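/- All manifolds and maps are holomorphic. In a Lie groupoid over a curve $X$ the source $s$ and the target $t$ are submersions, the product $gh$ is defined if $s(g)=t(h)$, the manifold of arrows is Hausdorff, and the identities $\mathrm{id}(X)$ form a closed embedded submanifold. Its Lie algebroid consists of the right-invariant vector fields tangent to the source fibres, with anchor given by the derivative of $t$ along the identities. The *twist* at $p\in X$ of a groupoid over $X$ whose arrows form a surface is obtained by blowing up the surface of arrows at the point $\mathrm{id}(p)$ and removing the proper transforms of the fibres $s^{-1}(p)$ and $t^{-1}(p)$; its source and target are the compositions of $s$ and $t$ with the blow-down map, and its identities are the proper transform of $\mathrm{id}(X)$. For $p\in\mathbb P^1$, let $\mathrm{Pair}(\mathbb P^1,k\cdot p)$ be the $k$-fold iterated twist at $p$ of the pair groupoid $\mathbb P^1\times\mathbb P^1$ (where $s(x,y)=y$, $t(x,y)=x$, $\mathrm{id}(x)=(x,x)$). Let $\mathcal T_{\mathbb P^1}(-k\cdot p)$ be the line bundle whose sections are the vector fields on $\mathbb P^1$ vanishing to order at least $k$ at $p$; it is a Lie algebroid under the Lie bracket, with anchor the inclusion into $\mathcal T_{\mathbb P^1}$. Its source-simply connected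 integration is denoted $\Pi(\mathbb P^1,k\cdot p)$. **Theorem.** Let $p\in\mathbb P^1$. 1. For every $k\ge 2$, the manifold $\mathrm{Pair}(\mathbb P^1,k\cdot p)$, with the above source, target and identities, carries exactly one structure of a Lie groupoid. 2. For every $k\ge2$ there is exactly one biholomorphic map $$\Phi_k:\ \mathrm{Pair}(\mathbb P^1,k\cdot p)\;\longrightarrow\;\mathrm{Tot}\big(\mathcal T_{\mathbb P^1}(-k\cdot p)\big)$$ that carries the source map to the bundle projection and the identities to the zero section, and whose derivative along the identities is the canonical identification of Lie algebroids: for every $x\in\mathbb P^1$ and every $v$ in the fibre of $\mathcal T_{\mathbb P^1}(-k\cdot p)$ at $x$, the derivative of $\tau\mapsto t(\Phi_k^{-1}(\tau v))$ at $\tau=0$ is the image of $v$ in $T_x\mathbb P^1$. 3. For every $k\ge2$ the groupoid $\mathrm{Pair}(\mathbb P^1,k\cdot p)$ is source-simply connected (its source fibres are connected and simply connected) and its anchor is an isomorphism of Lie algebroids from its Lie algebroid onto $\mathcal T_{\mathbb P^1}(-k\cdot p)$. Hence it is $\Pi(\mathbb P^1,k\cdot p)$. 4. For all $k\ge k'\ge2$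 the composition of blow-downs $\mathrm{Pair}(\mathbb P^1,k\cdot p)\to\mathrm{Pair}(\mathbb P^1,k'\cdot p)$ is a homomorphism of Lie groupoids over the identity of $\mathbb P^1$. Under $\Phi_k$ and $\Phi_{k'}$ it is the natural bundle map $\mathrm{Tot}(\mathcal T_{\mathbb P^1}(-k\cdot p))\to\mathrm{Tot}(\mathcal T_{\mathbb P^1}(-k'\cdot p))$ induced by the inclusion of sheaves. -/

import Mathlib

open Set Filter Topology Manifold ContDiff

noncomputable section

namespace PLine

/-- The affine coordinate `z` on `ℙ¹ ∖ {∞}`. -/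
def affineChart : OpenPartialHomeomorph (OnePoint ℂ) ℂ where
  toFun x := x.elim 0 id
  invFun z := (z : OnePoint ℂ)
  source := range ((↑) : ℂ → OnePoint ℂ)
  target := univ
  map_source' _ _ := mem_univ _
  map_target' z _ := mem_range_self z
  left_inv' := by rintro _ ⟨z, rfl⟩; rfl
  right_inv' _ _ := rfl
  open_source := OnePoint.isOpen_range_coe
  open_target := isOpen_univ
  continuousOn_toFun := by
    rintro _ ⟨z, rfl⟩
    refine ContinuousAt.continuousWithinAt (OnePoint.continuousAt_coe.2 ?_)
    exact continuousAt_id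
  continuousOn_invFun := OnePoint.continuous_coe.continuousOn

/-- The inversion `z ↦ 1 / z` of `ℙ¹`, exchanging `0` and `∞`. -/
def inv (x : OnePoint ℂ) : OnePoint ℂ :=
  x.elim ((0 : ℂ) : OnePoint ℂ) (fun z ↦ if z = 0 then OnePoint.infty else ((z⁻¹ : ℂ) : OnePoint ℂ))

theorem inv_inv_eq (x : OnePoint ℂ) : inv (inv x) = x := by
  induction x using OnePoint.rec with
  | infty => simp [inv]
  | coe z =>
    by_cases hz : z = 0 <;> simp [inv, hz]

theorem continuous_inv : Continuous inv := by
  rw [continuous_iff_continuousAt]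
  intro x
  induction x using OnePoint.rec with
  | infty =>
    rw [OnePoint.continuousAt_infty']
    have h : Tendsto (fun z : ℂ ↦ ((z⁻¹ : ℂ) : OnePoint ℂ)) (coclosedCompact ℂ)
        (𝓝 ((0 : ℂ) : OnePoint ℂ)) := by
      rw [coclosedCompact_eq_cocompact]
      exact (OnePoint.continuous_coe.tendsto 0).comp
        (Filter.tendsto_inv₀_cobounded.mono_left (Metric.cobounded_eq_cocompact (α := ℂ)).ge)
    refine h.congr' ?_
    have : ∀ᶠ z in coclosedCompact ℂ, z ≠ 0 := by
      rw [coclosedCompact_eq_cocompact]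
      exact (isCompact_singleton (x := (0 : ℂ))).compl_mem_cocompact
    filter_upwards [this] with z hz
    simp [inv, hz]
  | coe z =>
    rw [OnePoint.continuousAt_coe]
    by_cases hz : z = 0
    · subst hz
      have h0 : (inv ∘ ((↑) : ℂ → OnePoint ℂ)) 0 = OnePoint.infty := by simp [inv]
      rw [ContinuousAt, h0, ← nhdsNE_sup_pure, tendsto_sup]
      constructor
      · have h : Tendsto (fun z : ℂ ↦ ((z⁻¹ : ℂ) : OnePoint ℂ)) (𝓝[≠] 0) (𝓝 OnePoint.infty) := by
          refine OnePoint.tendsto_coe_infty.comp ?_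
          rw [coclosedCompact_eq_cocompact, ← Metric.cobounded_eq_cocompact]
          exact Filter.tendsto_inv₀_nhdsNE_zero
        refine h.congr' ?_
        filter_upwards [self_mem_nhdsWithin] with z hz
        simp [inv, show z ≠ 0 from hz]
      · rw [tendsto_pure_left]
        intro s hs
        rw [h0]
        exact mem_of_mem_nhds hs
    · have h : ContinuousAt (fun z : ℂ ↦ ((z⁻¹ : ℂ) : OnePoint ℂ)) z :=
        OnePoint.continuous_coe.continuousAt.comp (continuousAt_inv₀ hz)
      refine h.congr ?_
      filter_upwards [isOpen_ne.mem_nhds hz] with w hw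
      simp [inv, show w ≠ 0 from hw]

/-- The inversion as a homeomorphism. -/
def invHomeo : OnePoint ℂ ≃ₜ OnePoint ℂ where
  toFun := inv
  invFun := inv
  left_inv := inv_inv_eq
  right_inv := inv_inv_eq
  continuous_toFun := continuous_inv
  continuous_invFun := continuous_inv

/-- The affine coordinate `w = 1 / z` on `ℙ¹ ∖ {0}`. -/
def chartInfty : OpenPartialHomeomorph (OnePoint ℂ) ℂ :=
  invHomeo.transOpenPartialHomeomorph affineChart

/-- `ℙ¹`, as the Riemann sphere `ℂ ∪ {∞}`, with its two affine charts `z` and `1 / z`. -/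
instance : ChartedSpace ℂ (OnePoint ℂ) where
  atlas := {affineChart, chartInfty}
  chartAt x := x.elim chartInfty (fun _ ↦ affineChart)
  mem_chart_source x := by
    induction x using OnePoint.rec with
    | infty => exact ⟨0, by simp [invHomeo, inv]⟩
    | coe z => exact ⟨z, rfl⟩
  chart_mem_atlas x := by
    induction x using OnePoint.rec with
    | infty => exact Or.inr rfl
    | coe z => exact Or.inl rfl

instance : IsManifold 𝓘(ℂ, ℂ) ω (OnePoint ℂ) := by
  have key : ∀ z : ℂ, z ≠ 0 → ContDiffAt ℂ ω (fun z : ℂ ↦ (inv (z : OnePoint ℂ)).elim 0 id) z := by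
    intro z hz
    refine (contDiffAt_inv ℂ hz).congr_of_eventuallyEq ?_
    filter_upwards [isOpen_ne.mem_nhds hz] with w hw
    simp [inv, show w ≠ 0 from hw]
  have hne : ∀ z : ℂ, inv (z : OnePoint ℂ) ∈ range ((↑) : ℂ → OnePoint ℂ) → z ≠ 0 := by
    rintro z hz rfl
    simp [inv] at hz
  refine isManifold_of_contDiffOn _ _ _ ?_
  rintro e e' (rfl | rfl) (rfl | rfl) z hz
  · exact contDiffAt_id.contDiffWithinAt
  · refine (key z ?_).contDiffWithinAt
    exact hne z hz.1.2
  · refine (key z ?_).contDiffWithinAt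
    exact hne z hz.1.2
  · refine contDiffWithinAt_id.congr_of_mem (fun y hy ↦ ?_) hz
    simp only [mfld_simps, chartInfty, affineChart, invHomeo] at hy ⊢
    simp [inv_inv_eq]


theorem chartInfty_eq {x : OnePoint ℂ} (hx : x ∈ affineChart.source) :
    chartInfty x = (affineChart x)⁻¹ := by
  obtain ⟨z, rfl⟩ := hx
  change (inv z).elim 0 id = z⁻¹
  by_cases hz : z = 0 <;> simp [inv, hz]

theorem affineChart_ne_zero {x : OnePoint ℂ} (hx : x ∈ affineChart.source)
    (hx' : x ∈ chartInfty.source) : affineChart x ≠ 0 := by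
  obtain ⟨z, rfl⟩ := hx
  rintro (rfl : z = 0)
  obtain ⟨y, hy⟩ := hx'
  simp [invHomeo, inv] at hy

/-- The domains of the two affine charts. -/
def chartDomain (i : Bool) : Set (OnePoint ℂ) :=
  if i then chartInfty.source else affineChart.source

/-- The local equation of the point `p` in the two affine charts: if `ℓ` is the linear form on `ℂ²`
that vanishes on the line `p`, with `ℓ = Z - a * W` for `p = [a : 1]` and `ℓ = W` for `p = ∞`, this
is `ℓ / W` in the chart `z = Z / W` and `ℓ / Z` in the chart `w = W / Z`. -/
def localEqn (p : OnePoint ℂ) : Bool → OnePoint ℂ → ℂ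
  | false => fun x ↦ p.elim 1 (fun a ↦ affineChart x - a)
  | true => fun x ↦ p.elim (chartInfty x) (fun a ↦ 1 - a * chartInfty x)

theorem localEqn_false_eq (p : OnePoint ℂ) {x : OnePoint ℂ} (hx : x ∈ affineChart.source)
    (hx' : x ∈ chartInfty.source) :
    localEqn p false x = affineChart x * localEqn p true x := by
  have h := affineChart_ne_zero hx hx'
  induction p using OnePoint.rec with
  | infty => simp [localEqn, chartInfty_eq hx, h]
  | coe a =>
    simp only [localEqn, OnePoint.elim_some, chartInfty_eq hx]
    field_simp

/-- The transition functions of the line bundle `T(-k • p)`, with respect to the local frames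
`f₀ ^ k • ∂_z` and `f₁ ^ k • ∂_w`, where `f₀ = localEqn p false` and `f₁ = localEqn p true`. Since
`f₀ = z * f₁` and `∂_z = -z⁻² • ∂_w`, the coefficients satisfy `c₁ = -(z ^ k * z⁻²) * c₀`, and
symmetrically with `z` and `w` exchanged. -/
def twistedTransition (k : ℕ) : Bool → Bool → OnePoint ℂ → ℂ
  | false, true => fun x ↦ -(affineChart x ^ k * (affineChart x)⁻¹ ^ 2)
  | true, false => fun x ↦ -(chartInfty x ^ k * (chartInfty x)⁻¹ ^ 2)
  | _, _ => fun _ ↦ 1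

theorem contMDiffOn_twistedTransition (k : ℕ) (i j : Bool) :
    ContMDiffOn 𝓘(ℂ, ℂ) 𝓘(ℂ, ℂ) ω (twistedTransition k i j) (chartDomain i ∩ chartDomain j) := by
  have h0 : ContMDiffOn 𝓘(ℂ, ℂ) 𝓘(ℂ, ℂ) ω affineChart affineChart.source :=
    contMDiffOn_chart (x := ((0 : ℂ) : OnePoint ℂ))
  have h1 : ContMDiffOn 𝓘(ℂ, ℂ) 𝓘(ℂ, ℂ) ω chartInfty chartInfty.source :=
    contMDiffOn_chart (x := OnePoint.infty)
  have hF : ContDiffOn ℂ ω (fun z : ℂ ↦ -(z ^ k * z⁻¹ ^ 2)) {0}ᶜ := by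
    intro z hz
    exact (((contDiffAt_id.pow k).mul ((contDiffAt_inv ℂ hz).pow 2)).neg).contDiffWithinAt
  cases i <;> cases j
  · exact contMDiffOn_const
  · exact hF.contMDiffOn.comp (h0.mono inter_subset_left) fun x hx ↦ affineChart_ne_zero hx.1 hx.2
  · refine hF.contMDiffOn.comp (h1.mono inter_subset_left) fun x hx ↦ ?_
    simpa [chartInfty_eq hx.2] using affineChart_ne_zero hx.2 hx.1
  · exact contMDiffOn_const

/-- The holomorphic line bundle `T(-k • p)` on `ℙ¹`, whose sections are the vector fields vanishing
to order at least `k` at `p`: it is glued from the local frames `f₀ ^ k • ∂_z` and `f₁ ^ k • ∂_w`.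
The fibre at `x` is described in the frame of the preferred chart at `x`. The point `p` does not
enter the transition functions, but only the frames, and so the maps `toTangent` and
`natMap` below. -/
def twistedTangentCore (k : ℕ) : VectorBundleCore ℂ (OnePoint ℂ) ℂ Bool where
  baseSet := chartDomain
  isOpen_baseSet i := by
    cases i
    exacts [affineChart.open_source, chartInfty.open_source]
  indexAt x := x.elim true (fun _ ↦ false)
  mem_baseSet_at x := by
    induction x using OnePoint.rec with
    | infty => exact mem_chart_source ℂ OnePoint.infty
    | coe z => exact mem_chart_source ℂ (z : OnePoint ℂ)
  coordChange i j x := twistedTransition k i j x • ContinuousLinearMap.id ℂ ℂ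
  coordChange_self i x _ v := by cases i <;> simp [twistedTransition]
  continuousOn_coordChange i j :=
    (contMDiffOn_twistedTransition k i j).continuousOn.smul continuousOn_const
  coordChange_comp i j l x hx v := by
    have h : ∀ h0 : x ∈ affineChart.source, ∀ h1 : x ∈ chartInfty.source,
        twistedTransition k false true x * twistedTransition k true false x = 1 := by
      intro h0 h1
      have := affineChart_ne_zero h0 h1
      simp only [twistedTransition, chartInfty_eq h0, inv_pow]
      field_simp
    obtain ⟨⟨hi, hj⟩, hl⟩ := hx
    simp only [smul_apply, ContinuousLinearMap.id_apply, smul_eq_mul, ← mul_assoc]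
    congr 1
    cases i <;> cases j <;> cases l
    · simp [twistedTransition]
    · simp [twistedTransition]
    · rw [mul_comm, h hi hj]; rfl
    · simp [twistedTransition]
    · simp [twistedTransition]
    · rw [h hj hi]; rfl
    · simp [twistedTransition]
    · simp [twistedTransition]

instance (k : ℕ) : (twistedTangentCore k).IsContMDiff 𝓘(ℂ, ℂ) ω where
  contMDiffOn_coordChange i j := (contMDiffOn_twistedTransition k i j).smul contMDiffOn_const

/-- The total space of `T(-k • p)`. -/
abbrev Tot (k : ℕ) : Type := (twistedTangentCore k).TotalSpace

/-- The coefficient of a vector of `T(-k • p)` in the frame of the preferred chart. -/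
def Tot.coeff {k : ℕ} (v : Tot k) : ℂ := v.2

/-- The point of the total space of `T(-k • p)` over `x` with the given coefficient. -/
def Tot.mk {k : ℕ} (x : OnePoint ℂ) (a : ℂ) : Tot k := ⟨x, a⟩

/-- The local equation of `p`, in the preferred chart at `x`, evaluated at `x`. -/
def eqnAt (p x : OnePoint ℂ) : ℂ := localEqn p ((twistedTangentCore 0).indexAt x) x

/-- The natural bundle map `T(-k • p) → T`: it sends `f ^ k • ∂` to itself. -/
def toTangent (p : OnePoint ℂ) {k : ℕ} (v : Tot k) : TangentSpace 𝓘(ℂ, ℂ) v.proj :=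
  (eqnAt p v.proj ^ k * v.coeff : ℂ)

/-- The natural bundle map `T(-(k + n) • p) → T(-k • p)`: it sends `f ^ (k + n) • ∂` to
`f ^ n • (f ^ k • ∂)`. -/
def natMap (p : OnePoint ℂ) (k n : ℕ) (v : Tot (k + n)) : Tot k :=
  Tot.mk v.proj (eqnAt p v.proj ^ n * v.coeff)

end PLine

section Blowup

variable {M : Type} [TopologicalSpace M] [ChartedSpace (ℂ × ℂ) M]

/-- The blowup of a complex surface `M` at a point `c`: the points of `M` other than `c`, together
with the exceptional divisor `ℙ(T_c M)`. The tangent space `T_c M` is `ℂ × ℂ` through the preferred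
chart at `c`, as for `TangentSpace`. -/
inductive Blowup (c : M) : Type
  | off (m : M) (hm : m ≠ c) : Blowup c
  | exc (l : Projectivization ℂ (ℂ × ℂ)) : Blowup c

namespace Blowup

/-- The blow-down map. -/
def down (c : M) : Blowup c → M
  | off m _ => m
  | exc _ => c

/-- The coordinates of `m` in the preferred chart at `c`, recentred so that `c` has coordinates `0`. -/
def disp (c m : M) : ℂ × ℂ := chartAt (ℂ × ℂ) c m - chartAt (ℂ × ℂ) c c

/-- The point with the given recentred coordinates. -/
def undisp (c : M) (v : ℂ × ℂ) : M := (chartAt (ℂ × ℂ) c).symm (chartAt (ℂ × ℂ) c c + v)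

/-- The set of displacements occurring in the preferred chart at `c`. -/
def dispTarget (c : M) : Set (ℂ × ℂ) := {v | chartAt (ℂ × ℂ) c c + v ∈ (chartAt (ℂ × ℂ) c).target}

theorem undisp_disp {c m : M} (hm : m ∈ (chartAt (ℂ × ℂ) c).source) :
    undisp c (disp c m) = m := by
  simp [undisp, disp, (chartAt (ℂ × ℂ) c).left_inv hm]

theorem disp_undisp {c : M} {v : ℂ × ℂ} (hv : v ∈ dispTarget c) : disp c (undisp c v) = v := by
  simp [undisp, disp, (chartAt (ℂ × ℂ) c).right_inv hv]

theorem disp_self (c : M) : disp c c = 0 := by simp [disp]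

theorem undisp_zero (c : M) : undisp c 0 = c := by simp [undisp]

theorem disp_mem {c m : M} (hm : m ∈ (chartAt (ℂ × ℂ) c).source) : disp c m ∈ dispTarget c := by
  simpa [disp, dispTarget] using (chartAt (ℂ × ℂ) c).map_source hm

/-- A vector spanning the direction of a point of the blowup, as seen from `c`. -/
def vec (c : M) : Blowup c → ℂ × ℂ
  | off m _ => disp c m
  | exc l => l.rep

open Classical in
/-- The point of the blowup with displacement `a • v` and direction `v`. -/
def polar (c : M) (a : ℂ) (v : ℂ × ℂ) (hv : v ≠ 0) : Blowup c :=
  if h : undisp c (a • v) = c then exc (.mk ℂ v hv) else off (undisp c (a • v)) h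

theorem down_polar (c : M) (a : ℂ) (v : ℂ × ℂ) (hv : v ≠ 0) :
    down c (polar c a v hv) = undisp c (a • v) := by
  unfold polar
  split_ifs with h
  · exact h.symm
  · rfl

theorem vec_polar (c : M) {a : ℂ} {v : ℂ × ℂ} (hv : v ≠ 0) (h : a • v ∈ dispTarget c) :
    ∃ t : ℂ, t ≠ 0 ∧ vec c (polar c a v hv) = t • v := by
  unfold polar
  split_ifs with h'
  · obtain ⟨t, ht⟩ := Projectivization.exists_smul_eq_mk_rep ℂ v hv
    exact ⟨t, t.ne_zero, ht.symm⟩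
  · refine ⟨a, ?_, disp_undisp h⟩
    rintro rfl
    exact h' (by rw [zero_smul, undisp_zero])

theorem lin_symm_ne_zero (L : (ℂ × ℂ) ≃L[ℂ] (ℂ × ℂ)) (b : ℂ) : L.symm (1, b) ≠ 0 := by
  simp [Prod.ext_iff]

theorem smul_lin_symm (L : (ℂ × ℂ) ≃L[ℂ] (ℂ × ℂ)) {w : ℂ × ℂ} (h : (L w).1 ≠ 0) :
    (L w).1 • L.symm (1, (L w).2 / (L w).1) = w := by
  rw [← map_smul, ContinuousLinearEquiv.symm_apply_eq]
  ext
  · simp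
  · simp [mul_div_cancel₀ _ h]

/-- A chart `e` of `M`, as a chart of the blowup away from the exceptional divisor. -/
def chartOff (c : M) (e : OpenPartialHomeomorph M (ℂ × ℂ)) : PartialEquiv (Blowup c) (ℂ × ℂ) where
  toFun y := e (down c y)
  invFun v := open Classical in
    if h : e.symm v = c then exc (.mk ℂ (1, 0) (by simp)) else off (e.symm v) h
  source := {y | down c y ≠ c ∧ down c y ∈ e.source}
  target := {v | v ∈ e.target ∧ e.symm v ≠ c}
  map_source' := by
    rintro y ⟨h1, h2⟩
    exact ⟨e.map_source h2, by rwa [e.left_inv h2]⟩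
  map_target' := by
    rintro v ⟨h1, h2⟩
    rw [dif_neg h2]
    exact ⟨h2, e.map_target h1⟩
  left_inv' := by
    rintro (⟨m, hm⟩ | l) ⟨h1, h2⟩
    · have : e.symm (e m) = m := e.left_inv h2
      simp [down, this, hm]
    · exact absurd rfl h1
  right_inv' := by
    rintro v ⟨h1, h2⟩
    simp [h2, down, e.right_inv h1]

/-- The affine chart of the blowup attached to linear coordinates `L = (L₁, L₂)` on `T_c M`: the
pair `(L₁, L₂ / L₁)`, defined near the directions on which `L₁` does not vanish. The blow-down map
is `(a, b) ↦ (a, a * b)` in the coordinates `L`. -/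
def chartOn (c : M) (L : (ℂ × ℂ) ≃L[ℂ] (ℂ × ℂ)) : PartialEquiv (Blowup c) (ℂ × ℂ) where
  toFun y := ((L (disp c (down c y))).1, (L (vec c y)).2 / (L (vec c y)).1)
  invFun q := polar c q.1 (L.symm (1, q.2)) (lin_symm_ne_zero L q.2)
  source := {y | down c y ∈ (chartAt (ℂ × ℂ) c).source ∧ (L (vec c y)).1 ≠ 0}
  target := {q | q.1 • L.symm (1, q.2) ∈ dispTarget c}
  map_source' := by
    rintro (⟨m, hm⟩ | l) ⟨h1, h2⟩
    · have := smul_lin_symm L h2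
      simp only [vec] at this
      change _ ∈ dispTarget c
      simp only [down, vec, this]
      exact disp_mem h1
    · simp [down, disp_self, dispTarget]
  map_target' := by
    rintro ⟨a, b⟩ h
    obtain ⟨t, ht, ht'⟩ := vec_polar c (lin_symm_ne_zero L b) h
    refine ⟨?_, by simpa [ht'] using ht⟩
    rw [down_polar]
    exact (chartAt (ℂ × ℂ) c).map_target h
  left_inv' := by
    rintro (⟨m, hm⟩ | l) ⟨h1, h2⟩
    · have := smul_lin_symm L h2
      simp only [vec, down] at this h1 ⊢
      simp [polar, this, undisp_disp h1, hm]
    · have h0 : (L (disp c (down c (exc l)))).1 = 0 := by simp [down, disp_self]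
      rw [h0, polar, dif_pos (by rw [zero_smul, undisp_zero])]
      congr 1
      conv_rhs => rw [← l.mk_rep]
      rw [Projectivization.mk_eq_mk_iff']
      refine ⟨(L l.rep).1⁻¹, ?_⟩
      have h2 : (L l.rep).1 ≠ 0 := h2
      change (L l.rep).1⁻¹ • l.rep = L.symm (1, (L l.rep).2 / (L l.rep).1)
      rw [inv_smul_eq_iff₀ h2, smul_lin_symm L h2]
  right_inv' := by
    rintro ⟨a, b⟩ h
    obtain ⟨t, ht, ht'⟩ := vec_polar c (lin_symm_ne_zero L b) h
    simp only [ht', down_polar, disp_undisp h]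
    simp [ht]

/-- The charts of the blowup. -/
inductive IsChart (c : M) : PartialEquiv (Blowup c) (ℂ × ℂ) → Prop
  | off (e) (he : e ∈ atlas (ℂ × ℂ) M) : IsChart c (chartOff c e)
  | on (L) : IsChart c (chartOn c L)


theorem isOpen_dispTarget (c : M) : IsOpen (dispTarget c) :=
  (chartAt (ℂ × ℂ) c).open_target.preimage (continuous_const.add continuous_id)

theorem down_chartOff_symm (c : M) (e : OpenPartialHomeomorph M (ℂ × ℂ)) (v : ℂ × ℂ) :
    down c ((chartOff c e).symm v) = e.symm v := by
  simp only [chartOff, PartialEquiv.coe_symm_mk]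
  split_ifs with h
  · exact h.symm
  · rfl

theorem vec_chartOff_symm {c : M} {e : OpenPartialHomeomorph M (ℂ × ℂ)} {v : ℂ × ℂ}
    (h : e.symm v ≠ c) : vec c ((chartOff c e).symm v) = disp c (e.symm v) := by
  simp only [chartOff, PartialEquiv.coe_symm_mk, h, dite_false, vec]

theorem eventually_symm_ne {c : M} {e : OpenPartialHomeomorph M (ℂ × ℂ)} {v : ℂ × ℂ}
    (hv : v ∈ e.target) (h : e.symm v ≠ c) : ∀ᶠ w in 𝓝 v, e.symm w ≠ c := by
  by_cases hc : v = e c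
  · by_cases hcs : c ∈ e.source
    · exact absurd (by rw [hc, e.left_inv hcs]) h
    · filter_upwards [e.open_target.mem_nhds hv] with w hw hwc
      exact hcs (hwc ▸ e.map_target hw)
  · filter_upwards [e.open_target.mem_nhds hv, isOpen_ne.mem_nhds hc] with w hw hw' hwc
    exact hw' (by rw [← hwc, e.right_inv hw])

variable [IsManifold 𝓘(ℂ, ℂ × ℂ) ω M]

theorem contDiffAt_change {e e' : OpenPartialHomeomorph M (ℂ × ℂ)} (he : e ∈ atlas (ℂ × ℂ) M)
    (he' : e' ∈ atlas (ℂ × ℂ) M) {v : ℂ × ℂ} (hv : v ∈ e.target) (hv' : e.symm v ∈ e'.source) :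
    ContDiffAt ℂ ω (fun v ↦ e' (e.symm v)) v := by
  have h := (contDiffGroupoid ω 𝓘(ℂ, ℂ × ℂ)).compatible he he'
  rw [contDiffGroupoid, mem_groupoid_of_pregroupoid] at h
  have h1 := h.1
  have h2 : ContDiffOn ℂ ω (fun v ↦ e' (e.symm v)) (e.symm.trans e').source := by
    simpa [contDiffPregroupoid, Function.comp_def] using h1
  exact h2.contDiffAt ((e.symm.trans e').open_source.mem_nhds ⟨hv, hv'⟩)

theorem transition (c : M) {f f' : PartialEquiv (Blowup c) (ℂ × ℂ)} (hf : IsChart c f)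
    (hf' : IsChart c f') {v : ℂ × ℂ} (hv : v ∈ f.target ∧ f.symm v ∈ f'.source) :
    (∀ᶠ w in 𝓝 v, w ∈ f.target ∧ f.symm w ∈ f'.source) ∧
      ContDiffAt ℂ ω (fun w ↦ f' (f.symm w)) v := by
  have hφ := chart_mem_atlas (ℂ × ℂ) c
  obtain ⟨hv1, hv2⟩ := hv
  rcases hf with ⟨e, he⟩ | L <;> rcases hf' with ⟨e', he'⟩ | L'
  · have hs : e.symm v ∈ e'.source := by simpa only [down_chartOff_symm] using hv2.2
    have ho := (e.symm.trans e').open_source.mem_nhds ⟨hv1.1, hs⟩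
    constructor
    · filter_upwards [ho, eventually_symm_ne hv1.1 hv1.2] with w h1 h2
      exact ⟨⟨h1.1, h2⟩, by rwa [down_chartOff_symm], by rw [down_chartOff_symm]; exact h1.2⟩
    · refine (contDiffAt_change he he' hv1.1 hs).congr_of_eventuallyEq (.of_forall fun w ↦ ?_)
      exact congrArg e' (down_chartOff_symm c e w)
  · have hs : e.symm v ∈ (chartAt (ℂ × ℂ) c).source := by
      simpa only [down_chartOff_symm] using hv2.1
    have hd : ContDiffAt ℂ ω (fun w ↦ L' (disp c (e.symm w))) v :=
      L'.contDiff.contDiffAt.comp v ((contDiffAt_change he hφ hv1.1 hs).sub contDiffAt_const)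
    have h0 : (L' (disp c (e.symm v))).1 ≠ 0 := by
      have := hv2.2
      rwa [vec_chartOff_symm hv1.2] at this
    have ho := (e.symm.trans (chartAt (ℂ × ℂ) c)).open_source.mem_nhds ⟨hv1.1, hs⟩
    constructor
    · filter_upwards [ho, eventually_symm_ne hv1.1 hv1.2, 
        (continuous_fst.continuousAt.comp hd.continuousAt).eventually_ne h0] with w h1 h2 h3
      refine ⟨⟨h1.1, h2⟩, ?_, ?_⟩
      · rw [down_chartOff_symm]; exact h1.2
      · rw [vec_chartOff_symm h2]; exact h3
    · refine ((contDiff_fst.contDiffAt.comp v hd).prodMk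
        ((contDiff_snd.contDiffAt.comp v hd).div (contDiff_fst.contDiffAt.comp v hd)
          h0)).congr_of_eventuallyEq ?_
      filter_upwards [eventually_symm_ne hv1.1 hv1.2] with w h2
      change ((L' (disp c (down c ((chartOff c e).symm w)))).1, 
        (L' (vec c ((chartOff c e).symm w))).2 / (L' (vec c ((chartOff c e).symm w))).1) = _
      rw [vec_chartOff_symm h2, down_chartOff_symm]
      rfl
  · set d : ℂ × ℂ → ℂ × ℂ := fun q ↦ q.1 • L.symm (1, q.2) with hd_def
    have hd : ContDiff ℂ ω d := 
      contDiff_fst.smul (L.symm.contDiff.comp (contDiff_const.prodMk contDiff_snd))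
    have hdown : ∀ q, down c ((chartOn c L).symm q) = undisp c (d q) := fun q ↦ down_polar ..
    have ht : d v ∈ dispTarget c := hv1
    have hs : undisp c (d v) ∈ e'.source := hdown v ▸ hv2.2
    have hne : undisp c (d v) ≠ c := hdown v ▸ hv2.1
    have ho : ∀ᶠ w in 𝓝 v, chartAt (ℂ × ℂ) c c + d w ∈ ((chartAt (ℂ × ℂ) c).symm.trans e').source :=
      (continuous_const.add hd.continuous).continuousAt.eventually_mem
        (((chartAt (ℂ × ℂ) c).symm.trans e').open_source.mem_nhds ⟨ht, hs⟩)
    have hn : ∀ᶠ w in 𝓝 v, undisp c (d w) ≠ c :=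
      (continuous_const.add hd.continuous).continuousAt.eventually (eventually_symm_ne ht hne)
    constructor
    · filter_upwards [ho, hn] with w h1 h2
      refine ⟨h1.1, ?_, ?_⟩
      · rw [hdown]; exact h2
      · rw [hdown]; exact h1.2
    · refine ContDiffAt.congr_of_eventuallyEq (f := fun w ↦ e' (undisp c (d w))) ?_
        (.of_forall fun w ↦ congrArg e' (hdown w))
      exact ContDiffAt.comp (g := fun w ↦ e' ((chartAt (ℂ × ℂ) c).symm w)) v
        (contDiffAt_change hφ he' ht hs) (contDiff_const.add hd).contDiffAt
  · set d : ℂ × ℂ → ℂ × ℂ := fun q ↦ q.1 • L.symm (1, q.2) with hd_def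
    set u : ℂ × ℂ → ℂ × ℂ := fun q ↦ L' (L.symm (1, q.2)) with hu_def
    have hu : ContDiff ℂ ω u :=
      L'.contDiff.comp (L.symm.contDiff.comp (contDiff_const.prodMk contDiff_snd))
    have hd : ContDiff ℂ ω d := 
      contDiff_fst.smul (L.symm.contDiff.comp (contDiff_const.prodMk contDiff_snd))
    have hdown : ∀ q, down c ((chartOn c L).symm q) = undisp c (d q) := fun q ↦ down_polar ..
    have hvec : ∀ q, d q ∈ dispTarget c → ∃ t : ℂ, t ≠ 0 ∧
        L' (vec c ((chartOn c L).symm q)) = t • u q := by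
      intro q hq
      obtain ⟨t, h1, h2⟩ := vec_polar c (lin_symm_ne_zero L q.2) hq
      refine ⟨t, h1, ?_⟩
      rw [hu_def, ← map_smul]
      exact congrArg L' h2
    have h0 : (u v).1 ≠ 0 := by
      obtain ⟨t, h1, h2⟩ := hvec v hv1
      have := hv2.2
      rw [h2] at this
      exact right_ne_zero_of_mul this
    have ht : ∀ᶠ w in 𝓝 v, d w ∈ dispTarget c :=
      hd.continuous.continuousAt.eventually_mem ((isOpen_dispTarget c).mem_nhds hv1)
    constructor
    · filter_upwards [ht, (continuous_fst.comp hu.continuous).continuousAt.eventually_ne h0]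
        with w h1 h2
      obtain ⟨t, h3, h4⟩ := hvec w h1
      refine ⟨h1, ?_, ?_⟩
      · rw [hdown]; exact (chartAt (ℂ × ℂ) c).map_target h1
      · rw [h4]; exact mul_ne_zero h3 h2
    · refine ContDiffAt.congr_of_eventuallyEq
        (f := fun w ↦ ((L' (d w)).1, (u w).2 / (u w).1)) ?_ ?_
      · exact (contDiff_fst.comp (L'.contDiff.comp hd)).contDiffAt.prodMk
          ((contDiff_snd.comp hu).contDiffAt.div (contDiff_fst.comp hu).contDiffAt h0)
      · filter_upwards [ht] with w h1
        obtain ⟨t, h3, h4⟩ := hvec w h1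
        change ((L' (disp c (down c ((chartOn c L).symm w)))).1,
          (L' (vec c ((chartOn c L).symm w))).2 / (L' (vec c ((chartOn c L).symm w))).1) = _
        rw [h4, hdown, disp_undisp h1, Prod.smul_snd, Prod.smul_fst, smul_eq_mul, smul_eq_mul,
          mul_div_mul_left _ _ h3]

open Classical in
/-- The charts of the blowup, which glue to the structure of a complex manifold. -/
def core (c : M) : ChartedSpaceCore (ℂ × ℂ) (Blowup c) where
  atlas := {f | IsChart c f}
  chartAt y := match y with
    | off m _ => chartOff c (chartAt (ℂ × ℂ) m)
    | exc l => if l.rep.1 ≠ 0 then chartOn c (.refl ℂ _) else chartOn c (.prodComm ℂ ℂ ℂ)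
  mem_chart_source y := by
    cases y with
    | off m hm => exact ⟨hm, mem_chart_source _ m⟩
    | exc l =>
      dsimp only
      split_ifs with h
      · exact ⟨mem_chart_source _ c, h⟩
      · refine ⟨mem_chart_source _ c, fun h' ↦ l.rep_nonzero ?_⟩
        exact Prod.ext (not_not.1 h) h'
  chart_mem_atlas y := by
    cases y with
    | off m hm => exact .off _ (chart_mem_atlas _ m)
    | exc l =>
      dsimp only
      split_ifs
      exacts [.on _, .on _]
  open_source f f' hf hf' := by
    rw [isOpen_iff_mem_nhds]
    exact fun v hv ↦ (transition c hf hf' hv).1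
  continuousOn_toFun f f' hf hf' v hv :=
    (transition c hf hf' hv).2.continuousAt.continuousWithinAt

instance (c : M) : TopologicalSpace (Blowup c) := (core c).toTopologicalSpace

instance (c : M) : ChartedSpace (ℂ × ℂ) (Blowup c) := (core c).toChartedSpace

instance (c : M) : IsManifold 𝓘(ℂ, ℂ × ℂ) ω (Blowup c) := by
  refine isManifold_of_contDiffOn _ _ _ ?_
  intro f f' hf hf' v hv
  obtain ⟨f, h, rfl⟩ := mem_iUnion₂.1 hf
  obtain ⟨f', h', rfl⟩ := mem_iUnion₂.1 hf'
  exact (transition c h h' hv.1).2.contDiffWithinAt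

/-- A chart of the blowup as an open partial homeomorphism. -/
def chart (c : M) (f : PartialEquiv (Blowup c) (ℂ × ℂ)) (hf : IsChart c f) :
    OpenPartialHomeomorph (Blowup c) (ℂ × ℂ) :=
  (core c).openPartialHomeomorph f hf

theorem chart_mem (c : M) {f : PartialEquiv (Blowup c) (ℂ × ℂ)} (hf : IsChart c f) :
    chart c f hf ∈ IsManifold.maximalAtlas 𝓘(ℂ, ℂ × ℂ) ω (Blowup c) :=
  IsManifold.subset_maximalAtlas (mem_iUnion₂.2 ⟨f, hf, rfl⟩)

theorem exists_chartOn (c : M) (l : Projectivization ℂ (ℂ × ℂ)) :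
    ∃ L : (ℂ × ℂ) ≃L[ℂ] (ℂ × ℂ), (L l.rep).1 ≠ 0 := by
  by_cases h : l.rep.1 = 0
  · refine ⟨.prodComm ℂ ℂ ℂ, fun h' ↦ l.rep_nonzero (Prod.ext h h')⟩
  · exact ⟨.refl ℂ _, h⟩

theorem contMDiff_down (c : M) : ContMDiff 𝓘(ℂ, ℂ × ℂ) 𝓘(ℂ, ℂ × ℂ) ω (down c) := by
  intro y
  suffices h : ∃ f, ∃ hf : IsChart c f, y ∈ f.source ∧
      ContMDiffAt 𝓘(ℂ, ℂ × ℂ) 𝓘(ℂ, ℂ × ℂ) ω (fun v ↦ down c (f.symm v)) (f y) by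
    obtain ⟨f, hf, hy, h⟩ := h
    have h1 := contMDiffAt_of_mem_maximalAtlas (chart_mem c hf) (x := y) hy
    refine (ContMDiffAt.comp y (g := fun v ↦ down c (f.symm v)) h h1).congr_of_eventuallyEq ?_
    filter_upwards [(chart c f hf).open_source.mem_nhds hy] with z hz
    exact congrArg (down c) (f.left_inv hz).symm
  rcases y with ⟨m, hm⟩ | l
  · refine ⟨_, .off _ (chart_mem_atlas _ m), ⟨hm, mem_chart_source _ m⟩, ?_⟩
    simp only [down_chartOff_symm]
    exact contMDiffAt_symm_of_mem_maximalAtlas (IsManifold.chart_mem_maximalAtlas m)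
      (mem_chart_target _ m)
  · obtain ⟨L, hL⟩ := exists_chartOn c l
    have hs : exc l ∈ (chartOn c L).source := ⟨mem_chart_source _ c, hL⟩
    refine ⟨_, .on L, hs, ?_⟩
    have hd : ContDiff ℂ ω fun q : ℂ × ℂ ↦ chartAt (ℂ × ℂ) c c + q.1 • L.symm (1, q.2) :=
      contDiff_const.add
        (contDiff_fst.smul (L.symm.contDiff.comp (contDiff_const.prodMk contDiff_snd)))
    have ht := (chartOn c L).map_source hs
    have : (fun q ↦ down c ((chartOn c L).symm q)) =
        fun q ↦ (chartAt (ℂ × ℂ) c).symm (chartAt (ℂ × ℂ) c c + q.1 • L.symm (1, q.2)) :=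
      funext fun q ↦ down_polar ..
    rw [this]
    exact ContMDiffAt.comp (g := (chartAt (ℂ × ℂ) c).symm) _
      (contMDiffAt_symm_of_mem_maximalAtlas (IsManifold.chart_mem_maximalAtlas c) ht)
      hd.contMDiff.contMDiffAt

section
variable {X : Type} [TopologicalSpace X] [ChartedSpace ℂ X]

/-- A direction along which `σ` has nonzero derivative is not in the proper transform of a fibre. -/
theorem exc_notMem_closure {c : M} {p : X} {σ : M → X}
    (hσ : MDifferentiableAt 𝓘(ℂ, ℂ × ℂ) 𝓘(ℂ, ℂ) σ c) (hσc : σ c = p)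
    {v : ℂ × ℂ} (hv : v ≠ 0) (hv' : (mfderiv 𝓘(ℂ, ℂ × ℂ) 𝓘(ℂ, ℂ) σ c : ℂ × ℂ →L[ℂ] ℂ) v ≠ 0) :
    exc (.mk ℂ v hv) ∉ closure (down c ⁻¹' (σ ⁻¹' {p} \ {c})) := by
  set l : Projectivization ℂ (ℂ × ℂ) := .mk ℂ v hv with hl
  obtain ⟨L, hL⟩ := exists_chartOn c l
  have hs : exc l ∈ (chartOn c L).source := ⟨mem_chart_source _ c, hL⟩
  set D : ℂ × ℂ →L[ℂ] ℂ := mfderiv 𝓘(ℂ, ℂ × ℂ) 𝓘(ℂ, ℂ) σ c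
  set φ := chartAt (ℂ × ℂ) c with hφ
  set g : ℂ × ℂ → ℂ := fun x ↦ chartAt ℂ (σ c) (σ (φ.symm x)) with hg
  have hD : HasFDerivAt g D (φ c) := by
    have := hσ.hasMFDerivAt.2
    simp only [writtenInExtChartAt, mfld_simps] at this
    exact this.hasFDerivAt Filter.univ_mem
  have hDl : D l.rep ≠ 0 := by
    obtain ⟨t, ht⟩ := Projectivization.exists_smul_eq_mk_rep ℂ v hv
    rw [hl, ← ht, Units.smul_def, map_smul]
    exact mul_ne_zero t.ne_zero hv'
  set f := chart c _ (.on L) with hf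
  -- the direction of nearby points
  set w : Blowup c → ℂ × ℂ := fun z ↦ L.symm (1, (f z).2) with hw
  have hfc : ContinuousAt f (exc l) := f.continuousAt hs
  have hwc : ContinuousAt w (exc l) :=
    L.symm.continuous.continuousAt.comp (continuousAt_const.prodMk hfc.snd)
  have hw0 : D (w (exc l)) ≠ 0 := by
    have h1 : w (exc l) = (L l.rep).1⁻¹ • l.rep := by
      rw [eq_inv_smul_iff₀ hL]
      exact smul_lin_symm L hL
    rw [h1, map_smul]
    exact mul_ne_zero (inv_ne_zero hL) hDl
  obtain ⟨ε, hε, hε'⟩ : ∃ ε : ℝ, 0 < ε ∧ ε * ‖w (exc l)‖ < ‖D (w (exc l))‖ := by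
    have h0 := norm_pos_iff.2 hw0
    refine ⟨‖D (w (exc l))‖ / (‖w (exc l)‖ + 1), by positivity, ?_⟩
    rw [div_mul_eq_mul_div, div_lt_iff₀ (by positivity)]
    nlinarith
  have h1 : ∀ᶠ z in 𝓝 (exc l), ε * ‖w z‖ < ‖D (w z)‖ :=
    (continuousAt_const.mul hwc.norm).eventually_lt (D.continuous.continuousAt.comp hwc).norm hε'
  have h2 : ∀ᶠ z in 𝓝 (exc l), ‖g (φ (down c z)) - g (φ c) - D (φ (down c z) - φ c)‖ ≤
      ε * ‖φ (down c z) - φ c‖ := by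
    have hc : Tendsto (fun z ↦ φ (down c z)) (𝓝 (exc l)) (𝓝 (φ c)) :=
      (φ.continuousAt (mem_chart_source _ c)).tendsto.comp
        (contMDiff_down c).continuous.continuousAt.tendsto
    exact hc.eventually (hD.isLittleO.def hε)
  have h3 : ∀ᶠ z in 𝓝 (exc l), z ∈ (chartOn c L).source := f.open_source.mem_nhds hs
  rw [mem_closure_iff_frequently, not_frequently]
  filter_upwards [h1, h2, h3] with z h1 h2 h3 ⟨h4, h5⟩
  have h6 : g (φ (down c z)) = g (φ c) := by
    have h4 : σ (down c z) = p := h4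
    simp only [hg, hφ, (chartAt (ℂ × ℂ) c).left_inv (mem_chart_source _ c)]
    rw [← hφ, φ.left_inv h3.1, h4, hσc]
  have h7 : φ (down c z) - φ c = (f z).1 • w z := by
    exact (congrArg (disp c) ((congrArg (down c) ((chartOn c L).left_inv h3).symm).trans
      (down_polar ..))).trans (disp_undisp ((chartOn c L).map_source h3))
  have h8 : (f z).1 ≠ 0 := by
    intro h0
    rw [h0, zero_smul, sub_eq_zero] at h7
    exact h5 (φ.injOn h3.1 (mem_chart_source _ c) h7)
  rw [h6, sub_self, zero_sub, norm_neg, h7, map_smul, norm_smul, norm_smul] at h2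
  have h9 := norm_pos_iff.2 h8
  nlinarith

theorem off_notMem_closure [T1Space X] {c : M} {p : X} {σ : M → X} (hσ : Continuous σ)
    {m : M} (hm : m ≠ c) (hmp : σ m ≠ p) :
    off m hm ∉ closure (down c ⁻¹' (σ ⁻¹' {p} \ {c})) := by
  intro h
  have hcl : IsClosed (down c ⁻¹' (σ ⁻¹' {p})) :=
    (isClosed_singleton.preimage hσ).preimage (contMDiff_down c).continuous
  exact hmp (closure_minimal (preimage_mono sdiff_subset) hcl h)

/-- The velocity of a curve `γ` at `p`. -/
def velocity (γ : X → M) (p : X) : ℂ × ℂ := mfderiv 𝓘(ℂ, ℂ) 𝓘(ℂ, ℂ × ℂ) γ p (1 : ℂ)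

/-- The proper transform of a curve `γ` with nonzero velocity at `p`. -/
def lift (γ : X → M) (p : X) (hv : velocity γ p ≠ 0) (x : X) : Blowup (γ p) :=
  open Classical in if h : γ x = γ p then exc (.mk ℂ (velocity γ p) hv) else off (γ x) h

theorem down_lift (γ : X → M) (p : X) (hv : velocity γ p ≠ 0) (x : X) :
    down (γ p) (lift γ p hv x) = γ x := by
  unfold lift
  split_ifs with h
  · exact h.symm
  · rfl

theorem analyticAt_dslope {f : ℂ → ℂ} {z : ℂ} (hf : AnalyticAt ℂ f z) :
    AnalyticAt ℂ (dslope f z) z := by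
  obtain ⟨P, hP⟩ := hf
  exact hP.has_fpower_series_dslope_fslope.analyticAt

theorem contMDiff_lift [IsManifold 𝓘(ℂ, ℂ) ω X] {γ : X → M} {p : X}
    (hγ : ContMDiff 𝓘(ℂ, ℂ) 𝓘(ℂ, ℂ × ℂ) ω γ) (hv : velocity γ p ≠ 0)
    (hinj : ∀ x, γ x = γ p → x = p) [T1Space X] :
    ContMDiff 𝓘(ℂ, ℂ) 𝓘(ℂ, ℂ × ℂ) ω (lift γ p hv) := by
  intro x
  suffices h : ∃ f, ∃ hf : IsChart (γ p) f, ∃ H : X → ℂ × ℂ,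
      (∀ᶠ z in 𝓝 x, lift γ p hv z ∈ f.source ∧ f (lift γ p hv z) = H z) ∧
      ContMDiffAt 𝓘(ℂ, ℂ) 𝓘(ℂ, ℂ × ℂ) ω H x by
    obtain ⟨f, hf, H, h, hH⟩ := h
    have h0 := h.self_of_nhds
    have h1 := contMDiffAt_symm_of_mem_maximalAtlas (chart_mem (γ p) hf) (x := H x)
      (h0.2 ▸ f.map_source h0.1)
    refine (ContMDiffAt.comp x (g := (chart (γ p) f hf).symm) h1 hH).congr_of_eventuallyEq ?_
    filter_upwards [h] with z hz
    exact ((f.left_inv hz.1).symm.trans (congrArg f.symm hz.2))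
  by_cases hx : x = p
  · subst hx
    set c := γ x with hc
    set l : Projectivization ℂ (ℂ × ℂ) := .mk ℂ (velocity γ x) hv with hl
    obtain ⟨L, hL⟩ := exists_chartOn c l
    set φ := chartAt (ℂ × ℂ) c with hφ
    set χ := chartAt ℂ x with hχ
    set Γ : ℂ → ℂ × ℂ := fun ζ ↦ L (disp c (γ (χ.symm ζ))) with hΓ
    have hΓa : ContDiffAt ℂ ω Γ (χ x) := by
      have h1 := (contMDiffAt_iff.1 (hγ x)).2
      simp only [mfld_simps, contDiffWithinAt_univ] at h1
      exact L.contDiff.contDiffAt.comp (χ x) (h1.sub contDiffAt_const)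
    have hΓ0 : Γ (χ x) = 0 := by
      simp [hΓ, hχ, ← hc, disp_self]
    have hΓd : HasDerivAt Γ (L (velocity γ x)) (χ x) := by
      have h1 := ((hγ x).mdifferentiableAt (by simp)).hasMFDerivAt.2
      simp only [writtenInExtChartAt, mfld_simps] at h1
      set D : ℂ →L[ℂ] ℂ × ℂ := mfderiv 𝓘(ℂ, ℂ) 𝓘(ℂ, ℂ × ℂ) γ x with hD
      have h2 : HasFDerivAt (φ ∘ γ ∘ χ.symm) D (χ x) := h1.hasFDerivAt Filter.univ_mem
      have h3 : HasDerivAt (φ ∘ γ ∘ χ.symm) (D 1) (χ x) := h2.hasDerivAt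
      exact L.hasFDerivAt.comp_hasDerivAt (χ x) (h3.sub_const (φ c))
    have hvL : (L (velocity γ x)).1 ≠ 0 := by
      obtain ⟨t, ht⟩ := Projectivization.exists_smul_eq_mk_rep ℂ _ hv
      intro h0
      apply hL
      rw [hl, ← ht, Units.smul_def, map_smul, Prod.smul_fst, h0, smul_zero]
    set Γ1 : ℂ → ℂ := fun ζ ↦ (Γ ζ).1 
    set Γ2 : ℂ → ℂ := fun ζ ↦ (Γ ζ).2
    have hΓ1 : ContDiffAt ℂ ω Γ1 (χ x) := contDiff_fst.contDiffAt.comp _ hΓa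
    have hΓ2 : ContDiffAt ℂ ω Γ2 (χ x) := contDiff_snd.contDiffAt.comp _ hΓa
    have hs1 : ContDiffAt ℂ ω (dslope Γ1 (χ x)) (χ x) :=
      (analyticAt_dslope (ContDiffAt.analyticAt hΓ1)).contDiffAt
    have hs2 : ContDiffAt ℂ ω (dslope Γ2 (χ x)) (χ x) :=
      (analyticAt_dslope (ContDiffAt.analyticAt hΓ2)).contDiffAt
    have hd1 : dslope Γ1 (χ x) (χ x) = (L (velocity γ x)).1 := by
      rw [dslope_same]; exact ((hasFDerivAt_fst (p := Γ (χ x))).comp_hasDerivAt (χ x) hΓd).deriv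
    have hd2 : dslope Γ2 (χ x) (χ x) = (L (velocity γ x)).2 := by
      rw [dslope_same]; exact ((hasFDerivAt_snd (p := Γ (χ x))).comp_hasDerivAt (χ x) hΓd).deriv
    have hne : dslope Γ1 (χ x) (χ x) ≠ 0 := hd1 ▸ hvL
    refine ⟨_, .on L, (fun ζ ↦ (Γ1 ζ, dslope Γ2 (χ x) ζ / dslope Γ1 (χ x) ζ)) ∘ χ, ?_, ?_⟩
    · have hχc : ContinuousAt χ x := χ.continuousAt (mem_chart_source _ x)
      filter_upwards [χ.open_source.mem_nhds (mem_chart_source _ x),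
        hγ.continuous.continuousAt.eventually_mem (φ.open_source.mem_nhds (mem_chart_source _ c)),
        (hs1.continuousAt.comp hχc).eventually_ne hne] with z h1 h2 h3
      by_cases hz : z = x
      · subst hz
        have h4 : lift γ z hv z = exc l := dif_pos rfl
        rw [h4]
        refine ⟨⟨mem_chart_source _ c, hL⟩, Prod.ext ?_ ?_⟩
        · change (L (disp c c)).1 = (Γ (χ z)).1
          rw [disp_self, hΓ0, map_zero]
        · change (L l.rep).2 / (L l.rep).1 = dslope Γ2 (χ z) (χ z) / dslope Γ1 (χ z) (χ z)
          rw [hd1, hd2]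
          obtain ⟨t, ht⟩ := Projectivization.exists_smul_eq_mk_rep ℂ _ hv
          rw [hl, ← ht, Units.smul_def, map_smul, Prod.smul_fst, Prod.smul_snd, smul_eq_mul,
            smul_eq_mul, mul_div_mul_left _ _ t.ne_zero]
      · have hγz : γ z ≠ γ x := fun h ↦ hz (hinj z h)
        have h4 : lift γ x hv z = off (γ z) hγz := dif_neg hγz
        have h5 : χ z ≠ χ x := fun h ↦ hz (χ.injOn h1 (mem_chart_source _ x) h)
        have h6 : Γ (χ z) = L (disp c (γ z)) := by simp only [hΓ, χ.left_inv h1]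
        have h7 : ∀ F : ℂ → ℂ, F (χ x) = 0 → F (χ z) = (χ z - χ x) * dslope F (χ x) (χ z) := by
          intro F hF
          rw [← smul_eq_mul, sub_smul_dslope, hF, sub_zero]
        have h8 : (L (disp c (γ z))).1 = (χ z - χ x) * dslope Γ1 (χ x) (χ z) := by
          rw [← h7 Γ1 (by simp only [Γ1, hΓ0, Prod.fst_zero])]
          exact congrArg Prod.fst h6.symm
        have h9 : (L (disp c (γ z))).2 = (χ z - χ x) * dslope Γ2 (χ x) (χ z) := by
          rw [← h7 Γ2 (by simp only [Γ2, hΓ0, Prod.snd_zero])]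
          exact congrArg Prod.snd h6.symm
        rw [h4]
        refine ⟨⟨h2, ?_⟩, Prod.ext ?_ ?_⟩
        · change (L (disp c (γ z))).1 ≠ 0
          rw [h8]
          exact mul_ne_zero (sub_ne_zero.2 h5) h3
        · change (L (disp c (γ z))).1 = (Γ (χ z)).1
          rw [h6]
        · change (L (disp c (γ z))).2 / (L (disp c (γ z))).1 = _
          rw [h8, h9, mul_div_mul_left _ _ (sub_ne_zero.2 h5)]
          rfl
    · refine ContMDiffAt.comp x ?_
        (contMDiffAt_of_mem_maximalAtlas (IsManifold.chart_mem_maximalAtlas x)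
          (mem_chart_source _ x))
      exact (hΓ1.prodMk (hs2.div hs1 hne)).contMDiffAt
  · have hγx : γ x ≠ γ p := fun h ↦ hx (hinj x h)
    refine ⟨_, .off _ (chart_mem_atlas _ (γ x)), fun z ↦ chartAt (ℂ × ℂ) (γ x) (γ z), ?_, ?_⟩
    · filter_upwards [isOpen_ne.mem_nhds hx, hγ.continuous.continuousAt.eventually_mem
        ((chartAt (ℂ × ℂ) (γ x)).open_source.mem_nhds (mem_chart_source _ _))] with z h1 h2
      have h4 : down (γ p) (lift γ p hv z) = γ z := down_lift γ p hv z
      refine ⟨⟨?_, ?_⟩, congrArg _ h4⟩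
      · rw [h4]; exact fun h ↦ h1 (hinj z h)
      · rw [h4]; exact h2
    · exact ContMDiffAt.comp x (contMDiffAt_of_mem_maximalAtlas
        (IsManifold.chart_mem_maximalAtlas (γ x)) (mem_chart_source _ _)) (hγ x)

end
end Blowup

end Blowup

/-- A holomorphic reflexive graph over the curve `X` whose arrows form a complex surface: all the
data of a holomorphic Lie groupoid over `X` except the composition and the inversion. -/
structure ReflGraph (X : Type) [TopologicalSpace X] [ChartedSpace ℂ X] where
  Arrow : Type
  [top : TopologicalSpace Arrow]
  [charted : ChartedSpace (ℂ × ℂ) Arrow]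
  [mfld : IsManifold 𝓘(ℂ, ℂ × ℂ) ω Arrow]
  s : Arrow → X
  t : Arrow → X
  one : X → Arrow
  contMDiff_s : ContMDiff 𝓘(ℂ, ℂ × ℂ) 𝓘(ℂ, ℂ) ω s
  contMDiff_t : ContMDiff 𝓘(ℂ, ℂ × ℂ) 𝓘(ℂ, ℂ) ω t
  contMDiff_one : ContMDiff 𝓘(ℂ, ℂ) 𝓘(ℂ, ℂ × ℂ) ω one
  s_one : ∀ x, s (one x) = x
  t_one : ∀ x, t (one x) = x

namespace ReflGraph

attribute [instance] top charted mfld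

variable {X : Type} [TopologicalSpace X] [ChartedSpace ℂ X]

/-- The pair groupoid `X × X`: an arrow `(x, y)` has source `y` and target `x`, and the identities
are the diagonal. -/
def pair (X : Type) [TopologicalSpace X] [ChartedSpace ℂ X] [IsManifold 𝓘(ℂ, ℂ) ω X] :
    ReflGraph X where
  Arrow := X × X
  charted := inferInstanceAs (ChartedSpace (ModelProd ℂ ℂ) (X × X))
  mfld := by
    rw [modelWithCornersSelf_prod]
    exact inferInstanceAs (IsManifold (𝓘(ℂ, ℂ).prod 𝓘(ℂ, ℂ)) ω (X × X))
  s := Prod.snd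
  t := Prod.fst
  one x := (x, x)
  contMDiff_s := by
    rw [modelWithCornersSelf_prod]
    exact contMDiff_snd
  contMDiff_t := by
    rw [modelWithCornersSelf_prod]
    exact contMDiff_fst
  contMDiff_one := by
    rw [modelWithCornersSelf_prod]
    exact contMDiff_id.prodMk contMDiff_id
  s_one _ := rfl
  t_one _ := rfl

variable (Q : ReflGraph X) (p : X)

/-- The union of the proper transforms, in the blowup at the identity arrow over `p`, of the source
fibre and of the target fibre over `p`. A proper transform is the closure of the preimage of the
complement of the centre. -/
def removed : Set (Blowup (Q.one p)) :=
  closure (Blowup.down (Q.one p) ⁻¹' (Q.s ⁻¹' {p} \ {Q.one p})) ∪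
    closure (Blowup.down (Q.one p) ⁻¹' (Q.t ⁻¹' {p} \ {Q.one p}))

/-- The arrows of the twist at `p`: the blowup at the identity arrow over `p` with the proper
transforms of the source fibre and of the target fibre removed. -/
def twistArrow : TopologicalSpace.Opens (Blowup (Q.one p)) :=
  ⟨(Q.removed p)ᶜ, (isClosed_closure.union isClosed_closure).isOpen_compl⟩

theorem one_injective {x y : X} (h : Q.one x = Q.one y) : x = y := by
  rw [← Q.s_one x, h, Q.s_one]

theorem mfderiv_velocity_ne_zero {σ : Q.Arrow → X} (hσ : ContMDiff 𝓘(ℂ, ℂ × ℂ) 𝓘(ℂ, ℂ) ω σ)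
    (h : ∀ x, σ (Q.one x) = x) :
    (mfderiv 𝓘(ℂ, ℂ × ℂ) 𝓘(ℂ, ℂ) σ (Q.one p) : ℂ × ℂ →L[ℂ] ℂ) (Blowup.velocity Q.one p) ≠ 0 := by
  have h1 : HasMFDerivAt 𝓘(ℂ, ℂ) 𝓘(ℂ, ℂ) (σ ∘ Q.one) p
      ((mfderiv 𝓘(ℂ, ℂ × ℂ) 𝓘(ℂ, ℂ) σ (Q.one p)).comp (mfderiv 𝓘(ℂ, ℂ) 𝓘(ℂ, ℂ × ℂ) Q.one p)) :=
    ((hσ _).mdifferentiableAt (by simp)).hasMFDerivAt.comp p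
      ((Q.contMDiff_one p).mdifferentiableAt (by simp)).hasMFDerivAt
  have h2 := (h1.congr_of_eventuallyEq (f₁ := id) (.of_forall fun x ↦ (h x).symm)).mfderiv
  rw [mfderiv_id] at h2
  intro h0
  exact one_ne_zero (α := ℂ) ((DFunLike.congr_fun h2 (1 : ℂ)).trans h0)

theorem velocity_one_ne_zero : Blowup.velocity Q.one p ≠ 0 := by
  intro h
  have := Q.mfderiv_velocity_ne_zero p Q.contMDiff_s Q.s_one
  rw [h] at this
  exact this (ContinuousLinearMap.map_zero _)

theorem lift_one_mem [T1Space X] (x : X) :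
    Blowup.lift Q.one p (Q.velocity_one_ne_zero p) x ∈ Q.twistArrow p := by
  change _ ∉ closure _ ∪ closure _
  unfold Blowup.lift
  split_ifs with h
  · rintro (h' | h')
    · refine Blowup.exc_notMem_closure ((Q.contMDiff_s _).mdifferentiableAt (by simp))
        (Q.s_one p) _ (Q.mfderiv_velocity_ne_zero p Q.contMDiff_s Q.s_one) h'
    · refine Blowup.exc_notMem_closure ((Q.contMDiff_t _).mdifferentiableAt (by simp))
        (Q.t_one p) _ (Q.mfderiv_velocity_ne_zero p Q.contMDiff_t Q.t_one) h'
  · have hx : x ≠ p := fun h' ↦ h (congrArg Q.one h')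
    rintro (h' | h')
    · exact Blowup.off_notMem_closure Q.contMDiff_s.continuous h (by rwa [Q.s_one]) h'
    · exact Blowup.off_notMem_closure Q.contMDiff_t.continuous h (by rwa [Q.t_one]) h'

/-- The blow-down map of the twist. -/
def blowdown (g : Q.twistArrow p) : Q.Arrow := Blowup.down (Q.one p) g.1

theorem contMDiff_blowdown : ContMDiff 𝓘(ℂ, ℂ × ℂ) 𝓘(ℂ, ℂ × ℂ) ω (Q.blowdown p) :=
  (Blowup.contMDiff_down (Q.one p)).comp contMDiff_subtype_val

/-- The twist at `p`. Source and target are those of the blow-down, and the identities are the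
proper transform of the identities. -/
def twist [T1Space X] [IsManifold 𝓘(ℂ, ℂ) ω X] : ReflGraph X where
  Arrow := Q.twistArrow p
  s := Q.s ∘ Q.blowdown p
  t := Q.t ∘ Q.blowdown p
  one x := ⟨Blowup.lift Q.one p (Q.velocity_one_ne_zero p) x, Q.lift_one_mem p x⟩
  contMDiff_s := Q.contMDiff_s.comp (Q.contMDiff_blowdown p)
  contMDiff_t := Q.contMDiff_t.comp (Q.contMDiff_blowdown p)
  contMDiff_one x := by
    have := Blowup.contMDiff_lift Q.contMDiff_one (Q.velocity_one_ne_zero p)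
      (fun x h ↦ Q.one_injective h) x
    exact (ChartedSpace.liftPropWithinAt_subtypeVal_comp_iff _ _ _).1 this
  s_one x := (congrArg Q.s (Blowup.down_lift ..)).trans (Q.s_one x)
  t_one x := (congrArg Q.t (Blowup.down_lift ..)).trans (Q.t_one x)

end ReflGraph

section Groupoid

variable {X : Type} [TopologicalSpace X] [ChartedSpace ℂ X]

/-- A structure of holomorphic Lie groupoid on a holomorphic reflexive graph over `X`. The product
`mul g h` is meaningful only if `s g = t h`, and it is required to be holomorphic on the fibre
product of `s` and `t`, that is to be there locally the restriction of a holomorphic map. -/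
structure LieGroupoid (Q : ReflGraph X) where
  mul : Q.Arrow → Q.Arrow → Q.Arrow
  inv : Q.Arrow → Q.Arrow
  s_mul : ∀ g h, Q.s g = Q.t h → Q.s (mul g h) = Q.s h
  t_mul : ∀ g h, Q.s g = Q.t h → Q.t (mul g h) = Q.t g
  mul_assoc : ∀ g h k, Q.s g = Q.t h → Q.s h = Q.t k → mul (mul g h) k = mul g (mul h k)
  one_mul : ∀ g, mul (Q.one (Q.t g)) g = g
  mul_one : ∀ g, mul g (Q.one (Q.s g)) = g
  s_inv : ∀ g, Q.s (inv g) = Q.t g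
  t_inv : ∀ g, Q.t (inv g) = Q.s g
  mul_inv : ∀ g, mul g (inv g) = Q.one (Q.t g)
  inv_mul : ∀ g, mul (inv g) g = Q.one (Q.s g)
  t2Space : T2Space Q.Arrow
  submersion_s : ∀ g, Function.Surjective (mfderiv 𝓘(ℂ, ℂ × ℂ) 𝓘(ℂ, ℂ) Q.s g)
  submersion_t : ∀ g, Function.Surjective (mfderiv 𝓘(ℂ, ℂ × ℂ) 𝓘(ℂ, ℂ) Q.t g)
  isClosedEmbedding_one : IsClosedEmbedding Q.one
  contMDiffOn_mul :
    ContMDiffOn (𝓘(ℂ, ℂ × ℂ).prod 𝓘(ℂ, ℂ × ℂ)) 𝓘(ℂ, ℂ × ℂ) ω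
      (fun q : Q.Arrow × Q.Arrow ↦ mul q.1 q.2) {q | Q.s q.1 = Q.t q.2}
  contMDiff_inv : ContMDiff 𝓘(ℂ, ℂ × ℂ) 𝓘(ℂ, ℂ × ℂ) ω inv

namespace LieGroupoid

variable {Q Q' : ReflGraph X}

/-- A morphism of holomorphic Lie groupoids over the identity of `X`. -/
structure IsMorphism (G : LieGroupoid Q) (G' : LieGroupoid Q') (F : Q.Arrow → Q'.Arrow) :
    Prop where
  contMDiff : ContMDiff 𝓘(ℂ, ℂ × ℂ) 𝓘(ℂ, ℂ × ℂ) ω F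
  map_s : ∀ g, Q'.s (F g) = Q.s g
  map_t : ∀ g, Q'.t (F g) = Q.t g
  map_one : ∀ x, F (Q.one x) = Q'.one x
  map_mul : ∀ g h, Q.s g = Q.t h → F (G.mul g h) = G'.mul (F g) (F h)

/-- `ξ` is a section over `V ⊆ X` of the Lie algebroid of `G`: a holomorphic vector field on the
arrows with target in `V`, tangent to the source fibres, and right-invariant. The right translation
by `h` is defined on the source fibre over `t h`. -/
structure IsAlgebroidSection (G : LieGroupoid Q) (V : Set X)
    (ξ : (g : Q.Arrow) → TangentSpace 𝓘(ℂ, ℂ × ℂ) g) : Prop where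
  contMDiffOn : ContMDiffOn 𝓘(ℂ, ℂ × ℂ) 𝓘(ℂ, ℂ × ℂ).tangent ω
    (fun g ↦ (⟨g, ξ g⟩ : TangentBundle 𝓘(ℂ, ℂ × ℂ) Q.Arrow)) (Q.t ⁻¹' V)
  vertical : ∀ g, Q.t g ∈ V → mfderiv 𝓘(ℂ, ℂ × ℂ) 𝓘(ℂ, ℂ) Q.s g (ξ g) = 0
  right_invariant : ∀ g h, Q.t g ∈ V → Q.s g = Q.t h →
    ∀ A : TangentSpace 𝓘(ℂ, ℂ × ℂ) g →L[ℂ] TangentSpace 𝓘(ℂ, ℂ × ℂ) (G.mul g h),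
      HasMFDerivWithinAt 𝓘(ℂ, ℂ × ℂ) 𝓘(ℂ, ℂ × ℂ) (fun g' ↦ G.mul g' h) {g' | Q.s g' = Q.t h} g A →
        A (ξ g) = ξ (G.mul g h)

/-- The anchor of the Lie algebroid: the derivative of the target along the identities. -/
def anchor (Q : ReflGraph X) (ξ : (g : Q.Arrow) → TangentSpace 𝓘(ℂ, ℂ × ℂ) g) (x : X) :
    TangentSpace 𝓘(ℂ, ℂ) x :=
  (mfderiv 𝓘(ℂ, ℂ × ℂ) 𝓘(ℂ, ℂ) Q.t (Q.one x) (ξ (Q.one x)) : ℂ)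

end LieGroupoid

/-- `η` is a section over the open set `V` of the sheaf `T(-k • p)`: a holomorphic vector field on
`V` that vanishes to order at least `k` at `p`. -/
structure IsTwistedField (p : X) (k : ℕ) (V : Set X)
    (η : (x : X) → TangentSpace 𝓘(ℂ, ℂ) x) [IsManifold 𝓘(ℂ, ℂ) ω X] : Prop where
  contMDiffOn : ContMDiffOn 𝓘(ℂ, ℂ) 𝓘(ℂ, ℂ).tangent ω
    (fun x ↦ (⟨x, η x⟩ : TangentBundle 𝓘(ℂ, ℂ) X)) V
  order : p ∈ V → (k : ℕ∞) ≤ analyticOrderAt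
    (fun z : ℂ ↦ (mfderiv 𝓘(ℂ, ℂ) 𝓘(ℂ, ℂ) (chartAt ℂ p) ((chartAt ℂ p).symm z)
      (η ((chartAt ℂ p).symm z)) : ℂ)) (chartAt ℂ p p)

namespace LieGroupoid

variable {Q : ReflGraph X} [IsManifold 𝓘(ℂ, ℂ) ω X]

/-- `G` integrates the Lie algebroid `T(-k • p)`: over every open set, the anchor is an isomorphism,
compatible with the brackets, from the sections of the Lie algebroid of `G` to those of
`T(-k • p)`. (An isomorphism of Lie algebroids to the subsheaf `T(-k • p)` of `T` commutes with the
anchors, so it can only be the anchor of the Lie algebroid of `G`.) -/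
structure Integrates (G : LieGroupoid Q) (p : X) (k : ℕ) : Prop where
  mapsTo : ∀ V, IsOpen V → ∀ ξ, G.IsAlgebroidSection V ξ → IsTwistedField p k V (anchor Q ξ)
  injective : ∀ V, IsOpen V → ∀ ξ ξ', G.IsAlgebroidSection V ξ → G.IsAlgebroidSection V ξ' →
    (∀ x ∈ V, anchor Q ξ x = anchor Q ξ' x) → ∀ g, Q.t g ∈ V → ξ g = ξ' g
  surjective : ∀ V, IsOpen V → ∀ η, IsTwistedField p k V η →
    ∃ ξ, G.IsAlgebroidSection V ξ ∧ ∀ x ∈ V, anchor Q ξ x = η x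
  bracket : ∀ V, IsOpen V → ∀ ξ ξ', G.IsAlgebroidSection V ξ → G.IsAlgebroidSection V ξ' →
    ∀ x ∈ V, anchor Q (VectorField.mlieBracket 𝓘(ℂ, ℂ × ℂ) ξ ξ') x =
      VectorField.mlieBracket 𝓘(ℂ, ℂ) (anchor Q ξ) (anchor Q ξ') x

/-- `G` is source-simply connected: the source fibres are connected and simply connected. -/
def SourceSimplyConnected (_G : LieGroupoid Q) : Prop :=
  ∀ x, SimplyConnectedSpace {g : Q.Arrow // Q.s g = x}

/-- `G` is the fundamental groupoid `Π(X, k • p)`: the source-simply connected integration of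
`T(-k • p)`. -/
structure IsFundamentalGroupoid (G : LieGroupoid Q) (p : X) (k : ℕ) : Prop where
  integrates : G.Integrates p k
  sourceSimplyConnected : G.SourceSimplyConnected

end LieGroupoid

end Groupoid

namespace PLine

/-- The surface of arrows of `Pair(ℙ¹, k • p)`, with its source, target and identities: the pair
groupoid of `ℙ¹`, twisted `k` times at `p`. -/
def pairGraph (p : OnePoint ℂ) : ℕ → ReflGraph (OnePoint ℂ)
  | 0 => ReflGraph.pair (OnePoint ℂ)
  | k + 1 => (pairGraph p k).twist p

/-- The natural map `Pair(ℙ¹, (k + n) • p) → Pair(ℙ¹, k • p)`: a composition of blow-downs. -/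
def pairMap (p : OnePoint ℂ) (k : ℕ) : (n : ℕ) → (pairGraph p (k + n)).Arrow → (pairGraph p k).Arrow
  | 0 => id
  | n + 1 => fun g ↦ pairMap p k n ((pairGraph p (k + n)).blowdown p g)

/-- Biholomorphic maps from the arrows of `Pair(ℙ¹, k • p)` to the total space of `T(-k • p)`. -/
abbrev PairTotIso (p : OnePoint ℂ) (k : ℕ) : Type :=
  Diffeomorph 𝓘(ℂ, ℂ × ℂ) (𝓘(ℂ, ℂ).prod 𝓘(ℂ, ℂ)) (pairGraph p k).Arrow (Tot k) ω

/-- The requirements on the canonical isomorphism `Pair(ℙ¹, k • p) ≅ Tot T(-k • p)`: the source is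
the bundle projection, the identities are the zero section, and its derivative along the identities
is the canonical identification of the Lie algebroid of `Pair(ℙ¹, k • p)` with `T(-k • p)`, that is
for every vector `v` of `T(-k • p)` at `x`, the target of the arrow corresponding to `τ • v` has
derivative at `τ = 0` the tangent vector at `x` underlying `v`. -/
structure IsCanonical (p : OnePoint ℂ) (k : ℕ) (Φ : PairTotIso p k) : Prop where
  proj_eq_s : ∀ g, (Φ g).proj = (pairGraph p k).s g
  map_one : ∀ x, Φ ((pairGraph p k).one x) = Tot.mk x 0
  hasMFDerivAt : ∀ (x : OnePoint ℂ) (a : ℂ),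
    HasMFDerivAt 𝓘(ℂ, ℂ) 𝓘(ℂ, ℂ) (fun τ : ℂ ↦ (pairGraph p k).t (Φ.symm (Tot.mk x (τ * a)))) 0
      (ContinuousLinearMap.toSpanSingleton ℂ (toTangent p (Tot.mk x a : Tot k) : ℂ))

end PLine

end

/-! Let `u` be an affine coordinate on `ℙ¹ ∖ {p}` and `f = 1 / u` the coordinate near `p`. Away from
`p` an arrow of the pair groupoid is determined by its source `u` and target `u + a`, and twisting
does not change this part. After `k` twists the arrows with source near `p` are described by `(f,
c)` with `a = f ^ (k - 2) * c`, so that their target is `f / (1 + c * f ^ (k - 1))`. This goes by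
induction on `k`: the blowup of the point `(f, c) = (0, 0)`, without the proper transform of `f =
0`, which for `k ≥ 1` is both the source and the target fibre over `p`, has coordinates `(f, c /
f)`. For `k = 1` the point `(0, -1)` is missing from the chart, because a direction in the pair
groupoid must avoid two axes; from `k = 2` on, each of the two charts is a whole `ℂ × ℂ`. The data
are collected in `Std`; `stdOne` is the base of the induction and `Std.twist` the step.

For `k ≥ 2` everything is then explicit. The gluing `u = 1 / f`, `a = f ^ (k - 2) * c` is that of
`T(-k • p)`, since the vector field `a ∂_u` equals `-c * f ^ k ∂_f`; this gives the isomorphism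
`Std.iso`. Composition is addition of the fibre coordinates `a`. In the coordinates `(f, c)` it
becomes a rational expression without pole over `f = 0` (`Std.mul_B_of_composable`), so it extends
holomorphically over `p`. The source fibres are copies of `ℂ`.

Uniqueness rests on density. Arrows with source different from `p` are determined by source and
target, so the product of two of them is forced, and continuity forces the rest (`Std.mul_eq`). A
second canonical isomorphism differs from the first, on each source fibre off `p`, by a
biholomorphic map of `ℂ` fixing `0`; such a map is linear (`Complex.exists_mul_of_leftInverse`) and
the prescribed derivative makes it the identity (`Std.symm_totA_eq`, `Std.eq_iso`).

The anchor of a right-invariant field with component `b` along `c` is `-b * f ^ k ∂_f` near `p`,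
which gives the order of vanishing. Conversely a field `f ^ k * χ ∂_f` lifts, with a component that
is holomorphic because the powers of `f` cancel (`Std.contMDiffAt_liftField_self`). Brackets are
compared in the coordinates source and target off `p`; at `p` both sides vanish
(`Std.anchor_mlieBracket`). -/

noncomputable section

set_option linter.unusedSectionVars false

/-! ### Two facts of complex analysis -/

/-- A map that is analytic at `0` and vanishes there is `v ↦ E v v` for an analytic family `E` of
linear maps. -/
theorem AnalyticAt.exists_eventually_eq_apply_self {V W : Type*} [NormedAddCommGroup V]
    [NormedSpace ℂ V] [NormedAddCommGroup W] [NormedSpace ℂ W] [CompleteSpace W] {F : V → W}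
    (hF : AnalyticAt ℂ F 0) (h0 : F 0 = 0) :
    ∃ E : V → V →L[ℂ] W, AnalyticAt ℂ E 0 ∧ (∀ᶠ v in 𝓝 0, F v = E v v) ∧
      E 0 = fderiv ℂ F 0 := by
  obtain ⟨P, r, hP⟩ := hF
  -- The constant term of the power series vanishes, so every term has a last argument that can be
  -- split off: `E` is the sum of the shifted series.
  have hr : 0 < P.shift.radius := by
    rw [FormalMultilinearSeries.radius_shift]
    exact hP.r_pos.trans_le hP.r_le
  have hS := P.shift.hasFPowerSeriesOnBall hr
  have hev : ∀ᶠ v in 𝓝 (0 : V), F v = P.shift.sum v v := by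
    filter_upwards [Metric.eball_mem_nhds (0 : V) hP.r_pos,
      Metric.eball_mem_nhds (0 : V) hr] with v h1 h2
    have h3 : HasSum (fun n ↦ P n fun _ ↦ v) (F v) := by simpa using hP.hasSum h1
    have h4 : HasSum (fun n ↦ P.shift n fun _ ↦ v) (P.shift.sum v) := by simpa using hS.hasSum h2
    have h5 : HasSum (fun n ↦ P.shift n (fun _ ↦ v) v) (P.shift.sum v v) := by
      simpa using h4.mapL (ContinuousLinearMap.apply ℂ W v)
    have h6 := (hasSum_nat_add_iff' 1).2 h3
    have h7 : P 0 (fun _ ↦ v) = 0 := by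
      rw [← h0, ← hP.coeff_zero fun _ ↦ v]
    simp only [Finset.range_one, Finset.sum_singleton, h7, sub_zero] at h6
    refine h6.unique ?_
    convert h5 using 2 with n
    simp only [FormalMultilinearSeries.shift, ContinuousMultilinearMap.curryRight_apply]
    congr 1
    ext i
    refine Fin.lastCases ?_ (fun j ↦ ?_) i <;> simp
  refine ⟨P.shift.sum, hS.analyticAt, hev, ?_⟩
  -- In the product rule the term with the derivative of `E` is evaluated at the vector `0`, so only
  -- `E 0` survives.
  have h1 : HasFDerivAt (fun v ↦ P.shift.sum v v) (P.shift.sum 0) 0 := by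
    simpa using hS.analyticAt.differentiableAt.hasFDerivAt.clm_apply (hasFDerivAt_id (0 : V))
  exact (h1.congr_of_eventuallyEq hev).fderiv.symm

/-- A biholomorphic map of `ℂ` that fixes `0` is linear. -/
theorem Complex.exists_mul_of_leftInverse {f g : ℂ → ℂ} (hf : Differentiable ℂ f)
    (hg : Differentiable ℂ g) (hgf : Function.LeftInverse g f) (hfg : Function.RightInverse g f)
    (h0 : f 0 = 0) : ∃ l : ℂ, ∀ z, f z = l * z := by
  have hg0 : g 0 = 0 := by simpa [h0] using hgf 0
  have hinj : ∀ z, f z = 0 → z = 0 := fun z hz ↦ by rw [← hgf z, hz, hg0]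
  let e : ℂ ≃ₜ ℂ := ⟨⟨f, g, hgf, hfg⟩, hf.continuous, hg.continuous⟩
  have htop : Tendsto f (cocompact ℂ) (cocompact ℂ) := e.isClosedEmbedding.tendsto_cocompact
  -- `f` and `g` in the coordinate `1 / z` at infinity. The convention `0⁻¹ = 0` gives them the
  -- right value at `0`, where they are continuous because `f` and `g` are proper, and hence
  -- holomorphic by removal of the singularity.
  set h : ℂ → ℂ := fun z ↦ (f z⁻¹)⁻¹ with hh
  set h' : ℂ → ℂ := fun z ↦ (g z⁻¹)⁻¹ with hh'
  have key : ∀ F : ℂ → ℂ, Differentiable ℂ F → (∀ z, F z = 0 → z = 0) → F 0 = 0 →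
      Tendsto F (cocompact ℂ) (cocompact ℂ) → DifferentiableAt ℂ (fun z ↦ (F z⁻¹)⁻¹) 0 := by
    intro F hF hF0 hF00 hFt
    refine (Complex.analyticAt_of_differentiable_on_punctured_nhds_of_continuousAt ?_ ?_
      ).differentiableAt
    · filter_upwards [self_mem_nhdsWithin] with z hz
      have hz' : z ≠ 0 := hz
      refine (hF.differentiableAt.comp z (differentiableAt_inv hz')).inv fun h ↦ hz' ?_
      simpa using hF0 _ h
    · have h1 : Tendsto (fun z ↦ (F z⁻¹)⁻¹) (𝓝[≠] 0) (𝓝 0) := by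
        rw [← Metric.cobounded_eq_cocompact] at hFt
        exact Filter.tendsto_inv₀_cobounded.comp (hFt.comp Filter.tendsto_inv₀_nhdsNE_zero)
      rw [continuousAt_iff_punctured_nhds]
      simpa [hF00] using h1
  have hd : DifferentiableAt ℂ h 0 := key f hf hinj h0 htop
  have hd' : DifferentiableAt ℂ h' 0 := key g hg (fun z hz ↦ by rw [← hfg z, hz, h0]) hg0
    e.symm.isClosedEmbedding.tendsto_cocompact
  have hh0 : h 0 = 0 := by simp [hh, h0]
  have hcomp : ∀ z, h' (h z) = z := fun z ↦ by simp [hh, hh', hgf z⁻¹]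
  -- `h'` is a left inverse of `h`, so the chain rule excludes a zero derivative.
  have hne : deriv h 0 ≠ 0 := by
    intro h1
    have h2 : HasDerivAt (fun z ↦ h' (h z)) (deriv h' 0 * deriv h 0) 0 :=
      HasDerivAt.comp (h₂ := h') (0 : ℂ) (by rw [hh0]; exact hd'.hasDerivAt) hd.hasDerivAt
    have h3 : HasDerivAt (fun z ↦ h' (h z)) 1 0 := by
      simpa only [hcomp] using hasDerivAt_id' (0 : ℂ)
    have := h2.unique h3
    simp [h1] at this
  -- `f z / z` has a finite limit at infinity, the inverse of the derivative of `h` at `0`. Being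
  -- entire, it is constant by Liouville.
  have hs : Tendsto (dslope f 0) (cocompact ℂ) (𝓝 (deriv h 0)⁻¹) := by
    have h1 : Tendsto (fun z ↦ z⁻¹ * h z) (𝓝[≠] 0) (𝓝 (deriv h 0)) := by
      have := hd.hasDerivAt.tendsto_slope_zero
      simpa only [zero_add, hh0, sub_zero, smul_eq_mul] using this
    have h2 : Tendsto (fun z : ℂ ↦ z⁻¹) (cocompact ℂ) (𝓝[≠] 0) := by
      rw [← Metric.cobounded_eq_cocompact]
      exact Filter.tendsto_inv₀_cobounded'
    refine ((h1.comp h2).inv₀ hne).congr' ?_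
    filter_upwards [(isCompact_singleton (x := (0 : ℂ))).compl_mem_cocompact] with z hz
    have hz' : z ≠ 0 := hz
    rw [dslope_of_ne _ hz', slope_def_field]
    simp [hh, h0, div_eq_mul_inv]
  have hds : Differentiable ℂ (dslope f 0) := by
    intro z
    by_cases hz : z = 0
    · subst hz
      exact (Blowup.analyticAt_dslope (hf.analyticAt 0)).differentiableAt
    · exact (differentiableAt_dslope_of_ne hz).2 hf.differentiableAt
  refine ⟨(deriv h 0)⁻¹, fun z ↦ ?_⟩
  have h1 := sub_smul_dslope f 0 z
  rw [hds.apply_eq_of_tendsto_cocompact z hs] at h1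
  simpa [h0, mul_comm] using h1.symm

/-! ### The blowup in arbitrary local coordinates -/

namespace Blowup

variable {M : Type} [TopologicalSpace M] [ChartedSpace (ℂ × ℂ) M]

theorem eq_off {c : M} {y : Blowup c} (h : down c y ≠ c) : y = off (down c y) h := by
  rcases y with ⟨m, hm⟩ | l
  · rfl
  · exact absurd rfl h

variable [IsManifold 𝓘(ℂ, ℂ × ℂ) ω M]

/-- A map to the blowup is determined by its blow-down off the exceptional divisor. -/
theorem contMDiffAt_of_down {c : M} {V : Type*} [NormedAddCommGroup V] [NormedSpace ℂ V]
    {H : Type*} [TopologicalSpace H] {I : ModelWithCorners ℂ V H} {N : Type*}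
    [TopologicalSpace N] [ChartedSpace H N] {F : N → Blowup c} {n : N}
    (hF : ContMDiffAt I 𝓘(ℂ, ℂ × ℂ) ω (fun x ↦ down c (F x)) n) (hn : down c (F n) ≠ c)
    [T1Space M] : ContMDiffAt I 𝓘(ℂ, ℂ × ℂ) ω F n := by
  set e := chartAt (ℂ × ℂ) (down c (F n)) with he
  have hc : IsChart c (chartOff c e) := .off _ (chart_mem_atlas _ _)
  have hev : ∀ᶠ x in 𝓝 n, F x ∈ (chartOff c e).source :=
    (hF.continuousAt.eventually_mem (isOpen_ne.mem_nhds hn)).and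
      (hF.continuousAt.eventually_mem (e.open_source.mem_nhds (mem_chart_source _ _)))
  have h1 := contMDiffAt_symm_of_mem_maximalAtlas (chart_mem c hc)
    ((chartOff c e).map_source hev.self_of_nhds)
  have h2 : ContMDiffAt I 𝓘(ℂ, ℂ × ℂ) ω (fun x ↦ e (down c (F x))) n :=
    ContMDiffAt.comp n (contMDiffAt_of_mem_maximalAtlas (IsManifold.chart_mem_maximalAtlas _)
      (mem_chart_source _ _)) hF
  refine (ContMDiffAt.comp n (g := (chart c _ hc).symm) h1 h2).congr_of_eventuallyEq ?_
  filter_upwards [hev] with x hx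
  exact ((chartOff c e).left_inv hx).symm

/-- Local coordinates of a surface at `c`: a local biholomorphic map `toFun` from `ℂ × ℂ` that maps
the origin to `c`, with its local inverse `coord`. -/
structure Param (c : M) where
  toFun : ℂ × ℂ → M
  coord : M → ℂ × ℂ
  map_zero : toFun 0 = c
  contMDiffAt_toFun : ContMDiffAt 𝓘(ℂ, ℂ × ℂ) 𝓘(ℂ, ℂ × ℂ) ω toFun 0
  contMDiffAt_coord : ContMDiffAt 𝓘(ℂ, ℂ × ℂ) 𝓘(ℂ, ℂ × ℂ) ω coord c
  coord_toFun : ∀ᶠ v in 𝓝 0, coord (toFun v) = v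
  toFun_coord : ∀ᶠ m in 𝓝 c, toFun (coord m) = m

namespace Param

variable {c : M} (P : Param c)

theorem coord_self : P.coord c = 0 := by
  have := P.coord_toFun.self_of_nhds
  rwa [P.map_zero] at this

/-- The map `toFun` in the preferred chart at `c`. -/
def disp (v : ℂ × ℂ) : ℂ × ℂ := Blowup.disp c (P.toFun v)

/-- The map `coord` in the preferred chart at `c`. -/
def undisp (d : ℂ × ℂ) : ℂ × ℂ := P.coord (Blowup.undisp c d)

theorem disp_zero : P.disp 0 = 0 := by
  rw [disp, P.map_zero, disp_self]

theorem undisp_zero : P.undisp 0 = 0 := by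
  rw [undisp, Blowup.undisp_zero, P.coord_self]

theorem eventually_mem_source : ∀ᶠ v in 𝓝 0, P.toFun v ∈ (chartAt (ℂ × ℂ) c).source :=
  P.contMDiffAt_toFun.continuousAt.eventually_mem <| by
    rw [P.map_zero]; exact (chartAt (ℂ × ℂ) c).open_source.mem_nhds (mem_chart_source _ c)

theorem contDiffAt_disp : ContDiffAt ℂ ω P.disp 0 := by
  have h1 : ContMDiffAt 𝓘(ℂ, ℂ × ℂ) 𝓘(ℂ, ℂ × ℂ) ω (chartAt (ℂ × ℂ) c) (P.toFun 0) := by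
    rw [P.map_zero]
    exact contMDiffAt_of_mem_maximalAtlas (IsManifold.chart_mem_maximalAtlas _)
      (mem_chart_source _ _)
  exact (h1.comp 0 P.contMDiffAt_toFun).contDiffAt.sub contDiffAt_const

theorem contMDiffAt_undisp :
    ContMDiffAt 𝓘(ℂ, ℂ × ℂ) 𝓘(ℂ, ℂ × ℂ) ω (Blowup.undisp c) 0 := by
  have h1 : ContMDiffAt 𝓘(ℂ, ℂ × ℂ) 𝓘(ℂ, ℂ × ℂ) ω (chartAt (ℂ × ℂ) c).symm
      (chartAt (ℂ × ℂ) c c + 0) := by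
    rw [add_zero]
    exact contMDiffAt_symm_of_mem_maximalAtlas (IsManifold.chart_mem_maximalAtlas _)
      (mem_chart_target _ _)
  exact h1.comp (0 : ℂ × ℂ) (contDiffAt_const.add contDiffAt_id).contMDiffAt

theorem contDiffAt_undisp : ContDiffAt ℂ ω P.undisp 0 := by
  have h1 : ContMDiffAt 𝓘(ℂ, ℂ × ℂ) 𝓘(ℂ, ℂ × ℂ) ω P.coord (Blowup.undisp c 0) := by
    rw [Blowup.undisp_zero]; exact P.contMDiffAt_coord
  exact (h1.comp 0 contMDiffAt_undisp).contDiffAt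

theorem undisp_disp : ∀ᶠ v in 𝓝 0, P.undisp (P.disp v) = v := by
  filter_upwards [P.eventually_mem_source, P.coord_toFun] with v h1 h2
  rw [undisp, disp, Blowup.undisp_disp h1, h2]

theorem disp_undisp : ∀ᶠ d in 𝓝 0, P.disp (P.undisp d) = d := by
  have h1 : ∀ᶠ d in 𝓝 (0 : ℂ × ℂ), P.toFun (P.coord (Blowup.undisp c d)) = Blowup.undisp c d :=
    (contMDiffAt_undisp (c := c)).continuousAt.eventually
      (by rw [Blowup.undisp_zero]; exact P.toFun_coord)
  have h2 : (0 : ℂ × ℂ) ∈ dispTarget c := by simp [dispTarget]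
  filter_upwards [h1, (isOpen_dispTarget c).mem_nhds h2] with d h3 h4
  rw [undisp, disp, h3, Blowup.disp_undisp h4]

/-- The derivative of `toFun` at the origin. -/
def lin : (ℂ × ℂ) ≃L[ℂ] (ℂ × ℂ) :=
  have h1 : HasFDerivAt P.disp (fderiv ℂ P.disp 0) 0 :=
    (P.contDiffAt_disp.differentiableAt (by simp)).hasFDerivAt
  have h2 : HasFDerivAt P.undisp (fderiv ℂ P.undisp 0) 0 :=
    (P.contDiffAt_undisp.differentiableAt (by simp)).hasFDerivAt
  .equivOfInverse (fderiv ℂ P.disp 0) (fderiv ℂ P.undisp 0)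
    (fun v ↦ by
      have h3 : HasFDerivAt (fun v ↦ P.undisp (P.disp v))
          ((fderiv ℂ P.undisp 0).comp (fderiv ℂ P.disp 0)) 0 :=
        HasFDerivAt.comp (g := P.undisp) (0 : ℂ × ℂ) (by rw [P.disp_zero]; exact h2) h1
      exact DFunLike.congr_fun
        (h3.unique ((hasFDerivAt_id 0).congr_of_eventuallyEq P.undisp_disp)) v)
    (fun v ↦ by
      have h3 : HasFDerivAt (fun v ↦ P.disp (P.undisp v))
          ((fderiv ℂ P.disp 0).comp (fderiv ℂ P.undisp 0)) 0 :=
        HasFDerivAt.comp (g := P.disp) (0 : ℂ × ℂ) (by rw [P.undisp_zero]; exact h1) h2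
      exact DFunLike.congr_fun
        (h3.unique ((hasFDerivAt_id 0).congr_of_eventuallyEq P.disp_undisp)) v)

theorem hasFDerivAt_disp : HasFDerivAt P.disp (P.lin : ℂ × ℂ →L[ℂ] ℂ × ℂ) 0 :=
  (P.contDiffAt_disp.differentiableAt (by simp)).hasFDerivAt

theorem lin_ne_zero {v : ℂ × ℂ} (hv : v ≠ 0) : P.lin v ≠ 0 := by simpa using hv

/-- The point of the exceptional divisor in the direction `v`. -/
def dir (v : ℂ × ℂ) (hv : v ≠ 0) : Blowup c := exc (.mk ℂ (P.lin v) (P.lin_ne_zero hv))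

theorem down_dir (v : ℂ × ℂ) (hv : v ≠ 0) : down c (P.dir v hv) = c := rfl

theorem vec_dir (v : ℂ × ℂ) (hv : v ≠ 0) : ∃ t : ℂ, t ≠ 0 ∧ vec c (P.dir v hv) = t • P.lin v := by
  obtain ⟨t, ht⟩ := Projectivization.exists_smul_eq_mk_rep ℂ _ (P.lin_ne_zero hv)
  exact ⟨t, t.ne_zero, ht.symm⟩

theorem dir_eq_iff {v w : ℂ × ℂ} (hv : v ≠ 0) (hw : w ≠ 0) :
    P.dir v hv = P.dir w hw ↔ ∃ t : ℂ, t • w = v := by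
  rw [dir, dir, exc.injEq, Projectivization.mk_eq_mk_iff']
  simp only [← map_smul, P.lin.injective.eq_iff]

theorem exists_eq_dir (l : Projectivization ℂ (ℂ × ℂ)) : ∃ v hv, exc l = P.dir v hv := by
  refine ⟨P.lin.symm l.rep, by simpa using l.rep_nonzero, ?_⟩
  simp [dir]

/-- A map `F` to the blowup whose blow-down is `τ • w`, in the coordinates at `c`, with `w`
nonvanishing, is holomorphic as soon as it maps the zeros of `τ` to the direction of `w`. -/
theorem contMDiffAt_of_polar {N : Type*} [NormedAddCommGroup N] [NormedSpace ℂ N]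
    {F : N → Blowup c} {n : N} {τ : N → ℂ} {w : N → ℂ × ℂ} (hτ : ContDiffAt ℂ ω τ n)
    (hw : ContDiffAt ℂ ω w n) (hτn : τ n = 0) (hwn : w n ≠ 0)
    (h0 : ∀ᶠ x in 𝓝 n, τ x = 0 → ∃ hx, F x = P.dir (w x) hx)
    (h1 : ∀ᶠ x in 𝓝 n, τ x ≠ 0 → down c (F x) = P.toFun (τ x • w x)) :
    ContMDiffAt 𝓘(ℂ, N) 𝓘(ℂ, ℂ × ℂ) ω F n := by
  obtain ⟨E, hE, hE', hE0⟩ :=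
    AnalyticAt.exists_eventually_eq_apply_self P.contDiffAt_disp.analyticAt P.disp_zero
  have hE0 : E 0 = (P.lin : ℂ × ℂ →L[ℂ] ℂ × ℂ) := hE0
  have hs : ContDiffAt ℂ ω (fun x ↦ τ x • w x) n := hτ.smul hw
  have hs0 : τ n • w n = 0 := by rw [hτn, zero_smul]
  have hst : Tendsto (fun x ↦ τ x • w x) (𝓝 n) (𝓝 0) := by
    simpa [hs0] using hs.continuousAt.tendsto
  -- The blowup is defined through the preferred chart, where the displacement is `P.disp (τ • w) =
  -- τ • W` with `W = E (τ • w) w`. So `W` spans the direction of `F` off the zeros of `τ`, and on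
  -- them it equals `P.lin w`: one holomorphic formula covers both.
  set W : N → ℂ × ℂ := fun x ↦ E (τ x • w x) (w x) with hWdef
  have hW : ContDiffAt ℂ ω W n :=
    (ContDiffAt.comp n (g := E) (by simpa only [hs0] using hE.contDiffAt) hs).clm_apply hw
  have hWn : W n = P.lin (w n) := by simp [hWdef, hs0, hE0]
  have hvec : ∀ᶠ x in 𝓝 n, down c (F x) ∈ (chartAt (ℂ × ℂ) c).source ∧
      (∃ t : ℂ, t ≠ 0 ∧ vec c (F x) = t • W x) ∧
      Blowup.disp c (down c (F x)) = P.disp (τ x • w x) := by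
    filter_upwards [h0, h1, hst.eventually P.eventually_mem_source, hst.eventually hE',
      hst.eventually P.undisp_disp, hw.continuousAt.eventually_ne hwn] with x h0 h1 h2 h3 h4 h5
    by_cases hx : τ x = 0
    · obtain ⟨h6, h7⟩ := h0 hx
      obtain ⟨t, ht, ht'⟩ := P.vec_dir (w x) h6
      rw [h7]
      refine ⟨mem_chart_source _ c, ⟨t, ht, ?_⟩, ?_⟩
      · rw [ht', hWdef]; simp [hx, hE0]
      · rw [down_dir, disp_self, hx, zero_smul, P.disp_zero]
    · have h6 := h1 hx
      have h7 : down c (F x) ≠ c := by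
        intro h8
        have h9 : P.disp (τ x • w x) = 0 := by rw [disp, ← h6, h8, disp_self]
        rw [h9, P.undisp_zero] at h4
        exact smul_ne_zero hx h5 h4.symm
      refine ⟨h6 ▸ h2, ⟨τ x, hx, ?_⟩, by rw [h6]; rfl⟩
      rw [eq_off h7]
      change Blowup.disp c (down c (F x)) = _
      rw [h6]
      exact h3.trans (map_smul _ _ _)
  obtain ⟨h2, h3⟩ := h0.self_of_nhds hτn
  obtain ⟨L, hL⟩ := exists_chartOn c (.mk ℂ (P.lin (w n)) (P.lin_ne_zero h2))
  have hLW : (L (W n)).1 ≠ 0 := by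
    obtain ⟨t, ht⟩ := Projectivization.exists_smul_eq_mk_rep ℂ _ (P.lin_ne_zero h2)
    intro h
    apply hL
    rw [← ht, ← hWn, Units.smul_def, map_smul, Prod.smul_fst, h, smul_zero]
  have hLWd : ContDiffAt ℂ ω (fun x ↦ L (W x)) n := L.contDiff.contDiffAt.comp n hW
  have hd : ContDiffAt ℂ ω (fun x ↦ L (P.disp (τ x • w x))) n :=
    L.contDiff.contDiffAt.comp n
      (ContDiffAt.comp n (g := P.disp) (by simpa only [hs0] using P.contDiffAt_disp) hs)
  set G : N → ℂ × ℂ := fun x ↦ ((L (P.disp (τ x • w x))).1, (L (W x)).2 / (L (W x)).1) with hG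
  have hGd : ContDiffAt ℂ ω G n :=
    (contDiff_fst.contDiffAt.comp n hd).prodMk
      ((contDiff_snd.contDiffAt.comp n hLWd).div (contDiff_fst.contDiffAt.comp n hLWd) hLW)
  have hFG : ∀ᶠ x in 𝓝 n, F x ∈ (chartOn c L).source ∧ chartOn c L (F x) = G x := by
    filter_upwards [hvec, (continuous_fst.continuousAt.comp hLWd.continuousAt).eventually_ne hLW]
      with x ⟨h4, ⟨t, ht, h5⟩, h6⟩ h7
    refine ⟨⟨h4, ?_⟩, Prod.ext ?_ ?_⟩
    · rw [h5, map_smul]; exact mul_ne_zero ht h7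
    · change (L (Blowup.disp c (down c (F x)))).1 = _
      rw [h6]
    · change (L (vec c (F x))).2 / (L (vec c (F x))).1 = _
      rw [h5, map_smul, Prod.smul_snd, Prod.smul_fst, smul_eq_mul, smul_eq_mul,
        mul_div_mul_left _ _ ht]
  have hFn := hFG.self_of_nhds
  have h8 := contMDiffAt_symm_of_mem_maximalAtlas (chart_mem c (.on L)) (x := G n)
    (hFn.2 ▸ (chartOn c L).map_source hFn.1)
  refine (ContMDiffAt.comp n (g := (chart c _ (.on L)).symm) h8 hGd.contMDiffAt
    ).congr_of_eventuallyEq ?_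
  filter_upwards [hFG] with x hx
  exact ((chartOn c L).left_inv hx.1).symm.trans (congrArg (chartOn c L).symm hx.2)

/-- The slope `v₂ / v₁` of the direction `v` of a point of the blowup, in the coordinates at `c`. -/
def slope : Blowup c → ℂ
  | off m _ => (P.coord m).2 / (P.coord m).1
  | exc l => (P.lin.symm l.rep).2 / (P.lin.symm l.rep).1

theorem slope_dir (v : ℂ × ℂ) (hv : v ≠ 0) : P.slope (P.dir v hv) = v.2 / v.1 := by
  obtain ⟨t, ht⟩ := Projectivization.exists_smul_eq_mk_rep ℂ _ (P.lin_ne_zero hv)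
  change (P.lin.symm (Projectivization.mk ℂ (P.lin v) _).rep).2 /
    (P.lin.symm (Projectivization.mk ℂ (P.lin v) _).rep).1 = _
  rw [← ht, Units.smul_def, map_smul, P.lin.symm_apply_apply, Prod.smul_snd, Prod.smul_fst,
    smul_eq_mul, smul_eq_mul, mul_div_mul_left _ _ t.ne_zero]

/-- The change of coordinates in the other direction: in a chart of the blowup the displacement is
`d = q.1 • w`, and `P.undisp d = q.1 • E d w`. The factor `q.1` cancels in the slope, which is
therefore the slope of `E d w` also on the exceptional divisor. -/
theorem contMDiffAt_slope_dir {v : ℂ × ℂ} (hv : v ≠ 0) (hv1 : v.1 ≠ 0) :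
    ContMDiffAt 𝓘(ℂ, ℂ × ℂ) 𝓘(ℂ, ℂ) ω P.slope (P.dir v hv) := by
  obtain ⟨E, hE, hE', hE0⟩ :=
    AnalyticAt.exists_eventually_eq_apply_self P.contDiffAt_undisp.analyticAt P.undisp_zero
  have hE0 : E 0 = (P.lin.symm : ℂ × ℂ →L[ℂ] ℂ × ℂ) := hE0
  obtain ⟨L, hL⟩ := exists_chartOn c (.mk ℂ (P.lin v) (P.lin_ne_zero hv))
  have hs : P.dir v hv ∈ (chartOn c L).source := ⟨mem_chart_source _ c, hL⟩
  set f := chartOn c L with hf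
  set q₀ := f (P.dir v hv) with hq₀
  have hq₀1 : q₀.1 = 0 := by
    change (L (Blowup.disp c c)).1 = 0
    rw [Blowup.disp_self, _root_.map_zero, Prod.fst_zero]
  set w : ℂ × ℂ → ℂ × ℂ := fun q ↦ L.symm (1, q.2) with hw
  set d : ℂ × ℂ → ℂ × ℂ := fun q ↦ q.1 • w q with hd
  have hwd : ContDiff ℂ ω w := L.symm.contDiff.comp (contDiff_const.prodMk contDiff_snd)
  have hdd : ContDiff ℂ ω d := contDiff_fst.smul hwd
  have hd0 : d q₀ = 0 := by simp only [hd, hq₀1, zero_smul]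
  have hw0 : ∃ t : ℂ, t ≠ 0 ∧ w q₀ = t • P.lin v := by
    obtain ⟨t, ht, ht'⟩ := P.vec_dir v hv
    have h1 : w q₀ = (L (vec c (P.dir v hv))).1⁻¹ • vec c (P.dir v hv) := by
      rw [eq_inv_smul_iff₀ hs.2]
      exact smul_lin_symm L hs.2
    exact ⟨_, mul_ne_zero (inv_ne_zero hs.2) ht, by rw [h1, ht', smul_smul]⟩
  set W : ℂ × ℂ → ℂ × ℂ := fun q ↦ E (d q) (w q) with hWdef
  have hW : ContDiffAt ℂ ω W q₀ :=
    (ContDiffAt.comp q₀ (g := E) (by simpa only [hd0] using hE.contDiffAt)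
      hdd.contDiffAt).clm_apply hwd.contDiffAt
  have hW0 : (W q₀).1 ≠ 0 := by
    obtain ⟨t, ht, h1⟩ := hw0
    simp [hWdef, hd0, hE0, h1, ht, hv1]
  have hdt : Tendsto d (𝓝 q₀) (𝓝 0) := by simpa [hd0] using hdd.continuous.tendsto q₀
  have key : ∀ᶠ q in 𝓝 q₀, P.slope (f.symm q) = (W q).2 / (W q).1 := by
    have h0 : (0 : ℂ × ℂ) ∈ dispTarget c := by simp [dispTarget]
    filter_upwards [hdt.eventually hE', hdt.eventually ((isOpen_dispTarget c).mem_nhds h0)]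
      with q h1 h2
    change P.slope (polar c q.1 (w q) _) = _
    unfold polar
    split_ifs with h3
    · have h4 : d q = 0 := by
        have := Blowup.disp_undisp h2
        rwa [h3, Blowup.disp_self, eq_comm] at this
      obtain ⟨t, ht⟩ := Projectivization.exists_smul_eq_mk_rep ℂ _ (lin_symm_ne_zero L q.2)
      change (P.lin.symm (Projectivization.mk ℂ (w q) _).rep).2 /
        (P.lin.symm (Projectivization.mk ℂ (w q) _).rep).1 = _
      rw [← ht, Units.smul_def, map_smul, Prod.smul_snd, Prod.smul_fst,
        smul_eq_mul, smul_eq_mul, mul_div_mul_left _ _ t.ne_zero]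
      simp [hWdef, h4, hE0, hw]
    · have h4 : q.1 ≠ 0 := by
        intro h5
        exact h3 (by rw [h5, zero_smul, Blowup.undisp_zero])
      change (P.undisp (d q)).2 / (P.undisp (d q)).1 = _
      have h5 : P.undisp (d q) = q.1 • W q := h1.trans (map_smul _ _ _)
      rw [h5, Prod.smul_snd, Prod.smul_fst, smul_eq_mul, smul_eq_mul, mul_div_mul_left _ _ h4]
  have h1 := contMDiffAt_of_mem_maximalAtlas (chart_mem c (.on L)) (x := P.dir v hv) hs
  have h2 : ContDiffAt ℂ ω (fun q ↦ (W q).2 / (W q).1) q₀ :=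
    (contDiff_snd.contDiffAt.comp q₀ hW).div (contDiff_fst.contDiffAt.comp q₀ hW) hW0
  refine (ContMDiffAt.comp (P.dir v hv) (g := fun q ↦ (W q).2 / (W q).1) h2.contMDiffAt h1
    ).congr_of_eventuallyEq ?_
  filter_upwards [(chart c _ (.on L)).open_source.mem_nhds hs, h1.continuousAt.eventually key]
    with y h3 h4
  have h5 : f.symm (f y) = y := f.left_inv h3
  exact (congrArg P.slope h5.symm).trans h4

section
variable {X : Type} [TopologicalSpace X] [ChartedSpace ℂ X]

/-- By the chain rule the derivative of `σ` in the direction `P.lin v` is its derivative along the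
curve `τ ↦ P.toFun (τ • v)`, so `exc_notMem_closure` can be checked in any coordinates. -/
theorem dir_notMem_closure {σ : M → X} (hσ : MDifferentiableAt 𝓘(ℂ, ℂ × ℂ) 𝓘(ℂ, ℂ) σ c)
    {v : ℂ × ℂ} (hv : v ≠ 0) {d : ℂ} (hd : d ≠ 0)
    (h : HasDerivAt (fun τ : ℂ ↦ chartAt ℂ (σ c) (σ (P.toFun (τ • v)))) d 0) :
    P.dir v hv ∉ closure (down c ⁻¹' (σ ⁻¹' {σ c} \ {c})) := by
  refine exc_notMem_closure hσ rfl _ ?_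
  set D : ℂ × ℂ →L[ℂ] ℂ := mfderiv 𝓘(ℂ, ℂ × ℂ) 𝓘(ℂ, ℂ) σ c
  set φ := chartAt (ℂ × ℂ) c with hφ
  have hD : HasFDerivAt (fun x ↦ chartAt ℂ (σ c) (σ (φ.symm x))) D (φ c) := by
    have := hσ.hasMFDerivAt.2
    simp only [writtenInExtChartAt, mfld_simps] at this
    exact this.hasFDerivAt Filter.univ_mem
  have h1 : HasDerivAt (fun τ : ℂ ↦ φ c + P.disp (τ • v)) (P.lin v) 0 := by
    have h2 : HasDerivAt (fun τ : ℂ ↦ τ • v) v 0 := by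
      simpa using (hasDerivAt_id (0 : ℂ)).smul_const v
    have h3 : HasFDerivAt P.disp (P.lin : ℂ × ℂ →L[ℂ] ℂ × ℂ) ((0 : ℂ) • v) := by
      rw [zero_smul]; exact P.hasFDerivAt_disp
    exact (h3.comp_hasDerivAt (0 : ℂ) h2).const_add _
  have h4 : HasFDerivAt (fun x ↦ chartAt ℂ (σ c) (σ (φ.symm x))) D
      (φ c + P.disp ((0 : ℂ) • v)) := by
    rw [zero_smul, P.disp_zero, add_zero]; exact hD
  have h5 := h4.comp_hasDerivAt (0 : ℂ) h1
  have h6 : HasDerivAt (fun τ : ℂ ↦ chartAt ℂ (σ c) (σ (P.toFun (τ • v)))) (D (P.lin v)) 0 := by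
    refine h5.congr_of_eventuallyEq ?_
    have h7 : Tendsto (fun τ : ℂ ↦ τ • v) (𝓝 0) (𝓝 0) := by
      have : Continuous fun τ : ℂ ↦ τ • v := by fun_prop
      simpa using this.tendsto 0
    filter_upwards [h7.eventually P.eventually_mem_source] with τ hτ
    simp only [Function.comp_apply, disp, Blowup.disp, add_sub_cancel, ← hφ, φ.left_inv hτ]
  exact (h6.unique h).trans_ne hd

/-- The line through `0` in the direction `v` lifts to a holomorphic curve in the blowup. It runs
inside the fibre of `σ` for `τ ≠ 0` and reaches the direction of `v` at `τ = 0`. -/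
theorem dir_mem_closure {σ : M → X} {v : ℂ × ℂ} (hv : v ≠ 0) {x : X}
    (h : ∀ᶠ τ : ℂ in 𝓝 0, σ (P.toFun (τ • v)) = x) :
    P.dir v hv ∈ closure (down c ⁻¹' (σ ⁻¹' {x} \ {c})) := by
  classical
  have h7 : Tendsto (fun τ : ℂ ↦ τ • v) (𝓝 0) (𝓝 0) := by
    have : Continuous fun τ : ℂ ↦ τ • v := by fun_prop
    simpa using this.tendsto 0
  have hne : ∀ᶠ τ : ℂ in 𝓝 0, τ ≠ 0 → P.toFun (τ • v) ≠ c := by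
    filter_upwards [h7.eventually P.coord_toFun] with τ h1 h2 h3
    rw [h3, P.coord_self] at h1
    exact smul_ne_zero h2 hv h1.symm
  set F : ℂ → Blowup c := fun τ ↦ if h : P.toFun (τ • v) = c then P.dir v hv else
    off (P.toFun (τ • v)) h with hF
  have hF0 : F 0 = P.dir v hv := dif_pos (by rw [zero_smul, P.map_zero])
  have hc : ContMDiffAt 𝓘(ℂ, ℂ) 𝓘(ℂ, ℂ × ℂ) ω F 0 := by
    refine P.contMDiffAt_of_polar (τ := id) (w := fun _ ↦ v) contDiffAt_id contDiffAt_const rfl hv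
      (.of_forall fun τ hτ ↦ ⟨hv, ?_⟩) ?_
    · rw [show τ = 0 from hτ, hF0]
    · filter_upwards [hne] with τ h1 h2
      simp only [hF]
      rw [dif_neg (h1 h2)]
      rfl
  rw [← hF0]
  refine mem_closure_of_tendsto (hc.continuousAt.tendsto.mono_left nhdsWithin_le_nhds :
    Tendsto F (𝓝[≠] 0) _) ?_
  filter_upwards [self_mem_nhdsWithin, nhdsWithin_le_nhds hne, nhdsWithin_le_nhds h]
    with τ h1 h2 h3
  simp only [hF]
  rw [dif_neg (h2 h1)]
  exact ⟨h3, h2 h1⟩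

end

end Param

end Blowup

/-! ### Affine coordinates of the projective line adapted to the point -/

namespace PLine

theorem contMDiffOn_affineChart :
    ContMDiffOn 𝓘(ℂ, ℂ) 𝓘(ℂ, ℂ) ω affineChart affineChart.source :=
  contMDiffOn_chart (x := ((0 : ℂ) : OnePoint ℂ))

theorem contMDiffOn_chartInfty :
    ContMDiffOn 𝓘(ℂ, ℂ) 𝓘(ℂ, ℂ) ω chartInfty chartInfty.source :=
  contMDiffOn_chart (x := OnePoint.infty)

theorem mem_affineChart_source {x : OnePoint ℂ} : x ∈ affineChart.source ↔ x ≠ OnePoint.infty := by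
  induction x using OnePoint.rec with
  | infty => simp [affineChart]
  | coe z => simp [affineChart]

theorem mem_chartInfty_source {x : OnePoint ℂ} :
    x ∈ chartInfty.source ↔ x ≠ ((0 : ℂ) : OnePoint ℂ) := by
  have : x ∈ chartInfty.source ↔ inv x ∈ affineChart.source := Iff.rfl
  rw [this, mem_affineChart_source]
  induction x using OnePoint.rec with
  | infty => simp [inv]
  | coe z => by_cases hz : z = 0 <;> simp [inv, hz]

theorem contMDiff_coe : ContMDiff 𝓘(ℂ, ℂ) 𝓘(ℂ, ℂ) ω ((↑) : ℂ → OnePoint ℂ) := by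
  have := contMDiffOn_chart_symm (I := 𝓘(ℂ, ℂ)) (n := ω) (x := ((0 : ℂ) : OnePoint ℂ))
  exact contMDiffOn_univ.1 this

theorem contMDiff_inv_coe : ContMDiff 𝓘(ℂ, ℂ) 𝓘(ℂ, ℂ) ω (fun z : ℂ ↦ inv (z : OnePoint ℂ)) := by
  have := contMDiffOn_chart_symm (I := 𝓘(ℂ, ℂ)) (n := ω) (x := (OnePoint.infty : OnePoint ℂ))
  refine contMDiffOn_univ.1 (this.mono fun z _ ↦ ?_)
  change z ∈ chartInfty.target
  simp [chartInfty, affineChart]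

theorem inv_coe_of_ne {z : ℂ} (hz : z ≠ 0) : inv (z : OnePoint ℂ) = ((z⁻¹ : ℂ) : OnePoint ℂ) := by
  simp [inv, hz]

theorem inv_coe_zero : inv ((0 : ℂ) : OnePoint ℂ) = OnePoint.infty := by simp [inv]

theorem affineChart_coe (z : ℂ) : affineChart (z : OnePoint ℂ) = z := rfl

theorem chartInfty_infty : chartInfty OnePoint.infty = 0 := rfl

theorem chartInfty_coe (z : ℂ) : chartInfty (z : OnePoint ℂ) = z⁻¹ := chartInfty_eq ⟨z, rfl⟩

theorem chartInfty_inv_coe (z : ℂ) : chartInfty (inv (z : OnePoint ℂ)) = z := by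
  change (inv (inv _)).elim 0 id = z
  rw [inv_inv_eq]; rfl

/-- An affine coordinate of `ℙ¹ ∖ {p}`: the inverse of `z` if `p = ∞`, and of `1 / (z - c)` if
`p = c` is finite. -/
def away (p : OnePoint ℂ) (u : ℂ) : OnePoint ℂ :=
  p.elim (u : OnePoint ℂ) fun c ↦ if u = 0 then OnePoint.infty else ((c + u⁻¹ : ℂ) : OnePoint ℂ)

/-- The affine coordinate near `p` that is inverse to `away`. -/
def near (p : OnePoint ℂ) (f : ℂ) : OnePoint ℂ :=
  p.elim (inv (f : OnePoint ℂ)) fun c ↦ ((c + f : ℂ) : OnePoint ℂ)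

/-- The inverse of `away`. -/
def awayInv (p x : OnePoint ℂ) : ℂ :=
  p.elim (affineChart x) fun c ↦ x.elim 0 fun z ↦ (z - c)⁻¹

/-- The inverse of `near`. -/
def nearInv (p x : OnePoint ℂ) : ℂ :=
  p.elim (chartInfty x) fun c ↦ affineChart x - c

variable (p : OnePoint ℂ)

theorem near_of_ne {f : ℂ} (hf : f ≠ 0) : near p f = away p f⁻¹ := by
  induction p using OnePoint.rec <;> simp [near, away, hf, inv_coe_of_ne]

theorem away_of_ne {u : ℂ} (hu : u ≠ 0) : away p u = near p u⁻¹ := by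
  rw [near_of_ne p (inv_ne_zero hu), inv_inv]

theorem near_zero : near p 0 = p := by
  induction p using OnePoint.rec <;> simp [near, inv_coe_zero]

theorem away_ne (u : ℂ) : away p u ≠ p := by
  induction p using OnePoint.rec with
  | infty => simp [away]
  | coe c => by_cases hu : u = 0 <;> simp [away, hu]

theorem awayInv_away (u : ℂ) : awayInv p (away p u) = u := by
  induction p using OnePoint.rec with
  | infty => simp [awayInv, away, affineChart_coe]
  | coe c => by_cases hu : u = 0 <;> simp [away, awayInv, hu]

theorem away_awayInv {x : OnePoint ℂ} (hx : x ≠ p) : away p (awayInv p x) = x := by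
  induction p using OnePoint.rec with
  | infty =>
    induction x using OnePoint.rec with
    | infty => exact absurd rfl hx
    | coe z => simp [awayInv, away, affineChart_coe]
  | coe c =>
    induction x using OnePoint.rec with
    | infty => simp [awayInv, away]
    | coe z =>
      have : z - c ≠ 0 := sub_ne_zero.2 fun h ↦ hx (by rw [h])
      simp [awayInv, away, this]

theorem away_injective : Function.Injective (away p) :=
  Function.LeftInverse.injective (awayInv_away p)

theorem nearInv_near (f : ℂ) : nearInv p (near p f) = f := by
  induction p using OnePoint.rec with
  | infty => simp [near, nearInv, chartInfty_inv_coe]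
  | coe c => simp [near, nearInv, affineChart_coe]

theorem near_injective : Function.Injective (near p) :=
  Function.LeftInverse.injective (nearInv_near p)

theorem near_nearInv {x : OnePoint ℂ} (hx : x ≠ away p 0) : near p (nearInv p x) = x := by
  by_cases hxp : x = p
  · rw [← congrArg (nearInv p) ((near_zero p).trans hxp.symm), nearInv_near, near_zero, hxp]
  · obtain ⟨u, rfl⟩ : ∃ u, x = away p u := ⟨_, (away_awayInv p hxp).symm⟩
    have hu : u ≠ 0 := by rintro rfl; exact hx rfl
    rw [away_of_ne p hu, nearInv_near]

theorem near_ne {f : ℂ} (hf : f ≠ 0) : near p f ≠ p := by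
  rw [near_of_ne p hf]; exact away_ne p _

theorem near_ne_away_zero (f : ℂ) : near p f ≠ away p 0 := by
  by_cases hf : f = 0
  · rw [hf, near_zero]; exact (away_ne p 0).symm
  · rw [near_of_ne p hf]
    exact fun h ↦ inv_ne_zero hf (away_injective p h)

theorem contMDiff_near : ContMDiff 𝓘(ℂ, ℂ) 𝓘(ℂ, ℂ) ω (near p) := by
  induction p using OnePoint.rec with
  | infty => exact contMDiff_inv_coe
  | coe c => exact contMDiff_coe.comp (contDiff_const.add contDiff_id).contMDiff

/-- If `u = 1 / (z - c)`, then `1 / z = u / (1 + c * u)`, which is regular at `u = 0`, that is at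
infinity. -/
theorem away_coe_eq {c u : ℂ} (h : 1 + c * u ≠ 0) :
    away (c : OnePoint ℂ) u = inv ((u / (1 + c * u) : ℂ) : OnePoint ℂ) := by
  by_cases hu : u = 0
  · simp [away, hu, inv]
  · have h1 : c + u⁻¹ = (u / (1 + c * u))⁻¹ := by field_simp; ring
    simp [away, hu, inv_coe_of_ne (div_ne_zero hu h), h1]

theorem contDiffAt_awayInfty (c : ℂ) : ContDiffAt ℂ ω (fun u : ℂ ↦ u / (1 + c * u)) 0 :=
  contDiffAt_id.div (contDiffAt_const.add (contDiffAt_const.mul contDiffAt_id)) (by simp)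

theorem eventually_ne_zero_awayInfty (c : ℂ) : ∀ᶠ u : ℂ in 𝓝 0, 1 + c * u ≠ 0 :=
  (Continuous.continuousAt (by fun_prop)).eventually_ne (by simp)

theorem contMDiff_away : ContMDiff 𝓘(ℂ, ℂ) 𝓘(ℂ, ℂ) ω (away p) := by
  intro u
  by_cases hu : u = 0
  · subst hu
    induction p using OnePoint.rec with
    | infty => exact contMDiff_coe 0
    | coe c =>
      refine (contMDiff_inv_coe.contMDiffAt.comp (0 : ℂ)
        (contDiffAt_awayInfty c).contMDiffAt).congr_of_eventuallyEq ?_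
      filter_upwards [eventually_ne_zero_awayInfty c] with u hu
      exact away_coe_eq hu
  · refine ((contMDiff_near p).contMDiffAt.comp u (contDiffAt_inv ℂ hu).contMDiffAt
      ).congr_of_eventuallyEq ?_
    filter_upwards [isOpen_ne.mem_nhds hu] with v hv
    exact away_of_ne p hv

theorem contMDiffAt_nearInv {x : OnePoint ℂ} (hx : x ≠ away p 0) :
    ContMDiffAt 𝓘(ℂ, ℂ) 𝓘(ℂ, ℂ) ω (nearInv p) x := by
  induction p using OnePoint.rec with
  | infty =>
    exact contMDiffOn_chartInfty.contMDiffAt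
      (chartInfty.open_source.mem_nhds (mem_chartInfty_source.2 hx))
  | coe c =>
    have hx : x ≠ OnePoint.infty := by simpa [away] using hx
    have h1 := contMDiffOn_affineChart.contMDiffAt
      (affineChart.open_source.mem_nhds (mem_affineChart_source.2 hx))
    exact ContMDiffAt.comp (g := fun z : ℂ ↦ z - c) x
      (contDiff_id.sub contDiff_const).contMDiff.contMDiffAt h1

theorem contMDiffAt_awayInv {x : OnePoint ℂ} (hx : x ≠ p) :
    ContMDiffAt 𝓘(ℂ, ℂ) 𝓘(ℂ, ℂ) ω (awayInv p) x := by
  by_cases hq : x = away p 0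
  · subst hq
    induction p using OnePoint.rec with
    | infty =>
      exact contMDiffOn_affineChart.contMDiffAt
        (affineChart.open_source.mem_nhds (mem_affineChart_source.2 hx))
    | coe c =>
      have h0 : away (c : OnePoint ℂ) 0 = OnePoint.infty := by simp [away]
      rw [h0]
      have h1 := contMDiffOn_chartInfty.contMDiffAt (x := OnePoint.infty)
        (chartInfty.open_source.mem_nhds (mem_chartInfty_source.2 (by simp)))
      have h2 : ContDiffAt ℂ ω (fun w : ℂ ↦ w / (1 - c * w)) (chartInfty OnePoint.infty) := by
        rw [chartInfty_infty]
        exact contDiffAt_id.div (contDiffAt_const.sub (contDiffAt_const.mul contDiffAt_id))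
          (by simp)
      refine (ContMDiffAt.comp OnePoint.infty (g := fun w : ℂ ↦ w / (1 - c * w))
        h2.contMDiffAt h1).congr_of_eventuallyEq ?_
      have h3 : ∀ᶠ y : OnePoint ℂ in 𝓝 OnePoint.infty, y ≠ ((0 : ℂ) : OnePoint ℂ) :=
        isOpen_ne.mem_nhds (by simp)
      filter_upwards [h3] with y h3
      induction y using OnePoint.rec with
      | infty => simp [awayInv, chartInfty_infty]
      | coe z =>
        have hz : z ≠ 0 := fun h ↦ h3 (by rw [h])
        simp only [awayInv, OnePoint.elim_some, Function.comp_apply, chartInfty_coe]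
        -- For `z = c` both sides are quotients by zero, hence `0`.
        by_cases hzc : z = c
        · subst hzc; simp [hz]
        · have := sub_ne_zero.2 hzc
          field_simp
  · have h1 := contMDiffAt_nearInv p hq
    have h2 : nearInv p x ≠ 0 := by
      intro h
      have := near_nearInv p hq
      rw [h, near_zero] at this
      exact hx this.symm
    refine (ContMDiffAt.comp x (contDiffAt_inv ℂ h2).contMDiffAt h1).congr_of_eventuallyEq ?_
    filter_upwards [isOpen_ne.mem_nhds hx, isOpen_ne.mem_nhds hq] with y h3 h4
    obtain ⟨u, rfl⟩ : ∃ u, y = away p u := ⟨_, (away_awayInv p h3).symm⟩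
    have hu : u ≠ 0 := by rintro rfl; exact h4 rfl
    rw [Function.comp_apply, awayInv_away, away_of_ne p hu, nearInv_near, inv_inv]

theorem chartAt_near (f : ℂ) : chartAt ℂ p (near p f) = chartAt ℂ p p + f := by
  induction p using OnePoint.rec with
  | infty =>
    change chartInfty (inv f) = chartInfty _ + f
    rw [chartInfty_inv_coe, chartInfty_infty, zero_add]
  | coe c => rfl

theorem chartAt_symm_add (f : ℂ) : (chartAt ℂ p).symm (chartAt ℂ p p + f) = near p f := by
  rw [← chartAt_near]
  refine (chartAt ℂ p).left_inv ?_
  induction p using OnePoint.rec with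
  | infty =>
    refine mem_chartInfty_source.2 ?_
    have := near_ne_away_zero OnePoint.infty f
    simpa [away] using this
  | coe c => exact ⟨c + f, rfl⟩

end PLine

theorem PLine.awayInv_eq (p : OnePoint ℂ) {x : OnePoint ℂ} (hx : x ≠ p) (hq : x ≠ PLine.away p 0) :
    PLine.nearInv p x ≠ 0 ∧ PLine.awayInv p x = (PLine.nearInv p x)⁻¹ := by
  obtain ⟨u, rfl⟩ : ∃ u, x = PLine.away p u := ⟨_, (PLine.away_awayInv p hx).symm⟩
  have hu : u ≠ 0 := by rintro rfl; exact hq rfl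
  rw [PLine.awayInv_away, PLine.away_of_ne p hu, PLine.nearInv_near, inv_inv]
  exact ⟨inv_ne_zero hu, rfl⟩

theorem PLine.nearInv_self (p : OnePoint ℂ) : PLine.nearInv p p = 0 := by
  conv_lhs => rw [← congrArg (PLine.nearInv p) (PLine.near_zero p)]
  rw [PLine.nearInv_near]

/-! ### Points of the twist off the exceptional divisor -/

namespace ReflGraph

variable {X : Type} [TopologicalSpace X] [ChartedSpace ℂ X] (Q : ReflGraph X) (p : X)

/-- Away from the centre the blow-down is injective and the fibres are closed, so taking the closure
adds nothing there. -/
theorem off_mem_twistArrow [T1Space X] {m : Q.Arrow} (hm : m ≠ Q.one p) :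
    Blowup.off m hm ∈ Q.twistArrow p ↔ Q.s m ≠ p ∧ Q.t m ≠ p := by
  constructor
  · intro h
    have h : ¬ _ := h
    rw [removed, mem_union, not_or] at h
    exact ⟨fun h' ↦ h.1 (subset_closure ⟨h', hm⟩), fun h' ↦ h.2 (subset_closure ⟨h', hm⟩)⟩
  · rintro ⟨h1, h2⟩ (h | h)
    · exact Blowup.off_notMem_closure Q.contMDiff_s.continuous hm h1 h
    · exact Blowup.off_notMem_closure Q.contMDiff_t.continuous hm h2 h

theorem contMDiffAt_twistArrow {V : Type*} [NormedAddCommGroup V] [NormedSpace ℂ V]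
    {F : V → Q.twistArrow p} {n : V}
    (h : ContMDiffAt 𝓘(ℂ, V) 𝓘(ℂ, ℂ × ℂ) ω (fun x ↦ (F x).1) n) :
    ContMDiffAt 𝓘(ℂ, V) 𝓘(ℂ, ℂ × ℂ) ω F n :=
  (ChartedSpace.liftPropWithinAt_subtypeVal_comp_iff _ _ _).1 h

end ReflGraph

/-! ### Standard coordinates and their first consequences -/

namespace PLine

/-- Standard coordinates on a reflexive graph over `ℙ¹`: arrows with source `u` and target `u + a`,
in the affine coordinate of `ℙ¹ ∖ {p}`, have coordinates `(u, a)` in `A`, and the same arrow has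
coordinates `(f, c)` in `B`, where `u = f⁻¹` and `a = f ^ (k - 2) * c`. -/
structure Std (p : OnePoint ℂ) (k : ℕ) (D : Set (ℂ × ℂ)) (Q : ReflGraph (OnePoint ℂ)) where
  A : ℂ × ℂ → Q.Arrow
  B : ℂ × ℂ → Q.Arrow
  c : Q.Arrow → ℂ
  isOpen : IsOpen D
  zero_mem : (0 : ℂ × ℂ) ∈ D
  -- Only the part of `D` over `f = 0` can be incomplete: for `k = 1` it lacks the point `(0, -1)`,
  -- and for `k ≥ 2` nothing.
  mem_of_ne : ∀ v : ℂ × ℂ, v.1 ≠ 0 → v ∈ D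
  contMDiff_A : ContMDiff 𝓘(ℂ, ℂ × ℂ) 𝓘(ℂ, ℂ × ℂ) ω A
  contMDiffOn_B : ContMDiffOn 𝓘(ℂ, ℂ × ℂ) 𝓘(ℂ, ℂ × ℂ) ω B D
  contMDiffAt_c : ∀ g, Q.s g ≠ away p 0 → ContMDiffAt 𝓘(ℂ, ℂ × ℂ) 𝓘(ℂ, ℂ) ω c g
  s_A : ∀ v, Q.s (A v) = away p v.1
  t_A : ∀ v, Q.t (A v) = away p (v.1 + v.2)
  -- No arrow leads from another point to `p`. The pair groupoid itself does not satisfy this, which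
  -- is why standard coordinates begin with the first twist.
  t_ne : ∀ g, Q.s g ≠ p → Q.t g ≠ p
  A_eq : ∀ g, Q.s g ≠ p →
    A (awayInv p (Q.s g), awayInv p (Q.t g) - awayInv p (Q.s g)) = g
  B_of_ne : ∀ v : ℂ × ℂ, v.1 ≠ 0 → B v = A (v.1⁻¹, v.1 ^ k * v.1⁻¹ ^ 2 * v.2)
  s_B : ∀ v ∈ D, Q.s (B v) = near p v.1
  t_B_zero : ∀ x, (0, x) ∈ D → Q.t (B (0, x)) = p
  B_eq : ∀ g, Q.s g ≠ away p 0 → (nearInv p (Q.s g), c g) ∈ D ∧ B (nearInv p (Q.s g), c g) = g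
  c_B : ∀ v ∈ D, c (B v) = v.2

namespace Std

variable {p : OnePoint ℂ} {k : ℕ} {D : Set (ℂ × ℂ)} {Q : ReflGraph (OnePoint ℂ)} (S : Std p k D Q)

/-- The coordinates inverse to `A`. -/
def α (g : Q.Arrow) : ℂ × ℂ := (awayInv p (Q.s g), awayInv p (Q.t g) - awayInv p (Q.s g))

/-- The coordinates inverse to `B`. -/
def β (g : Q.Arrow) : ℂ × ℂ := (nearInv p (Q.s g), S.c g)

include S in
theorem contMDiffAt_α {g : Q.Arrow} (hg : Q.s g ≠ p) :
    ContMDiffAt 𝓘(ℂ, ℂ × ℂ) 𝓘(ℂ, ℂ × ℂ) ω (α (p := p) (Q := Q)) g := by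
  have h1 := (contMDiffAt_awayInv p hg).comp g (Q.contMDiff_s g)
  have h2 := (contMDiffAt_awayInv p (S.t_ne g hg)).comp g (Q.contMDiff_t g)
  exact h1.prodMk_space (h2.sub h1)

theorem contMDiffAt_β {g : Q.Arrow} (hg : Q.s g ≠ away p 0) :
    ContMDiffAt 𝓘(ℂ, ℂ × ℂ) 𝓘(ℂ, ℂ × ℂ) ω S.β g :=
  ((contMDiffAt_nearInv p hg).comp g (Q.contMDiff_s g)).prodMk_space (S.contMDiffAt_c g hg)

theorem A_α {g : Q.Arrow} (hg : Q.s g ≠ p) : S.A (α (p := p) g) = g := S.A_eq g hg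

theorem B_β {g : Q.Arrow} (hg : Q.s g ≠ away p 0) : S.B (S.β g) = g := (S.B_eq g hg).2

theorem β_mem {g : Q.Arrow} (hg : Q.s g ≠ away p 0) : S.β g ∈ D := (S.B_eq g hg).1

theorem α_A (v : ℂ × ℂ) : α (p := p) (S.A v) = v := by
  simp [α, S.s_A, S.t_A, awayInv_away]

theorem β_B {v : ℂ × ℂ} (hv : v ∈ D) : S.β (S.B v) = v := by
  simp [β, S.s_B v hv, nearInv_near, S.c_B v hv]

theorem s_A_ne (v : ℂ × ℂ) : Q.s (S.A v) ≠ p := by rw [S.s_A]; exact away_ne p _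

theorem s_B_ne {v : ℂ × ℂ} (hv : v ∈ D) : Q.s (S.B v) ≠ away p 0 := by
  rw [S.s_B v hv]; exact near_ne_away_zero p _

theorem β_eq_zero_iff {g : Q.Arrow} (hg : Q.s g ≠ away p 0) : (S.β g).1 = 0 ↔ Q.s g = p := by
  constructor
  · intro h
    rw [← S.B_β hg, S.s_B _ (S.β_mem hg), h, near_zero]
  · intro h
    change nearInv p (Q.s g) = 0
    rw [h, nearInv_self]

theorem s_ne_of_eq {g : Q.Arrow} (hg : Q.s g = p) : Q.s g ≠ away p 0 :=
  hg ▸ (away_ne p 0).symm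

include S in
/-- An arrow with source different from `p` is determined by its source and target. -/
theorem ext_of_ne {g h : Q.Arrow} (hg : Q.s g ≠ p) (hs : Q.s g = Q.s h) (ht : Q.t g = Q.t h) :
    g = h := by
  rw [← S.A_eq g hg, ← S.A_eq h (hs ▸ hg), hs, ht]

theorem exists_eq_A {g : Q.Arrow} (hg : Q.s g ≠ p) : ∃ v, g = S.A v := ⟨_, (S.A_α hg).symm⟩

theorem exists_eq_B {g : Q.Arrow} (hg : Q.s g = p) : ∃ x, (0, x) ∈ D ∧ g = S.B (0, x) := by
  have hq := s_ne_of_eq hg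
  have h1 : S.β g = (0, S.c g) := Prod.ext ((S.β_eq_zero_iff hq).2 hg) rfl
  refine ⟨S.c g, ?_, ?_⟩
  · rw [← h1]; exact S.β_mem hq
  · rw [← h1, S.B_β hq]

include S in
theorem t_eq {g : Q.Arrow} (hg : Q.s g = p) : Q.t g = p := by
  obtain ⟨x, hx, rfl⟩ := S.exists_eq_B hg
  exact S.t_B_zero x hx

theorem s_B_zero {x : ℂ} (hx : (0, x) ∈ D) : Q.s (S.B (0, x)) = p := by
  rw [S.s_B _ hx, near_zero]

/-- In the coordinate `u` the target is `f⁻¹ + f ^ (k - 2) * x = (1 + x * f ^ (k - 1)) / f`. The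
nonvanishing condition says that it is not the point `u = 0`, where the coordinate near `p` is not
defined. -/
theorem t_B (hk : 1 ≤ k) {v : ℂ × ℂ} (hv : v ∈ D) (hv' : 1 + v.2 * v.1 ^ (k - 1) ≠ 0) :
    Q.t (S.B v) = near p (v.1 / (1 + v.2 * v.1 ^ (k - 1))) := by
  obtain ⟨f, x⟩ := v
  by_cases hf : f = 0
  · subst hf
    rw [S.t_B_zero x hv, zero_div, near_zero]
  · obtain ⟨k, rfl⟩ := Nat.exists_eq_add_of_le' hk
    rw [S.B_of_ne _ hf, S.t_A, near_of_ne p (div_ne_zero hf hv')]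
    congr 1
    simp only [Nat.add_sub_cancel] at hv' ⊢
    field_simp
    ring

include S in
theorem one_away (u : ℂ) : Q.one (away p u) = S.A (u, 0) := by
  refine S.ext_of_ne ?_ ?_ ?_
  · rw [Q.s_one]; exact away_ne p u
  · rw [Q.s_one, S.s_A]
  · rw [Q.t_one, S.t_A]; simp

theorem one_near {f : ℂ} (hf : f ≠ 0) : Q.one (near p f) = S.B (f, 0) := by
  rw [near_of_ne p hf, S.one_away, S.B_of_ne (f, 0) hf, mul_zero]

/-- `Std` does not mention the identities. Off `p` they are recognized by source and target and have
`c = 0`; continuity of `c` along the identities gives the value over `p`. -/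
theorem one_self : Q.one p = S.B 0 := by
  have hp : Q.s (Q.one p) ≠ away p 0 := s_ne_of_eq (Q.s_one p)
  have h1 : ContinuousAt (fun f ↦ S.c (Q.one (near p f))) 0 := by
    have h2 : ContinuousAt S.c (Q.one (near p 0)) := by
      rw [near_zero]; exact (S.contMDiffAt_c _ hp).continuousAt
    exact ContinuousAt.comp (f := fun f ↦ Q.one (near p f)) (x := 0) h2
      (Q.contMDiff_one.continuous.comp (contMDiff_near p).continuous).continuousAt
  have h2 : Tendsto (fun f ↦ S.c (Q.one (near p f))) (𝓝[≠] 0) (𝓝 0) := by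
    refine tendsto_const_nhds.congr' ?_
    filter_upwards [self_mem_nhdsWithin] with f hf
    rw [S.one_near hf, S.c_B _ (S.mem_of_ne (f, 0) hf)]
  have h3 : S.c (Q.one p) = 0 := by
    have h4 := tendsto_nhds_unique (h1.tendsto.mono_left nhdsWithin_le_nhds) h2
    rwa [near_zero] at h4
  have h4 := S.B_β hp
  rw [β, h3, Q.s_one, nearInv_self] at h4
  exact h4.symm

-- Distinct arrows are separated by a continuous function: by the source if the sources differ, by
-- the target if they have the same source different from `p`, and by the coordinate `c` on the
-- fibre over `p`.
include S in
theorem t2Space : T2Space Q.Arrow := by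
  rw [t2Space_iff_disjoint_nhds]
  intro g g' hgg'
  by_cases hs : Q.s g = Q.s g'
  · by_cases hp : Q.s g = p
    · have hq := s_ne_of_eq hp
      have hq' := s_ne_of_eq (hs.symm.trans hp)
      have hc : S.c g ≠ S.c g' := by
        intro h
        apply hgg'
        rw [← S.B_β hq, ← S.B_β hq', β, β, hs, h]
      exact (S.contMDiffAt_c g hq).continuousAt.tendsto.disjoint (disjoint_nhds_nhds.2 hc)
        (S.contMDiffAt_c g' hq').continuousAt.tendsto
    · have ht : Q.t g ≠ Q.t g' := fun ht ↦ hgg' (S.ext_of_ne hp hs ht)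
      exact (Q.contMDiff_t.continuous.tendsto g).disjoint (disjoint_nhds_nhds.2 ht)
        (Q.contMDiff_t.continuous.tendsto g')
  · exact (Q.contMDiff_s.continuous.tendsto g).disjoint (disjoint_nhds_nhds.2 hs)
      (Q.contMDiff_s.continuous.tendsto g')

/-- Coordinates at the identity arrow over `p`. -/
def param : Blowup.Param (Q.one p) where
  toFun := S.B
  coord := S.β
  map_zero := S.one_self.symm
  contMDiffAt_toFun := S.contMDiffOn_B.contMDiffAt (S.isOpen.mem_nhds S.zero_mem)
  contMDiffAt_coord := S.contMDiffAt_β (s_ne_of_eq (Q.s_one p))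
  coord_toFun := by filter_upwards [S.isOpen.mem_nhds S.zero_mem] with v hv using S.β_B hv
  toFun_coord := by
    filter_upwards [Q.contMDiff_s.continuous.continuousAt.eventually_ne
      (s_ne_of_eq (Q.s_one p))] with g hg using S.B_β hg

end Std

end PLine

/-! ### The inductive step: standard coordinates on a twist -/

namespace PLine

namespace Std

section Twist

variable {p : OnePoint ℂ} {k : ℕ} {D : Set (ℂ × ℂ)} {Q : ReflGraph (OnePoint ℂ)} (S : Std p k D Q)

theorem A_ne_one (v : ℂ × ℂ) : S.A v ≠ Q.one p := fun h ↦
  S.s_A_ne v (by rw [h, Q.s_one])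

theorem t_A_ne (v : ℂ × ℂ) : Q.t (S.A v) ≠ p := S.t_ne _ (S.s_A_ne v)

/-- The coordinates `A` on the twist. -/
def twistA (v : ℂ × ℂ) : Q.twistArrow p :=
  ⟨.off (S.A v) (S.A_ne_one v), (Q.off_mem_twistArrow p _).2 ⟨S.s_A_ne v, S.t_A_ne v⟩⟩

theorem contMDiff_twistA : ContMDiff 𝓘(ℂ, ℂ × ℂ) 𝓘(ℂ, ℂ × ℂ) ω S.twistA := fun v ↦
  have := S.t2Space
  Q.contMDiffAt_twistArrow p (Blowup.contMDiffAt_of_down (S.contMDiff_A v) (S.A_ne_one v))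

theorem one_fst_ne_zero (x : ℂ) : ((1 : ℂ), x) ≠ 0 := fun h ↦ one_ne_zero (congrArg Prod.fst h)

theorem hasDerivAt_chart_near {g : ℂ → ℂ} {d : ℂ} (hg : HasDerivAt g d 0) :
    HasDerivAt (fun τ ↦ chartAt ℂ p (near p (g τ))) d 0 := by
  simp only [chartAt_near]
  exact hg.const_add _

/-- Source and target both have derivative `1` along `τ ↦ S.B (τ, τ * x)`, for every `x`. So the
direction `(1, x)` is tangent to neither of the two removed fibres. -/
theorem dir_mem_twistArrow (hk : 1 ≤ k) (x : ℂ) :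
    S.param.dir (1, x) (one_fst_ne_zero x) ∈ Q.twistArrow p := by
  have h7 : Tendsto (fun τ : ℂ ↦ τ • ((1 : ℂ), x)) (𝓝 0) (𝓝 0) := by
    have : Continuous fun τ : ℂ ↦ τ • ((1 : ℂ), x) := by fun_prop
    simpa using this.tendsto 0
  have hD := h7.eventually (S.isOpen.mem_nhds S.zero_mem)
  rintro (h | h)
  · have h1 : HasDerivAt (fun τ : ℂ ↦ chartAt ℂ p (Q.s (S.B (τ • ((1 : ℂ), x))))) 1 0 := by
      refine (hasDerivAt_chart_near (p := p) (hasDerivAt_id' (0 : ℂ))).congr_of_eventuallyEq ?_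
      filter_upwards [hD] with τ hτ
      rw [S.s_B _ hτ]
      simp
    have h2 := S.param.dir_notMem_closure ((Q.contMDiff_s (Q.one p)).mdifferentiableAt (by simp))
      (one_fst_ne_zero x) one_ne_zero (by rw [Q.s_one]; exact h1)
    rw [Q.s_one] at h2
    exact h2 h
  · have h0 : ContinuousAt (fun τ : ℂ ↦ 1 + τ * x * τ ^ (k - 1)) 0 := by fun_prop
    have h1 : HasDerivAt (fun τ : ℂ ↦ chartAt ℂ p (Q.t (S.B (τ • ((1 : ℂ), x))))) 1 0 := by
      have h2 : HasDerivAt (fun τ : ℂ ↦ τ / (1 + τ * x * τ ^ (k - 1))) 1 0 := by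
        have h3 : HasDerivAt (fun τ : ℂ ↦ 1 + τ * x * τ ^ (k - 1))
            (deriv (fun τ : ℂ ↦ 1 + τ * x * τ ^ (k - 1)) 0) 0 := by
          refine DifferentiableAt.hasDerivAt ?_
          fun_prop
        simpa using (hasDerivAt_id' (0 : ℂ)).fun_div h3 (by simp)
      refine (hasDerivAt_chart_near (p := p) h2).congr_of_eventuallyEq ?_
      filter_upwards [hD, h0.eventually_ne (by simp : (1 : ℂ) + 0 * x * 0 ^ (k - 1) ≠ 0)]
        with τ hτ hτ'
      have hτ'' : 1 + (τ • ((1 : ℂ), x)).2 * (τ • ((1 : ℂ), x)).1 ^ (k - 1) ≠ 0 := by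
        simpa using hτ'
      rw [S.t_B hk hτ hτ'']
      simp
    have h2 := S.param.dir_notMem_closure ((Q.contMDiff_t (Q.one p)).mdifferentiableAt (by simp))
      (one_fst_ne_zero x) one_ne_zero (by rw [Q.t_one]; exact h1)
    rw [Q.t_one] at h2
    exact h2 h

/-- The coordinates `B` on the twist. -/
def twistB (hk : 1 ≤ k) (v : ℂ × ℂ) : Q.twistArrow p :=
  if v.1 = 0 then ⟨_, S.dir_mem_twistArrow hk v.2⟩
  else S.twistA (v.1⁻¹, v.1 ^ (k + 1) * v.1⁻¹ ^ 2 * v.2)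

theorem twistB_zero (hk : 1 ≤ k) (x : ℂ) :
    S.twistB hk (0, x) = ⟨_, S.dir_mem_twistArrow hk x⟩ := if_pos rfl

theorem twistB_of_ne (hk : 1 ≤ k) {v : ℂ × ℂ} (hv : v.1 ≠ 0) :
    S.twistB hk v = S.twistA (v.1⁻¹, v.1 ^ (k + 1) * v.1⁻¹ ^ 2 * v.2) := if_neg hv

include S in
theorem smul_one_mem (v : ℂ × ℂ) : v.1 • ((1 : ℂ), v.2) ∈ D := by
  by_cases hv : v.1 = 0
  · rw [hv, zero_smul]; exact S.zero_mem
  · exact S.mem_of_ne _ (by simpa using hv)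

/-- The usual chart `(f, x) ↦ (f, f * x)` of a blowup: replacing `c` by `f * x` raises the exponent
of `f` by one. -/
theorem blowdown_twistB (hk : 1 ≤ k) (v : ℂ × ℂ) :
    Q.blowdown p (S.twistB hk v) = S.B (v.1 • ((1 : ℂ), v.2)) := by
  obtain ⟨f, x⟩ := v
  by_cases hv : f = 0
  · subst hv
    rw [S.twistB_zero, zero_smul, ← S.one_self]
    rfl
  · rw [S.twistB_of_ne hk hv, S.B_of_ne _ (by simpa using hv)]
    change S.A _ = S.A _
    congr 2
    · change f⁻¹ = (f * 1)⁻¹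
      rw [mul_one]
    · change f ^ (k + 1) * f⁻¹ ^ 2 * x = (f * 1) ^ k * (f * 1)⁻¹ ^ 2 * (f * x)
      ring

theorem contMDiff_twistB (hk : 1 ≤ k) :
    ContMDiff 𝓘(ℂ, ℂ × ℂ) 𝓘(ℂ, ℂ × ℂ) ω (S.twistB hk) := by
  have := S.t2Space
  intro v
  refine Q.contMDiffAt_twistArrow p ?_
  by_cases hv : v.1 = 0
  -- On the exceptional divisor `τ = f` and `w = (1, x)` are polar coordinates of the blow-down.
  · refine S.param.contMDiffAt_of_polar (τ := Prod.fst) (w := fun v ↦ (1, v.2))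
      contDiffAt_fst (contDiffAt_const.prodMk contDiffAt_snd) hv (one_fst_ne_zero _)
      (.of_forall fun w hw ↦ ?_) (.of_forall fun w _ ↦ S.blowdown_twistB hk w)
    refine ⟨one_fst_ne_zero _, ?_⟩
    obtain ⟨f, x⟩ := w
    obtain rfl : f = 0 := hw
    rw [S.twistB_zero]
  · refine Blowup.contMDiffAt_of_down ?_ ?_
    · have h1 : ContMDiffAt 𝓘(ℂ, ℂ × ℂ) 𝓘(ℂ, ℂ × ℂ) ω S.B (v.1 • ((1 : ℂ), v.2)) :=
        S.contMDiffOn_B.contMDiffAt (S.isOpen.mem_nhds (S.smul_one_mem v))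
      have h2 : ContDiffAt ℂ ω (fun v : ℂ × ℂ ↦ v.1 • ((1 : ℂ), v.2)) v :=
        contDiffAt_fst.smul (contDiffAt_const.prodMk contDiffAt_snd)
      exact (h1.comp v h2.contMDiffAt).congr_of_eventuallyEq
        (.of_forall fun w ↦ S.blowdown_twistB hk w)
    · rw [S.twistB_of_ne hk hv]
      exact S.A_ne_one _

/-- The line `f = 0` lies in the source fibre over `p`, so its direction belongs to the removed set;
every other direction is spanned by a vector `(1, x)`. -/
theorem twist_cases {y : Blowup (Q.one p)} (hy : y ∈ Q.twistArrow p) :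
    (∃ m hm, y = .off m hm ∧ Q.s m ≠ p ∧ Q.t m ≠ p) ∨
      ∃ x, y = S.param.dir (1, x) (one_fst_ne_zero x) := by
  rcases y with ⟨m, hm⟩ | l
  · exact .inl ⟨m, hm, rfl, (Q.off_mem_twistArrow p hm).1 hy⟩
  · obtain ⟨v, hv, h⟩ := S.param.exists_eq_dir l
    right
    have hv1 : v.1 ≠ 0 := by
      intro h0
      refine hy (Or.inl ?_)
      rw [h]
      refine S.param.dir_mem_closure hv ?_
      have h7 : Tendsto (fun τ : ℂ ↦ τ • v) (𝓝 0) (𝓝 0) := by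
        have : Continuous fun τ : ℂ ↦ τ • v := by fun_prop
        simpa using this.tendsto 0
      filter_upwards [h7.eventually (S.isOpen.mem_nhds S.zero_mem)] with τ hτ
      change Q.s (S.B _) = p
      rw [S.s_B _ hτ, Prod.smul_fst, h0, smul_zero, near_zero]
    refine ⟨v.2 / v.1, h.trans ?_⟩
    rw [S.param.dir_eq_iff]
    exact ⟨v.1, Prod.ext (by simp) (by simp [mul_div_cancel₀ _ hv1])⟩

theorem contMDiffAt_slope {y : Blowup (Q.one p)} (hy : y ∈ Q.twistArrow p)
    (hq : Q.s (Blowup.down _ y) ≠ away p 0) :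
    ContMDiffAt 𝓘(ℂ, ℂ × ℂ) 𝓘(ℂ, ℂ) ω S.param.slope y := by
  have := S.t2Space
  rcases S.twist_cases hy with ⟨m, hm, rfl, hs, -⟩ | ⟨x, rfl⟩
  · have h1 : ContMDiffAt 𝓘(ℂ, ℂ × ℂ) 𝓘(ℂ, ℂ × ℂ) ω
        (fun y ↦ S.β (Blowup.down (Q.one p) y)) (.off m hm) :=
      (S.contMDiffAt_β hq).comp _ (Blowup.contMDiff_down (Q.one p) _)
    have h0 : (S.β m).1 ≠ 0 := fun h ↦ hs ((S.β_eq_zero_iff hq).1 h)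
    have h2 : ContDiffAt ℂ ω (fun v : ℂ × ℂ ↦ v.2 / v.1) (S.β m) :=
      contDiffAt_snd.div contDiffAt_fst h0
    refine (ContMDiffAt.comp (Blowup.off m hm) (g := fun v : ℂ × ℂ ↦ v.2 / v.1)
      h2.contMDiffAt h1).congr_of_eventuallyEq ?_
    filter_upwards [(Blowup.contMDiff_down (Q.one p)).continuous.continuousAt.eventually_ne
      (show Blowup.down (Q.one p) (.off m hm) ≠ Q.one p from hm)] with z hz
    conv_lhs => rw [Blowup.eq_off hz]
    rfl
  · exact S.param.contMDiffAt_slope_dir _ one_ne_zero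

/-- Standard coordinates on the twist. -/
def twist (hk : 1 ≤ k) : Std p (k + 1) univ (Q.twist p) where
  A := S.twistA
  B := S.twistB hk
  -- The new coordinate is `c / f`, so that `a = f ^ (k - 2) * c = f ^ (k - 1) * (c / f)`. Every
  -- direction `(1, x)` survives, so the new domain is everything even if the old one is not.
  c y := S.param.slope y.1
  isOpen := isOpen_univ
  zero_mem := mem_univ _
  mem_of_ne _ _ := mem_univ _
  contMDiff_A := S.contMDiff_twistA
  contMDiffOn_B := (S.contMDiff_twistB hk).contMDiffOn
  contMDiffAt_c g hg := (S.contMDiffAt_slope g.2 hg).comp g contMDiff_subtype_val.contMDiffAt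
  s_A v := S.s_A v
  t_A v := S.t_A v
  t_ne g hg := S.t_ne _ hg
  A_eq := by
    rintro ⟨y, hy⟩ h
    rcases S.twist_cases hy with ⟨m, hm, rfl, hs, -⟩ | ⟨x, rfl⟩
    · have h1 : S.A (awayInv p (Q.s m), awayInv p (Q.t m) - awayInv p (Q.s m)) = m := S.A_eq m hs
      refine Subtype.ext ?_
      change Blowup.off (S.A (awayInv p (Q.s m), awayInv p (Q.t m) - awayInv p (Q.s m))) _ = _
      congr 1
    · exact absurd (Q.s_one p) h
  B_of_ne v hv := S.twistB_of_ne hk hv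
  s_B v _ := by
    change Q.s (Q.blowdown p (S.twistB hk v)) = _
    rw [S.blowdown_twistB, S.s_B _ (S.smul_one_mem v)]
    simp
  t_B_zero x _ := by
    change Q.t (Q.blowdown p (S.twistB hk (0, x))) = _
    rw [S.blowdown_twistB, zero_smul, ← S.one_self, Q.t_one]
  B_eq := by
    rintro ⟨y, hy⟩ h
    refine ⟨mem_univ _, ?_⟩
    rcases S.twist_cases hy with ⟨m, hm, rfl, hs, -⟩ | ⟨x, rfl⟩
    · have h : Q.s m ≠ away p 0 := h
      change S.twistB hk (nearInv p (Q.s m), S.c m / nearInv p (Q.s m)) = _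
      have h0 := (awayInv_eq p hs h).1
      rw [S.twistB_of_ne hk h0]
      refine Subtype.ext ?_
      have h1 := S.B_β h
      rw [β, S.B_of_ne _ h0] at h1
      have h2 : nearInv p (Q.s m) ^ (k + 1) * (nearInv p (Q.s m))⁻¹ ^ 2 *
          (S.c m / nearInv p (Q.s m)) =
            nearInv p (Q.s m) ^ k * (nearInv p (Q.s m))⁻¹ ^ 2 * S.c m := by
        field_simp
        ring
      change Blowup.off (S.A ((nearInv p (Q.s m))⁻¹, nearInv p (Q.s m) ^ (k + 1) *
        (nearInv p (Q.s m))⁻¹ ^ 2 * (S.c m / nearInv p (Q.s m)))) _ = _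
      congr 1
      rw [h2, h1]
    · have h1 : nearInv p ((Q.twist p).s ⟨_, hy⟩) = 0 := by
        change nearInv p (Q.s (Q.one p)) = 0
        rw [Q.s_one, nearInv_self]
      rw [h1, S.param.slope_dir, S.twistB_zero]
      simp only [div_one]
      rfl
  c_B := by
    rintro ⟨f, x⟩ -
    by_cases hf : f = 0
    · subst hf
      rw [S.twistB_zero, S.param.slope_dir]
      simp
    · rw [S.twistB_of_ne hk hf]
      have h1 : S.B (f, f * x) = S.A (f⁻¹, f ^ (k + 1) * f⁻¹ ^ 2 * x) := by
        rw [S.B_of_ne (f, f * x) hf]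
        congr 2
        ring
      change (S.β (S.A (f⁻¹, f ^ (k + 1) * f⁻¹ ^ 2 * x))).2 / (S.β _).1 = x
      rw [← h1, S.β_B (S.mem_of_ne _ hf)]
      field_simp

end Twist

end Std

end PLine

/-! ### The base of the induction: the first twist of the pair groupoid -/

namespace PLine

/-- The pair groupoid of `ℙ¹`. -/
abbrev pairQ : ReflGraph (OnePoint ℂ) := ReflGraph.pair (OnePoint ℂ)

instance : T2Space pairQ.Arrow := inferInstanceAs (T2Space (OnePoint ℂ × OnePoint ℂ))

theorem contMDiffAt_pairQ_mk {V H N : Type*} [NormedAddCommGroup V] [NormedSpace ℂ V]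
    [TopologicalSpace H] {I : ModelWithCorners ℂ V H} [TopologicalSpace N] [ChartedSpace H N]
    {f g : N → OnePoint ℂ} {n : N} (hf : ContMDiffAt I 𝓘(ℂ, ℂ) ω f n)
    (hg : ContMDiffAt I 𝓘(ℂ, ℂ) ω g n) :
    ContMDiffAt (M' := pairQ.Arrow) I 𝓘(ℂ, ℂ × ℂ) ω (fun x ↦ (f x, g x)) n := by
  rw [modelWithCornersSelf_prod]
  exact hf.prodMk hg

variable (p : OnePoint ℂ)

/-- The coordinates at `(p, p)` given by the source and the target. -/
def pairParam : Blowup.Param (pairQ.one p) where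
  toFun v := ((near p v.2, near p v.1) : OnePoint ℂ × OnePoint ℂ)
  coord g := (nearInv p (pairQ.s g), nearInv p (pairQ.t g))
  map_zero := Prod.ext (near_zero p) (near_zero p)
  contMDiffAt_toFun := contMDiffAt_pairQ_mk
    ((contMDiff_near p).contMDiffAt.comp _ contDiff_snd.contMDiff.contMDiffAt)
    ((contMDiff_near p).contMDiffAt.comp _ contDiff_fst.contMDiff.contMDiffAt)
  contMDiffAt_coord :=
    ((contMDiffAt_nearInv p (away_ne p 0).symm).comp (pairQ.one p)
      (pairQ.contMDiff_s (pairQ.one p))).prodMk_space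
      ((contMDiffAt_nearInv p (away_ne p 0).symm).comp (pairQ.one p)
        (pairQ.contMDiff_t (pairQ.one p)))
  coord_toFun := .of_forall fun v ↦ Prod.ext (nearInv_near p _) (nearInv_near p _)
  toFun_coord := by
    filter_upwards [(pairQ.contMDiff_s.continuous.continuousAt (x := pairQ.one p)).eventually_ne
      (away_ne p 0).symm, (pairQ.contMDiff_t.continuous.continuousAt
        (x := pairQ.one p)).eventually_ne (away_ne p 0).symm] with g h1 h2
    exact Prod.ext (near_nearInv p h2) (near_nearInv p h1)

/-- The arrow of the pair groupoid with source `u` and target `u + a`. -/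
def pairA (v : ℂ × ℂ) : pairQ.Arrow := ((away p (v.1 + v.2), away p v.1) : OnePoint ℂ × OnePoint ℂ)

theorem contMDiff_pairA : ContMDiff 𝓘(ℂ, ℂ × ℂ) 𝓘(ℂ, ℂ × ℂ) ω (pairA p) := fun v ↦
  contMDiffAt_pairQ_mk
    ((contMDiff_away p).contMDiffAt.comp v (contDiff_fst.add contDiff_snd).contMDiff.contMDiffAt)
    ((contMDiff_away p).contMDiffAt.comp v contDiff_fst.contMDiff.contMDiffAt)

theorem pairA_ne (v : ℂ × ℂ) : pairA p v ≠ pairQ.one p := fun h ↦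
  away_ne p v.1 (congrArg Prod.snd h)

/-- The coordinates `A` on the twist of the pair groupoid. -/
def twistPairA (v : ℂ × ℂ) : pairQ.twistArrow p :=
  ⟨.off (pairA p v) (pairA_ne p v),
    (pairQ.off_mem_twistArrow p _).2 ⟨away_ne p v.1, away_ne p (v.1 + v.2)⟩⟩

theorem contMDiff_twistPairA : ContMDiff 𝓘(ℂ, ℂ × ℂ) 𝓘(ℂ, ℂ × ℂ) ω (twistPairA p) := fun v ↦
  pairQ.contMDiffAt_twistArrow p (Blowup.contMDiffAt_of_down (contMDiff_pairA p v) (pairA_ne p v))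

/-- In the direction `(1, r)` the source has derivative `1` and the target `r`, so here the removal
of the target fibre imposes the condition `r ≠ 0`. -/
theorem pairParam_dir_mem {r : ℂ} (hr : r ≠ 0) :
    (pairParam p).dir (1, r) (Std.one_fst_ne_zero r) ∈ pairQ.twistArrow p := by
  rintro (h | h)
  · have h1 : HasDerivAt (fun τ : ℂ ↦ chartAt ℂ p
        (pairQ.s ((pairParam p).toFun (τ • ((1 : ℂ), r))))) 1 0 := by
      refine Std.hasDerivAt_chart_near (p := p) (g := fun τ ↦ τ * 1) ?_
      simpa using hasDerivAt_id' (0 : ℂ)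
    exact (pairParam p).dir_notMem_closure ((pairQ.contMDiff_s (pairQ.one p)).mdifferentiableAt
      (by simp)) (Std.one_fst_ne_zero r) one_ne_zero h1 h
  · have h1 : HasDerivAt (fun τ : ℂ ↦ chartAt ℂ p
        (pairQ.t ((pairParam p).toFun (τ • ((1 : ℂ), r))))) r 0 := by
      refine Std.hasDerivAt_chart_near (p := p) (g := fun τ ↦ τ * r) ?_
      simpa using (hasDerivAt_id' (0 : ℂ)).mul_const r
    exact (pairParam p).dir_notMem_closure ((pairQ.contMDiff_t (pairQ.one p)).mdifferentiableAt
      (by simp)) (Std.one_fst_ne_zero r) hr h1 h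

open Classical in
/-- The coordinates `B` on the twist of the pair groupoid. -/
def twistPairB (v : ℂ × ℂ) : pairQ.twistArrow p :=
  -- The coordinate `x` on the exceptional divisor is defined by `1 + x = 1 / r`, which makes `x =
  -- 0` the direction of the diagonal. At `(0, -1)`, outside `twistPairDomain`, the value does not
  -- matter.
  if h : v.1 = 0 ∧ 1 + v.2 ≠ 0 then ⟨_, pairParam_dir_mem p (inv_ne_zero h.2)⟩
  else twistPairA p (v.1⁻¹, v.1 ^ 1 * v.1⁻¹ ^ 2 * v.2)

theorem twistPairB_zero {x : ℂ} (hx : 1 + x ≠ 0) :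
    twistPairB p (0, x) = ⟨_, pairParam_dir_mem p (inv_ne_zero hx)⟩ := dif_pos ⟨rfl, hx⟩

theorem twistPairB_of_ne {v : ℂ × ℂ} (hv : v.1 ≠ 0) :
    twistPairB p v = twistPairA p (v.1⁻¹, v.1 ^ 1 * v.1⁻¹ ^ 2 * v.2) := dif_neg fun h ↦ hv h.1

/-- The domain of the coordinates `B` on the twist of the pair groupoid. -/
def twistPairDomain : Set (ℂ × ℂ) := {v | v.1 ≠ 0 ∨ 1 + v.2 ≠ 0}

theorem isOpen_twistPairDomain : IsOpen twistPairDomain :=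
  (isOpen_ne_fun continuous_fst continuous_const).union
    (isOpen_ne_fun (by fun_prop) continuous_const)

theorem s_twistPairB {v : ℂ × ℂ} (hv : v ∈ twistPairDomain) :
    (pairQ.twist p).s (twistPairB p v) = near p v.1 := by
  obtain ⟨f, x⟩ := v
  by_cases hf : f = 0
  · subst hf
    rw [twistPairB_zero p (hv.resolve_left fun h ↦ h rfl), near_zero]
    rfl
  · rw [twistPairB_of_ne p hf, near_of_ne p hf]
    rfl

/-- The target has `u`-coordinate `(1 + x) / f`, hence coordinate `f * (1 + x)⁻¹` near `p`. -/
theorem blowdown_twistPairB {v : ℂ × ℂ} (hv : 1 + v.2 ≠ 0) :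
    pairQ.blowdown p (twistPairB p v) = (pairParam p).toFun (v.1 • ((1 : ℂ), (1 + v.2)⁻¹)) := by
  obtain ⟨f, x⟩ := v
  by_cases hf : f = 0
  · subst hf
    rw [twistPairB_zero p hv, zero_smul, (pairParam p).map_zero]
    rfl
  · rw [twistPairB_of_ne p hf]
    have hv : 1 + x ≠ 0 := hv
    have h1 : f⁻¹ + f ^ 1 * f⁻¹ ^ 2 * x = (f * (1 + x)⁻¹)⁻¹ := by
      field_simp
    refine Prod.ext ?_ ?_
    · change away p (f⁻¹ + f ^ 1 * f⁻¹ ^ 2 * x) = near p (f * (1 + x)⁻¹)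
      rw [near_of_ne p (mul_ne_zero hf (inv_ne_zero hv)), h1]
    · change away p f⁻¹ = near p (f * 1)
      rw [mul_one, near_of_ne p hf]

theorem contMDiffAt_twistPairB {v : ℂ × ℂ} (hv : v ∈ twistPairDomain) :
    ContMDiffAt 𝓘(ℂ, ℂ × ℂ) 𝓘(ℂ, ℂ × ℂ) ω (twistPairB p) v := by
  by_cases hf : v.1 = 0
  · have hx := hv.resolve_left fun h ↦ h hf
    have hev : ∀ᶠ w : ℂ × ℂ in 𝓝 v, 1 + w.2 ≠ 0 :=
      (Continuous.continuousAt (by fun_prop)).eventually_ne hx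
    refine pairQ.contMDiffAt_twistArrow p ?_
    refine (pairParam p).contMDiffAt_of_polar (τ := Prod.fst) (w := fun v ↦ (1, (1 + v.2)⁻¹))
      contDiffAt_fst (contDiffAt_const.prodMk ((contDiffAt_const.add contDiffAt_snd).inv hx)) hf
      (Std.one_fst_ne_zero _) ?_ ?_
    · filter_upwards [hev] with w hw hw0
      obtain ⟨f, x⟩ := w
      obtain rfl : f = 0 := hw0
      refine ⟨Std.one_fst_ne_zero _, ?_⟩
      rw [twistPairB_zero p hw]
    · filter_upwards [hev] with w hw _
      exact blowdown_twistPairB p hw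
  · have h1 : ContDiffAt ℂ ω (fun v : ℂ × ℂ ↦ (v.1⁻¹, v.1 ^ 1 * v.1⁻¹ ^ 2 * v.2)) v :=
      (contDiffAt_fst.inv hf).prodMk
        (((contDiffAt_fst.pow 1).mul ((contDiffAt_fst.inv hf).pow 2)).mul contDiffAt_snd)
    refine ((contMDiff_twistPairA p).contMDiffAt.comp v h1.contMDiffAt).congr_of_eventuallyEq ?_
    filter_upwards [(isOpen_ne_fun continuous_fst continuous_const).mem_nhds hf] with w hw
    exact twistPairB_of_ne p hw

/-- The two axes of `pairParam` are the target and source fibres over `p`, so both axis directions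
are removed and the slope of a remaining direction is invertible. -/
theorem twistPair_cases {y : Blowup (pairQ.one p)} (hy : y ∈ pairQ.twistArrow p) :
    (∃ m hm, y = .off m hm ∧ pairQ.s m ≠ p ∧ pairQ.t m ≠ p) ∨
      ∃ x : ℂ, 1 + x ≠ 0 ∧ y = (pairParam p).dir (1, (1 + x)⁻¹) (Std.one_fst_ne_zero _) := by
  rcases y with ⟨m, hm⟩ | l
  · exact .inl ⟨m, hm, rfl, (pairQ.off_mem_twistArrow p hm).1 hy⟩
  · obtain ⟨v, hv, h⟩ := (pairParam p).exists_eq_dir l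
    right
    have hv1 : v.1 ≠ 0 := by
      intro h0
      refine hy (Or.inl ?_)
      rw [h]
      refine (pairParam p).dir_mem_closure hv (.of_forall fun τ ↦ ?_)
      change near p (τ * v.1) = p
      rw [h0, mul_zero, near_zero]
    have hv2 : v.2 ≠ 0 := by
      intro h0
      refine hy (Or.inr ?_)
      rw [h]
      refine (pairParam p).dir_mem_closure hv (.of_forall fun τ ↦ ?_)
      change near p (τ * v.2) = p
      rw [h0, mul_zero, near_zero]
    have h1 : 1 + (v.1 / v.2 - 1) = v.1 / v.2 := by ring
    refine ⟨v.1 / v.2 - 1, by rw [h1]; exact div_ne_zero hv1 hv2, h.trans ?_⟩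
    rw [(pairParam p).dir_eq_iff]
    refine ⟨v.1, Prod.ext (by simp) ?_⟩
    rw [h1]
    simp only [Prod.smul_snd, smul_eq_mul]
    field_simp

open Classical in
/-- The coordinate `c` on the twist of the pair groupoid. -/
def twistPairC (y : Blowup (pairQ.one p)) : ℂ :=
  if pairQ.s (Blowup.down _ y) = p then ((pairParam p).slope y)⁻¹ - 1
  else nearInv p (pairQ.s (Blowup.down _ y)) * awayInv p (pairQ.t (Blowup.down _ y)) - 1

theorem twistPairC_off {m : pairQ.Arrow} (hm : m ≠ pairQ.one p) (hs : pairQ.s m ≠ p) :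
    twistPairC p (.off m hm) = nearInv p (pairQ.s m) * awayInv p (pairQ.t m) - 1 := if_neg hs

theorem twistPairC_dir {x : ℂ} :
    twistPairC p ((pairParam p).dir (1, (1 + x)⁻¹) (Std.one_fst_ne_zero _)) = x := by
  rw [twistPairC, if_pos, (pairParam p).slope_dir]
  · simp
  · rfl

/-- Near the exceptional divisor the slope is the quotient of the coordinates `nearInv` of target
and source, and the inverse of the former is `awayInv` of the target. So both branches of the
definition are there the single expression `slope⁻¹ - 1`, provided the target stays away from the
point `u = 0`. -/
theorem contMDiffAt_twistPairC {y : Blowup (pairQ.one p)} (hy : y ∈ pairQ.twistArrow p)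
    (hq : pairQ.s (Blowup.down _ y) ≠ away p 0) :
    ContMDiffAt 𝓘(ℂ, ℂ × ℂ) 𝓘(ℂ, ℂ) ω (twistPairC p) y := by
  have hs : ContMDiff 𝓘(ℂ, ℂ × ℂ) 𝓘(ℂ, ℂ) ω (fun y ↦ pairQ.s (Blowup.down (pairQ.one p) y)) :=
    pairQ.contMDiff_s.comp (Blowup.contMDiff_down _)
  have ht : ContMDiff 𝓘(ℂ, ℂ × ℂ) 𝓘(ℂ, ℂ) ω (fun y ↦ pairQ.t (Blowup.down (pairQ.one p) y)) :=
    pairQ.contMDiff_t.comp (Blowup.contMDiff_down _)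
  rcases twistPair_cases p hy with ⟨m, hm, rfl, hsm, htm⟩ | ⟨x, hx, rfl⟩
  · have h1 := ((contMDiffAt_nearInv p hq).comp (Blowup.off m hm) (hs _)).prodMk_space
      ((contMDiffAt_awayInv p htm).comp (Blowup.off m hm) (ht (.off m hm)))
    have h2 : ContDiff ℂ ω (fun v : ℂ × ℂ ↦ v.1 * v.2 - 1) :=
      (contDiff_fst.mul contDiff_snd).sub contDiff_const
    refine (ContMDiffAt.comp (Blowup.off m hm) (g := fun v : ℂ × ℂ ↦ v.1 * v.2 - 1)
      h2.contMDiff.contMDiffAt h1).congr_of_eventuallyEq ?_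
    filter_upwards [hs.continuous.continuousAt.eventually_ne
      (show pairQ.s (Blowup.down (pairQ.one p) (.off m hm)) ≠ p from hsm)] with z hz
    exact if_neg hz
  · have h1 := (pairParam p).contMDiffAt_slope_dir (v := (1, (1 + x)⁻¹))
      (Std.one_fst_ne_zero _) one_ne_zero
    have h2 : ContDiffAt ℂ ω (fun r : ℂ ↦ r⁻¹ - 1)
        ((pairParam p).slope ((pairParam p).dir (1, (1 + x)⁻¹) (Std.one_fst_ne_zero _))) := by
      refine (contDiffAt_inv ℂ ?_).sub contDiffAt_const
      rw [(pairParam p).slope_dir]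
      simpa using hx
    refine (ContMDiffAt.comp ((pairParam p).dir (1, (1 + x)⁻¹) (Std.one_fst_ne_zero _))
      (g := fun r : ℂ ↦ r⁻¹ - 1) h2.contMDiffAt h1).congr_of_eventuallyEq ?_
    have hopen : IsOpen (pairQ.twistArrow p : Set (Blowup (pairQ.one p))) :=
      (pairQ.twistArrow p).isOpen
    have h3 : pairQ.t (Blowup.down (pairQ.one p)
        ((pairParam p).dir (1, (1 + x)⁻¹) (Std.one_fst_ne_zero _))) ≠ away p 0 := (away_ne p 0).symm
    filter_upwards [hopen.mem_nhds hy, ht.continuous.continuousAt.eventually_ne h3] with z hz hz2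
    rcases twistPair_cases p hz with ⟨m, hm, rfl, hsm, htm⟩ | ⟨x, hx, rfl⟩
    · change twistPairC p _ = ((nearInv p (pairQ.t m)) / (nearInv p (pairQ.s m)))⁻¹ - 1
      rw [twistPairC_off p hm hsm, (awayInv_eq p htm hz2).2, inv_div, div_eq_mul_inv]
    · exact if_pos rfl

/-- Standard coordinates on the twist of the pair groupoid. -/
def stdOne : Std p 1 twistPairDomain (pairQ.twist p) where
  A := twistPairA p
  B := twistPairB p
  c y := twistPairC p y.1
  isOpen := isOpen_twistPairDomain
  zero_mem := Or.inr (by simp)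
  mem_of_ne _ := Or.inl
  contMDiff_A := contMDiff_twistPairA p
  contMDiffOn_B v hv := (contMDiffAt_twistPairB p hv).contMDiffWithinAt
  contMDiffAt_c g hg := (contMDiffAt_twistPairC p g.2 hg).comp g contMDiff_subtype_val.contMDiffAt
  s_A _ := rfl
  t_A _ := rfl
  t_ne := by
    rintro ⟨y, hy⟩ h
    rcases twistPair_cases p hy with ⟨m, hm, rfl, hs, ht⟩ | ⟨x, hx, rfl⟩
    · exact ht
    · exact absurd rfl h
  A_eq := by
    rintro ⟨y, hy⟩ h
    rcases twistPair_cases p hy with ⟨m, hm, rfl, hs, ht⟩ | ⟨x, hx, rfl⟩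
    · refine Subtype.ext ?_
      change Blowup.off (pairA p (awayInv p (pairQ.s m),
        awayInv p (pairQ.t m) - awayInv p (pairQ.s m))) _ = _
      congr 1
      refine Prod.ext ?_ (away_awayInv p hs)
      change away p (awayInv p (pairQ.s m) + (awayInv p (pairQ.t m) - awayInv p (pairQ.s m))) = _
      rw [add_sub_cancel]
      exact away_awayInv p ht
    · exact absurd rfl h
  B_of_ne v hv := twistPairB_of_ne p hv
  s_B v hv := s_twistPairB p hv
  t_B_zero x hx := by
    rw [twistPairB_zero p (hx.resolve_left fun h ↦ h rfl)]
    rfl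
  B_eq := by
    rintro ⟨y, hy⟩ h
    rcases twistPair_cases p hy with ⟨m, hm, rfl, hs, ht⟩ | ⟨x, hx, rfl⟩
    · have h : pairQ.s m ≠ away p 0 := h
      obtain ⟨h0, h1⟩ := awayInv_eq p hs h
      change (nearInv p (pairQ.s m), twistPairC p (.off m hm)) ∈ twistPairDomain ∧
        twistPairB p (nearInv p (pairQ.s m), twistPairC p (.off m hm)) = _
      refine ⟨Or.inl h0, ?_⟩
      rw [twistPairC_off p hm hs, twistPairB_of_ne p h0]
      refine Subtype.ext ?_
      change Blowup.off (pairA p ((nearInv p (pairQ.s m))⁻¹, nearInv p (pairQ.s m) ^ 1 *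
        (nearInv p (pairQ.s m))⁻¹ ^ 2 * (nearInv p (pairQ.s m) * awayInv p (pairQ.t m) - 1))) _ = _
      congr 1
      refine Prod.ext ?_ ?_
      · change away p ((nearInv p (pairQ.s m))⁻¹ + nearInv p (pairQ.s m) ^ 1 *
          (nearInv p (pairQ.s m))⁻¹ ^ 2 * (nearInv p (pairQ.s m) * awayInv p (pairQ.t m) - 1)) = _
        have h2 : (nearInv p (pairQ.s m))⁻¹ + nearInv p (pairQ.s m) ^ 1 *
          (nearInv p (pairQ.s m))⁻¹ ^ 2 * (nearInv p (pairQ.s m) * awayInv p (pairQ.t m) - 1) =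
            awayInv p (pairQ.t m) := by
          field_simp
          ring
        rw [h2]
        exact away_awayInv p ht
      · change away p (nearInv p (pairQ.s m))⁻¹ = _
        rw [← h1]
        exact away_awayInv p hs
    · have h1 : nearInv p ((pairQ.twist p).s ⟨_, hy⟩) = 0 := nearInv_self p
      rw [h1, twistPairC_dir]
      exact ⟨Or.inr hx, twistPairB_zero p hx⟩
  c_B := by
    rintro ⟨f, x⟩ hv
    by_cases hf : f = 0
    · subst hf
      rw [twistPairB_zero p (hv.resolve_left fun h ↦ h rfl)]
      exact twistPairC_dir p
    · rw [twistPairB_of_ne p hf]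
      change twistPairC p (.off (pairA p (f⁻¹, f ^ 1 * f⁻¹ ^ 2 * x)) _) = x
      rw [twistPairC_off p (pairA_ne p (f⁻¹, f ^ 1 * f⁻¹ ^ 2 * x)) (away_ne p f⁻¹)]
      change nearInv p (away p f⁻¹) * awayInv p (away p (f⁻¹ + f ^ 1 * f⁻¹ ^ 2 * x)) - 1 = x
      rw [awayInv_away, ← near_of_ne p hf, nearInv_near]
      field_simp
      ring

/-- Standard coordinates on `Pair(ℙ¹, (k + 2) • p)`. -/
def stdPair : (k : ℕ) → Std p (k + 2) univ (pairGraph p (k + 2))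
  | 0 => (stdOne p).twist le_rfl
  | k + 1 => (stdPair k).twist (Nat.le_add_left 1 (k + 1))

end PLine

/-! ### The groupoid structure and its uniqueness -/

/-- A map to a curve is submersive where it has nonzero derivative along some curve. -/
theorem surjective_mfderiv_of_hasDerivAt {M X : Type} [TopologicalSpace M]
    [ChartedSpace (ℂ × ℂ) M] [TopologicalSpace X] [ChartedSpace ℂ X] {σ : M → X} {F : ℂ → M}
    {ψ : X → ℂ} {z d : ℂ} (hσ : MDifferentiableAt 𝓘(ℂ, ℂ × ℂ) 𝓘(ℂ, ℂ) σ (F z))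
    (hF : MDifferentiableAt 𝓘(ℂ, ℂ) 𝓘(ℂ, ℂ × ℂ) F z)
    (hψ : MDifferentiableAt 𝓘(ℂ, ℂ) 𝓘(ℂ, ℂ) ψ (σ (F z)))
    (h : HasDerivAt (fun w ↦ ψ (σ (F w))) d z) (hd : d ≠ 0) :
    Function.Surjective (mfderiv 𝓘(ℂ, ℂ × ℂ) 𝓘(ℂ, ℂ) σ (F z)) := by
  have h1 := hψ.hasMFDerivAt.comp z (hσ.hasMFDerivAt.comp z hF.hasMFDerivAt)
  set V : ℂ →L[ℂ] ℂ × ℂ := mfderiv 𝓘(ℂ, ℂ) 𝓘(ℂ, ℂ × ℂ) F z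
  set D : ℂ × ℂ →L[ℂ] ℂ := mfderiv 𝓘(ℂ, ℂ × ℂ) 𝓘(ℂ, ℂ) σ (F z) with hD
  set E : ℂ →L[ℂ] ℂ := mfderiv 𝓘(ℂ, ℂ) 𝓘(ℂ, ℂ) ψ (σ (F z))
  have h2 : HasFDerivAt (fun w ↦ ψ (σ (F w))) (E.comp (D.comp V)) z :=
    hasMFDerivAt_iff_hasFDerivAt.1 h1
  set v := V 1
  have h4 : E (D v) = d := h2.hasDerivAt.unique h
  have h5 : D v ≠ 0 := by
    intro h0
    rw [h0, map_zero] at h4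
    exact hd h4.symm
  change Function.Surjective D
  intro y
  refine ⟨(y / D v) • v, ?_⟩
  rw [map_smul, smul_eq_mul, div_mul_cancel₀ _ h5]

namespace PLine

namespace Std

variable {p : OnePoint ℂ} {k : ℕ} {Q : ReflGraph (OnePoint ℂ)} (S : Std p (k + 2) univ Q)

theorem B_of_ne' {f : ℂ} (hf : f ≠ 0) (x : ℂ) : S.B (f, x) = S.A (f⁻¹, f ^ k * x) := by
  rw [S.B_of_ne (f, x) hf]
  congr 2
  field_simp
  ring

theorem t_B' {f x : ℂ} (h : 1 + x * f ^ (k + 1) ≠ 0) :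
    Q.t (S.B (f, x)) = near p (f / (1 + x * f ^ (k + 1))) :=
  S.t_B (by omega) (mem_univ _) h

theorem contMDiff_B : ContMDiff 𝓘(ℂ, ℂ × ℂ) 𝓘(ℂ, ℂ × ℂ) ω S.B := contMDiffOn_univ.1 S.contMDiffOn_B

theorem s_B' (f x : ℂ) : Q.s (S.B (f, x)) = near p f := S.s_B (f, x) (mem_univ _)

theorem s_B0 (x : ℂ) : Q.s (S.B (0, x)) = p := S.s_B_zero (mem_univ _)

theorem t_B0 (x : ℂ) : Q.t (S.B (0, x)) = p := S.t_B_zero x (mem_univ _)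

theorem c_B' (f x : ℂ) : S.c (S.B (f, x)) = x := S.c_B (f, x) (mem_univ _)

theorem cases (g : Q.Arrow) : (∃ u a, g = S.A (u, a)) ∨ ∃ x, g = S.B (0, x) := by
  by_cases hg : Q.s g = p
  · obtain ⟨x, -, hx⟩ := S.exists_eq_B hg
    exact .inr ⟨x, hx⟩
  · obtain ⟨⟨u, a⟩, h⟩ := S.exists_eq_A hg
    exact .inl ⟨u, a, h⟩

/-- Source and target are both `p` or both different from `p`, so a composable pair lies entirely in
the fibre over `p` or entirely in the chart `A`. -/
theorem composable_cases {g h : Q.Arrow} (hgh : Q.s g = Q.t h) :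
    (∃ u a b, h = S.A (u, a) ∧ g = S.A (u + a, b)) ∨ ∃ x y, h = S.B (0, x) ∧ g = S.B (0, y) := by
  rcases S.cases h with ⟨u, a, rfl⟩ | ⟨x, rfl⟩
  · rcases S.cases g with ⟨v, b, rfl⟩ | ⟨y, rfl⟩
    · rw [S.s_A, S.t_A] at hgh
      obtain rfl : v = u + a := away_injective p hgh
      exact .inl ⟨u, a, b, rfl, rfl⟩
    · rw [S.s_B0] at hgh
      exact absurd hgh.symm (S.t_A_ne _)
  · rw [S.t_B0] at hgh
    obtain ⟨y, -, rfl⟩ := S.exists_eq_B hgh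
    exact .inr ⟨x, y, rfl, rfl⟩

open Classical in
/-- The product: the addition of the second coordinates. -/
def mul (g h : Q.Arrow) : Q.Arrow :=
  if Q.s h = p then S.B (0, S.c h + S.c g)
  else S.A ((α (p := p) h).1, (α (p := p) h).2 + (α (p := p) g).2)

open Classical in
/-- The inverse. -/
def inv (g : Q.Arrow) : Q.Arrow :=
  if Q.s g = p then S.B (0, -S.c g)
  else S.A ((α (p := p) g).1 + (α (p := p) g).2, -(α (p := p) g).2)

theorem mul_A (u a v b : ℂ) : S.mul (S.A (v, b)) (S.A (u, a)) = S.A (u, a + b) := by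
  rw [mul, if_neg (S.s_A_ne _), S.α_A, S.α_A]

theorem mul_B (x y : ℂ) : S.mul (S.B (0, y)) (S.B (0, x)) = S.B (0, x + y) := by
  rw [mul, if_pos (S.s_B0 x), S.c_B', S.c_B']

theorem inv_A (u a : ℂ) : S.inv (S.A (u, a)) = S.A (u + a, -a) := by
  rw [inv, if_neg (S.s_A_ne _), S.α_A]

theorem inv_B (x : ℂ) : S.inv (S.B (0, x)) = S.B (0, -x) := by
  rw [inv, if_pos (S.s_B0 x), S.c_B']

/-- The product in the coordinates `B`. -/
theorem mul_B_of_composable {f f' x y : ℂ} (hρ : 1 + x * f ^ (k + 1) ≠ 0)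
    (h : Q.s (S.B (f', y)) = Q.t (S.B (f, x))) :
    S.mul (S.B (f', y)) (S.B (f, x)) = S.B (f, x + ((1 + x * f ^ (k + 1)) ^ k)⁻¹ * y) := by
  rw [S.s_B', S.t_B' hρ] at h
  obtain rfl := near_injective p h
  by_cases hf : f = 0
  · subst hf
    rw [zero_div, S.mul_B]
    simp
  -- With `ρ = 1 + x * f ^ (k + 1)` the left factor has source `f / ρ`, so its fibre coordinate is
  -- `a = (f / ρ) ^ k * y`. The common factor `f ^ k` comes out of the sum.
  · rw [S.B_of_ne' hf, S.B_of_ne' hf, S.B_of_ne' (div_ne_zero hf hρ), S.mul_A, div_pow, mul_add]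
    congr 3
    field_simp

/-- The inverse in the coordinates `B`. -/
theorem inv_B_of_ne {f x : ℂ} (hρ : 1 + x * f ^ (k + 1) ≠ 0) :
    S.inv (S.B (f, x)) = S.B (f / (1 + x * f ^ (k + 1)), -((1 + x * f ^ (k + 1)) ^ k * x)) := by
  by_cases hf : f = 0
  · subst hf
    rw [S.inv_B]
    simp
  · rw [S.B_of_ne' hf, S.B_of_ne' (div_ne_zero hf hρ), S.inv_A]
    congr 2
    · field_simp
      ring
    · rw [div_pow]
      field_simp

theorem eventually_ne_zero {g : Q.Arrow} (hg : Q.s g = p) :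
    (∀ᶠ h in 𝓝 g, Q.s h ≠ away p 0) ∧
      ∀ᶠ h in 𝓝 g, 1 + (S.β h).2 * (S.β h).1 ^ (k + 1) ≠ 0 := by
  have hq := s_ne_of_eq hg
  have h1 : ContinuousAt S.β g := (S.contMDiffAt_β hq).continuousAt
  refine ⟨Q.contMDiff_s.continuous.continuousAt.eventually_ne hq, ?_⟩
  have h2 : ContinuousAt (fun h ↦ 1 + (S.β h).2 * (S.β h).1 ^ (k + 1)) g :=
    ContinuousAt.comp (g := fun v : ℂ × ℂ ↦ 1 + v.2 * v.1 ^ (k + 1)) (by fun_prop) h1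
  refine h2.eventually_ne ?_
  rw [(S.β_eq_zero_iff hq).2 hg]
  simp

/-- Over `p` the product is the rational expression of `mul_B_of_composable`, whose denominator is
`1` at `f = 0`. It agrees with `mul` on composable pairs only, so the comparison is made within that
set; off `p` the product agrees with addition in the chart `A` on a full neighbourhood. -/
theorem contMDiffOn_mul :
    ContMDiffOn (𝓘(ℂ, ℂ × ℂ).prod 𝓘(ℂ, ℂ × ℂ)) 𝓘(ℂ, ℂ × ℂ) ω
      (fun q : Q.Arrow × Q.Arrow ↦ S.mul q.1 q.2) {q | Q.s q.1 = Q.t q.2} := by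
  rintro ⟨g, h⟩ (hgh : Q.s g = Q.t h)
  have hs : Continuous fun q : Q.Arrow × Q.Arrow ↦ Q.s q.2 :=
    Q.contMDiff_s.continuous.comp continuous_snd
  by_cases hh : Q.s h = p
  · have hg : Q.s g = p := hgh.trans (S.t_eq hh)
    have h1 : ContMDiffAt (𝓘(ℂ, ℂ × ℂ).prod 𝓘(ℂ, ℂ × ℂ)) 𝓘(ℂ, (ℂ × ℂ) × (ℂ × ℂ)) ω
        (fun q : Q.Arrow × Q.Arrow ↦ (S.β q.1, S.β q.2)) (g, h) :=
      ((S.contMDiffAt_β (s_ne_of_eq hg)).comp (g, h) contMDiffAt_fst).prodMk_space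
        ((S.contMDiffAt_β (s_ne_of_eq hh)).comp (g, h) contMDiffAt_snd)
    set G : (ℂ × ℂ) × (ℂ × ℂ) → ℂ × ℂ := fun w ↦
      (w.2.1, w.2.2 + ((1 + w.2.2 * w.2.1 ^ (k + 1)) ^ k)⁻¹ * w.1.2) with hG
    have h2 : ContDiffAt ℂ ω G (S.β g, S.β h) := by
      have e1 : ContDiffAt ℂ ω (fun w : (ℂ × ℂ) × (ℂ × ℂ) ↦ w.2.1) (S.β g, S.β h) :=
        contDiff_snd.fst.contDiffAt
      have e2 : ContDiffAt ℂ ω (fun w : (ℂ × ℂ) × (ℂ × ℂ) ↦ w.2.2) (S.β g, S.β h) :=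
        contDiff_snd.snd.contDiffAt
      have e3 : ContDiffAt ℂ ω (fun w : (ℂ × ℂ) × (ℂ × ℂ) ↦ w.1.2) (S.β g, S.β h) :=
        contDiff_fst.snd.contDiffAt
      refine e1.prodMk (e2.add ((((contDiffAt_const.add (e2.mul (e1.pow _))).pow k).inv ?_).mul e3))
      have : (S.β h).1 = 0 := (S.β_eq_zero_iff (s_ne_of_eq hh)).2 hh
      simp [this]
    refine ((S.contMDiff_B _).comp (g, h) (h2.contMDiffAt.comp (g, h) h1)
      ).contMDiffWithinAt.congr_of_eventuallyEq ?_ ?_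
    · filter_upwards [self_mem_nhdsWithin,
        nhdsWithin_le_nhds (continuous_snd.continuousAt.eventually (S.eventually_ne_zero hh).1),
        nhdsWithin_le_nhds (continuous_snd.continuousAt.eventually (S.eventually_ne_zero hh).2),
        nhdsWithin_le_nhds (continuous_fst.continuousAt.eventually (S.eventually_ne_zero hg).1)]
        with q h1 h2 h3 h4
      have h5 := S.mul_B_of_composable (f' := (S.β q.1).1) (y := (S.β q.1).2) h3 (by
        simp only [Prod.mk.eta]; rw [S.B_β h2, S.B_β h4]; exact h1)
      simp only [Prod.mk.eta] at h5
      rw [S.B_β h2, S.B_β h4] at h5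
      exact h5
    · obtain ⟨x, -, rfl⟩ := S.exists_eq_B hg
      obtain ⟨y, -, rfl⟩ := S.exists_eq_B hh
      change S.mul (S.B (0, x)) (S.B (0, y)) = S.B _
      rw [S.mul_B]
      simp only [hG, Function.comp_apply, S.β_B (mem_univ _)]
      simp
  · have hg : Q.s g ≠ p := hgh ▸ S.t_ne h hh
    have h1 : ContMDiffAt (𝓘(ℂ, ℂ × ℂ).prod 𝓘(ℂ, ℂ × ℂ)) 𝓘(ℂ, (ℂ × ℂ) × (ℂ × ℂ)) ω
        (fun q : Q.Arrow × Q.Arrow ↦ (α (p := p) q.1, α (p := p) q.2)) (g, h) :=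
      ((S.contMDiffAt_α hg).comp (g, h) contMDiffAt_fst).prodMk_space
        ((S.contMDiffAt_α hh).comp (g, h) contMDiffAt_snd)
    have h2 : ContDiff ℂ ω fun w : (ℂ × ℂ) × (ℂ × ℂ) ↦ (w.2.1, w.2.2 + w.1.2) :=
      contDiff_snd.fst.prodMk (contDiff_snd.snd.add contDiff_fst.snd)
    refine (((S.contMDiff_A _).comp (g, h) (h2.contMDiff.contMDiffAt.comp (g, h) h1)
      ).congr_of_eventuallyEq ?_).contMDiffWithinAt
    filter_upwards [hs.continuousAt.eventually_ne (show Q.s (g, h).2 ≠ p from hh)] with q hq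
    exact if_neg hq

theorem contMDiff_inv : ContMDiff 𝓘(ℂ, ℂ × ℂ) 𝓘(ℂ, ℂ × ℂ) ω S.inv := by
  intro g
  by_cases hg : Q.s g = p
  · have h1 := S.contMDiffAt_β (s_ne_of_eq hg)
    have h0 : (S.β g).1 = 0 := (S.β_eq_zero_iff (s_ne_of_eq hg)).2 hg
    have h2 : ContDiffAt ℂ ω (fun v : ℂ × ℂ ↦
        (v.1 / (1 + v.2 * v.1 ^ (k + 1)), -((1 + v.2 * v.1 ^ (k + 1)) ^ k * v.2))) (S.β g) := by
      have e1 : ContDiffAt ℂ ω (fun v : ℂ × ℂ ↦ 1 + v.2 * v.1 ^ (k + 1)) (S.β g) :=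
        contDiffAt_const.add (contDiffAt_snd.mul (contDiffAt_fst.pow _))
      exact (contDiffAt_fst.div e1 (by simp [h0])).prodMk ((e1.pow k).mul contDiffAt_snd).neg
    refine ((S.contMDiff_B _).comp g (h2.contMDiffAt.comp g h1)).congr_of_eventuallyEq ?_
    filter_upwards [(S.eventually_ne_zero hg).1, (S.eventually_ne_zero hg).2] with h h3 h4
    have h5 := S.inv_B_of_ne h4
    simp only [Prod.mk.eta] at h5
    rw [S.B_β h3] at h5
    exact h5
  · have h2 : ContDiff ℂ ω fun v : ℂ × ℂ ↦ (v.1 + v.2, -v.2) :=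
      (contDiff_fst.add contDiff_snd).prodMk contDiff_snd.neg
    refine ((S.contMDiff_A _).comp g (h2.contMDiff.contMDiffAt.comp g (S.contMDiffAt_α hg))
      ).congr_of_eventuallyEq ?_
    filter_upwards [Q.contMDiff_s.continuous.continuousAt.eventually_ne hg] with h hh
    exact if_neg hh

theorem hasDerivAt_target (x : ℂ) :
    HasDerivAt (fun f : ℂ ↦ f / (1 + x * f ^ (k + 1))) 1 0 := by
  have h3 : HasDerivAt (fun f : ℂ ↦ 1 + x * f ^ (k + 1))
      (deriv (fun f : ℂ ↦ 1 + x * f ^ (k + 1)) 0) 0 := by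
    refine DifferentiableAt.hasDerivAt ?_
    fun_prop
  simpa using (hasDerivAt_id' (0 : ℂ)).fun_div h3 (by simp)

theorem eventually_target_ne (x : ℂ) : ∀ᶠ f : ℂ in 𝓝 0, 1 + x * f ^ (k + 1) ≠ 0 :=
  (Continuous.continuousAt (by fun_prop)).eventually_ne (by simp)

theorem mdifferentiableAt_A_left (u a : ℂ) :
    MDifferentiableAt 𝓘(ℂ, ℂ) 𝓘(ℂ, ℂ × ℂ) (fun w ↦ S.A (w, a)) u := by
  have h : ContMDiff 𝓘(ℂ, ℂ) 𝓘(ℂ, ℂ × ℂ) ω fun w ↦ S.A (w, a) :=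
    S.contMDiff_A.comp (contDiff_id.prodMk contDiff_const).contMDiff
  exact (h u).mdifferentiableAt (by simp)

theorem mdifferentiableAt_B_left (f x : ℂ) :
    MDifferentiableAt 𝓘(ℂ, ℂ) 𝓘(ℂ, ℂ × ℂ) (fun w ↦ S.B (w, x)) f := by
  have h : ContMDiff 𝓘(ℂ, ℂ) 𝓘(ℂ, ℂ × ℂ) ω fun w ↦ S.B (w, x) :=
    S.contMDiff_B.comp (contDiff_id.prodMk contDiff_const).contMDiff
  exact (h f).mdifferentiableAt (by simp)

include S in
theorem surjective_mfderiv_s (g : Q.Arrow) :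
    Function.Surjective (mfderiv 𝓘(ℂ, ℂ × ℂ) 𝓘(ℂ, ℂ) Q.s g) := by
  rcases S.cases g with ⟨u, a, rfl⟩ | ⟨x, rfl⟩
  · refine surjective_mfderiv_of_hasDerivAt (F := fun w ↦ S.A (w, a)) (ψ := awayInv p) (d := 1)
      ((Q.contMDiff_s _).mdifferentiableAt (by simp)) (S.mdifferentiableAt_A_left u a)
      ((contMDiffAt_awayInv p (S.s_A_ne _)).mdifferentiableAt (by simp)) ?_ one_ne_zero
    simp only [S.s_A, awayInv_away]
    exact hasDerivAt_id' u
  · refine surjective_mfderiv_of_hasDerivAt (F := fun w ↦ S.B (w, x)) (ψ := nearInv p) (d := 1)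
      ((Q.contMDiff_s _).mdifferentiableAt (by simp)) (S.mdifferentiableAt_B_left 0 x)
      ((contMDiffAt_nearInv p (S.s_B_ne (mem_univ _))).mdifferentiableAt (by simp)) ?_ one_ne_zero
    simp only [S.s_B', nearInv_near]
    exact hasDerivAt_id' 0

include S in
theorem surjective_mfderiv_t (g : Q.Arrow) :
    Function.Surjective (mfderiv 𝓘(ℂ, ℂ × ℂ) 𝓘(ℂ, ℂ) Q.t g) := by
  rcases S.cases g with ⟨u, a, rfl⟩ | ⟨x, rfl⟩
  · refine surjective_mfderiv_of_hasDerivAt (F := fun w ↦ S.A (w, a)) (ψ := awayInv p) (d := 1)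
      ((Q.contMDiff_t _).mdifferentiableAt (by simp)) (S.mdifferentiableAt_A_left u a)
      ((contMDiffAt_awayInv p (S.t_A_ne _)).mdifferentiableAt (by simp)) ?_ one_ne_zero
    simp only [S.t_A, awayInv_away]
    exact (hasDerivAt_id' u).add_const a
  · refine surjective_mfderiv_of_hasDerivAt (F := fun w ↦ S.B (w, x)) (ψ := nearInv p) (d := 1)
      ((Q.contMDiff_t _).mdifferentiableAt (by simp)) (S.mdifferentiableAt_B_left 0 x)
      ((contMDiffAt_nearInv p (by rw [S.t_B0]; exact (away_ne p 0).symm)).mdifferentiableAt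
        (by simp)) ?_ one_ne_zero
    -- Near the fibre over `p` the target is tangent to the source in the `f` direction, to first
    -- order.
    refine (hasDerivAt_target (k := k) x).congr_of_eventuallyEq ?_
    filter_upwards [eventually_target_ne (k := k) x] with f hf
    rw [S.t_B' hf, nearInv_near]

/-- The structure of Lie groupoid determined by standard coordinates. -/
def lieGroupoid : LieGroupoid Q where
  mul := S.mul
  inv := S.inv
  s_mul g h hgh := by
    rcases S.composable_cases hgh with ⟨u, a, b, rfl, rfl⟩ | ⟨x, y, rfl, rfl⟩
    · rw [S.mul_A, S.s_A, S.s_A]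
    · rw [S.mul_B, S.s_B0, S.s_B0]
  t_mul g h hgh := by
    rcases S.composable_cases hgh with ⟨u, a, b, rfl, rfl⟩ | ⟨x, y, rfl, rfl⟩
    · rw [S.mul_A, S.t_A, S.t_A, add_assoc]
    · rw [S.mul_B, S.t_B0, S.t_B0]
  mul_assoc g h l hgh hhl := by
    rcases S.composable_cases hhl with ⟨u, a, b, rfl, rfl⟩ | ⟨x, y, rfl, rfl⟩
    · rcases S.cases g with ⟨v, e, rfl⟩ | ⟨x, rfl⟩
      · simp only [S.mul_A, add_assoc]
      · rw [S.s_B0] at hgh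
        exact absurd hgh.symm (S.t_A_ne _)
    · rw [S.t_B0] at hgh
      obtain ⟨z, -, rfl⟩ := S.exists_eq_B hgh
      simp only [S.mul_B, add_assoc]
  one_mul g := by
    rcases S.cases g with ⟨u, a, rfl⟩ | ⟨x, rfl⟩
    · rw [S.t_A, S.one_away, S.mul_A, add_zero]
    · rw [S.t_B0, S.one_self]
      exact (S.mul_B x 0).trans (by rw [add_zero])
  mul_one g := by
    rcases S.cases g with ⟨u, a, rfl⟩ | ⟨x, rfl⟩
    · rw [S.s_A, S.one_away, S.mul_A, zero_add]
    · rw [S.s_B0, S.one_self]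
      exact (S.mul_B 0 x).trans (by rw [zero_add])
  s_inv g := by
    rcases S.cases g with ⟨u, a, rfl⟩ | ⟨x, rfl⟩
    · rw [S.inv_A, S.s_A, S.t_A]
    · rw [S.inv_B, S.s_B0, S.t_B0]
  t_inv g := by
    rcases S.cases g with ⟨u, a, rfl⟩ | ⟨x, rfl⟩
    · rw [S.inv_A, S.s_A, S.t_A]; simp
    · rw [S.inv_B, S.s_B0, S.t_B0]
  mul_inv g := by
    rcases S.cases g with ⟨u, a, rfl⟩ | ⟨x, rfl⟩
    · rw [S.inv_A, S.t_A, S.one_away, S.mul_A, neg_add_cancel]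
    · rw [S.inv_B, S.t_B0, S.one_self, S.mul_B, neg_add_cancel]; rfl
  inv_mul g := by
    rcases S.cases g with ⟨u, a, rfl⟩ | ⟨x, rfl⟩
    · rw [S.inv_A, S.s_A, S.one_away, S.mul_A, add_neg_cancel]
    · rw [S.inv_B, S.s_B0, S.one_self, S.mul_B, add_neg_cancel]; rfl
  t2Space := S.t2Space
  submersion_s := S.surjective_mfderiv_s
  submersion_t := S.surjective_mfderiv_t
  isClosedEmbedding_one :=
    have := S.t2Space
    Function.LeftInverse.isClosedEmbedding (f := Q.s) Q.s_one Q.contMDiff_s.continuous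
      Q.contMDiff_one.continuous
  contMDiffOn_mul := S.contMDiffOn_mul
  contMDiff_inv := S.contMDiff_inv

/-- The point `f / (1 + x * f ^ (k + 1))` is the target of `S.B (f, x)`, so these pairs are
composable for small `f`. They approach an arbitrary composable pair over `p`. -/
theorem continuous_B_target (x y : ℂ) :
    Tendsto (fun f : ℂ ↦ (S.B (f / (1 + x * f ^ (k + 1)), y), S.B (f, x))) (𝓝 0)
      (𝓝 (S.B (0, y), S.B (0, x))) := by
  have h1 : Tendsto (fun f : ℂ ↦ (f / (1 + x * f ^ (k + 1)), y)) (𝓝 0) (𝓝 (0, y)) := by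
    have := (hasDerivAt_target (k := k) x).continuousAt.tendsto
    rw [zero_div] at this
    exact this.prodMk_nhds tendsto_const_nhds
  have h2 : Tendsto (fun f : ℂ ↦ (f, x)) (𝓝 0) (𝓝 (0, x)) := by
    exact tendsto_id.prodMk_nhds tendsto_const_nhds
  exact ((S.contMDiff_B.continuous.tendsto _).comp h1).prodMk_nhds
    ((S.contMDiff_B.continuous.tendsto _).comp h2)

include S in
/-- The product of a Lie groupoid is determined by the source, the target and the identities. -/
theorem mul_eq (G G' : LieGroupoid Q) {g h : Q.Arrow} (hgh : Q.s g = Q.t h) :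
    G'.mul g h = G.mul g h := by
  have hT := S.t2Space
  -- Off `p` the source and target of the product already determine it; the pairs over `p` are
  -- limits of such pairs.
  have key : ∀ g h, Q.s g = Q.t h → Q.s h ≠ p → G'.mul g h = G.mul g h := by
    intro g h hgh hh
    refine S.ext_of_ne ?_ ?_ ?_
    · rwa [G'.s_mul g h hgh]
    · rw [G'.s_mul g h hgh, G.s_mul g h hgh]
    · rw [G'.t_mul g h hgh, G.t_mul g h hgh]
  by_cases hh : Q.s h = p
  · rcases S.composable_cases hgh with ⟨u, a, b, rfl, rfl⟩ | ⟨x, y, rfl, rfl⟩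
    · exact absurd hh (S.s_A_ne _)
    · have hev : ∀ᶠ f : ℂ in 𝓝 0, Q.s (S.B (f / (1 + x * f ^ (k + 1)), y)) = Q.t (S.B (f, x)) := by
        filter_upwards [eventually_target_ne (k := k) x] with f hf
        rw [S.s_B', S.t_B' hf]
      have h1 : ∀ G : LieGroupoid Q, Tendsto (fun f : ℂ ↦
          G.mul (S.B (f / (1 + x * f ^ (k + 1)), y)) (S.B (f, x))) (𝓝[≠] 0)
          (𝓝 (G.mul (S.B (0, y)) (S.B (0, x)))) := by
        intro G
        have h2 := (G.contMDiffOn_mul (S.B (0, y), S.B (0, x)) hgh).continuousWithinAt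
        exact (h2.tendsto.comp
          (tendsto_nhdsWithin_iff.2 ⟨S.continuous_B_target x y, hev⟩)).mono_left
          nhdsWithin_le_nhds
      refine tendsto_nhds_unique (h1 G') ((h1 G).congr' ?_)
      filter_upwards [nhdsWithin_le_nhds hev, self_mem_nhdsWithin] with f h2 h3
      refine (key _ _ h2 ?_).symm
      rw [S.s_B']
      exact near_ne p h3
  · exact key g h hgh hh

end Std

end PLine

/-! ### The source fibres -/

namespace PLine

namespace Std

variable {p : OnePoint ℂ} {k : ℕ} {Q : ReflGraph (OnePoint ℂ)} (S : Std p (k + 2) univ Q)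

/-- The arrow with source `x ≠ p` and the given coordinate. -/
def fibrePoint {x : OnePoint ℂ} (hx : x ≠ p) (a : ℂ) : {g : Q.Arrow // Q.s g = x} :=
  ⟨S.A (awayInv p x, a), (S.s_A _).trans (away_awayInv p hx)⟩

theorem fibrePoint_α {x : OnePoint ℂ} (hx : x ≠ p) (g : {g : Q.Arrow // Q.s g = x}) :
    S.fibrePoint hx (α (p := p) g.1).2 = g :=
  Subtype.ext ((congrArg (fun y ↦ S.A (awayInv p y, _)) g.2.symm).trans
    (S.A_α (g.2.trans_ne hx)))

include S in
theorem continuous_α_fibre {x : OnePoint ℂ} (hx : x ≠ p) :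
    Continuous fun g : {g : Q.Arrow // Q.s g = x} ↦ (α (p := p) g.1).2 :=
  continuous_iff_continuousAt.2 fun g ↦ ContinuousAt.comp (g := fun g ↦ (α (p := p) g).2)
    (continuous_snd.continuousAt.comp (S.contMDiffAt_α (g.2.trans_ne hx)).continuousAt)
    continuous_subtype_val.continuousAt

/-- The source fibre over a point different from `p`. -/
def fibreHomeoOfNe {x : OnePoint ℂ} (hx : x ≠ p) : {g : Q.Arrow // Q.s g = x} ≃ₜ ℂ where
  toFun g := (α (p := p) g.1).2
  invFun := S.fibrePoint hx
  left_inv := S.fibrePoint_α hx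
  right_inv a := congrArg Prod.snd (S.α_A (awayInv p x, a))
  continuous_toFun := S.continuous_α_fibre hx
  continuous_invFun :=
    (S.contMDiff_A.continuous.comp (continuous_const.prodMk continuous_id)).subtype_mk _

/-- The source fibre over `p`. -/
def fibreHomeoSelf : {g : Q.Arrow // Q.s g = p} ≃ₜ ℂ where
  toFun g := S.c g.1
  invFun x := ⟨S.B (0, x), S.s_B0 x⟩
  left_inv := by
    rintro ⟨g, hg⟩
    obtain ⟨x, -, rfl⟩ := S.exists_eq_B hg
    simp [S.c_B']
  right_inv x := by simp [S.c_B']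
  continuous_toFun := by
    rw [continuous_iff_continuousAt]
    rintro ⟨g, hg⟩
    exact ContinuousAt.comp (g := S.c) (S.contMDiffAt_c g (s_ne_of_eq hg)).continuousAt
      continuous_subtype_val.continuousAt
  continuous_invFun :=
    (S.contMDiff_B.continuous.comp (continuous_const.prodMk continuous_id)).subtype_mk _

theorem sourceSimplyConnected : S.lieGroupoid.SourceSimplyConnected := by
  intro x
  by_cases hx : x = p
  · subst hx
    have := S.fibreHomeoSelf.contractibleSpace
    infer_instance
  · have := (S.fibreHomeoOfNe hx).contractibleSpace
    infer_instance

end Std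

/-! ### Coordinates on the total space of the twisted tangent bundle -/

section Tot

variable {k : ℕ}

/-- The coefficient of a vector of `T(-k • p)` in the frame of the given chart. -/
def Tot.coeffIn (i : Bool) (v : Tot k) : ℂ :=
  twistedTransition k ((twistedTangentCore k).indexAt v.proj) i v.proj * v.coeff

theorem contMDiffAt_tot_iff (i : Bool) {V H N : Type*} [NormedAddCommGroup V] [NormedSpace ℂ V]
    [TopologicalSpace H] {I : ModelWithCorners ℂ V H} [TopologicalSpace N] [ChartedSpace H N]
    {F : N → Tot k} {n : N} (hn : (F n).proj ∈ chartDomain i) :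
    ContMDiffAt I (𝓘(ℂ, ℂ).prod 𝓘(ℂ, ℂ)) ω F n ↔
      ContMDiffAt I 𝓘(ℂ, ℂ) ω (fun x ↦ (F x).proj) n ∧
        ContMDiffAt I 𝓘(ℂ, ℂ) ω (fun x ↦ (F x).coeffIn i) n :=
  have : MemTrivializationAtlas ((twistedTangentCore k).localTriv i) := ⟨⟨i, rfl⟩⟩
  Bundle.Trivialization.contMDiffAt_iff (e := (twistedTangentCore k).localTriv i)
    (((twistedTangentCore k).mem_localTriv_source i _).2 hn)

theorem Tot.proj_mk (x : OnePoint ℂ) (a : ℂ) : (Tot.mk x a : Tot k).proj = x := rfl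

theorem Tot.coeff_mk (x : OnePoint ℂ) (a : ℂ) : (Tot.mk x a : Tot k).coeff = a := rfl

theorem coeffIn_false_coe (z a : ℂ) : (Tot.mk (z : OnePoint ℂ) a : Tot k).coeffIn false = a :=
  one_mul a

theorem coeffIn_true_infty (a : ℂ) : (Tot.mk OnePoint.infty a : Tot k).coeffIn true = a :=
  one_mul a

theorem coeffIn_true_coe (z a : ℂ) :
    (Tot.mk (z : OnePoint ℂ) a : Tot k).coeffIn true = -(z ^ k * z⁻¹ ^ 2) * a := rfl

theorem contMDiff_totProj : ContMDiff (𝓘(ℂ, ℂ).prod 𝓘(ℂ, ℂ)) 𝓘(ℂ, ℂ) ω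
    (fun v : Tot k ↦ v.proj) := Bundle.contMDiff_proj _

theorem contMDiffAt_coeffIn (i : Bool) {v : Tot k} (hv : v.proj ∈ chartDomain i) :
    ContMDiffAt (𝓘(ℂ, ℂ).prod 𝓘(ℂ, ℂ)) 𝓘(ℂ, ℂ) ω (Tot.coeffIn (k := k) i) v :=
  ((contMDiffAt_tot_iff (F := id) i hv).1 contMDiffAt_id).2

theorem mem_chartDomain_false {x : OnePoint ℂ} : x ∈ chartDomain false ↔ x ≠ OnePoint.infty :=
  mem_affineChart_source

theorem mem_chartDomain_true {x : OnePoint ℂ} :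
    x ∈ chartDomain true ↔ x ≠ ((0 : ℂ) : OnePoint ℂ) := mem_chartInfty_source

variable (p : OnePoint ℂ)

/-- The vector at `u` with coefficient `a`, with respect to the coordinate vector field of the
affine coordinate on `ℙ¹ ∖ {p}`. -/
def totA (v : ℂ × ℂ) : Tot k :=
  p.elim (Tot.mk (v.1 : OnePoint ℂ) v.2) fun c ↦
    -- For `u = 1 / (z - c)` one has `∂_u = -(z - c) ^ 2 • ∂_z`, which is `-u ^ (k - 2)` times the
    -- frame `(z - c) ^ k • ∂_z`. At infinity the local equation of `p` is `1` and `u` agrees with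
    -- `1 / z` to first order, so `∂_u` is the frame itself.
    if v.1 = 0 then Tot.mk OnePoint.infty v.2
    else Tot.mk ((c + v.1⁻¹ : ℂ) : OnePoint ℂ) (-(v.2 * v.1 ^ (k - 2)))

/-- The coefficient with respect to the coordinate vector field of the affine coordinate on
`ℙ¹ ∖ {p}`. -/
def totCoeffA (v : Tot k) : ℂ :=
  p.elim v.coeff fun c ↦ v.proj.elim v.coeff fun z ↦ -(v.coeff * (z - c) ^ (k - 2))

/-- The vector `-c • f ^ k • ∂_f` at `f`, in the affine coordinate near `p`. -/
def totB (v : ℂ × ℂ) : Tot k :=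
  p.elim (if v.1 = 0 then Tot.mk OnePoint.infty (-v.2)
    else Tot.mk ((v.1⁻¹ : ℂ) : OnePoint ℂ) (v.1 ^ (k - 2) * v.2))
    fun c ↦ Tot.mk ((c + v.1 : ℂ) : OnePoint ℂ) (-v.2)

/-- The coefficient with respect to the frame `-f ^ k • ∂_f` near `p`. -/
def totCoeffB (v : Tot k) : ℂ := p.elim (-v.coeffIn true) fun _ ↦ -v.coeffIn false

theorem proj_totA (v : ℂ × ℂ) : (totA p v : Tot k).proj = away p v.1 := by
  induction p using OnePoint.rec with
  | infty => rfl
  | coe c =>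
    simp only [totA, away, OnePoint.elim_some]
    split_ifs <;> rfl

theorem proj_totB (v : ℂ × ℂ) : (totB p v : Tot k).proj = near p v.1 := by
  induction p using OnePoint.rec with
  | infty =>
    simp only [totB, near, OnePoint.elim_infty]
    split_ifs with h
    · rw [h, inv_coe_zero]; rfl
    · rw [inv_coe_of_ne h]; rfl
  | coe c => rfl

theorem totB_of_ne {f : ℂ} (hf : f ≠ 0) (x : ℂ) :
    (totB p (f, x) : Tot k) = totA p (f⁻¹, f ^ (k - 2) * x) := by
  induction p using OnePoint.rec with
  | infty => simp [totA, totB, hf]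
  | coe c =>
    simp only [totA, totB, OnePoint.elim_some, inv_eq_zero, hf, if_false, inv_inv]
    congr 2
    rw [inv_pow]
    field_simp

theorem totA_totCoeffA {v : Tot k} (hv : v.proj ≠ p) :
    totA p (awayInv p v.proj, totCoeffA p v) = v := by
  obtain ⟨x, a⟩ := v
  induction p using OnePoint.rec with
  | infty =>
    induction x using OnePoint.rec with
    | infty => exact absurd rfl hv
    | coe z => rfl
  | coe c =>
    induction x using OnePoint.rec with
    | infty => simp [totA, awayInv, totCoeffA]; rfl
    | coe z =>
      have : z - c ≠ 0 := sub_ne_zero.2 fun h ↦ hv (by rw [h])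
      simp only [totA, awayInv, totCoeffA, OnePoint.elim_some, inv_eq_zero, this, if_false, inv_inv]
      rw [add_sub_cancel]
      refine congrArg (Tot.mk (z : OnePoint ℂ)) (?_ : -(-((show ℂ from a) * (z - c) ^ (k - 2)) *
        (z - c)⁻¹ ^ (k - 2)) = (show ℂ from a))
      rw [inv_pow, neg_mul, neg_neg, mul_inv_cancel_right₀ (pow_ne_zero _ this)]

theorem totCoeffA_totA (v : ℂ × ℂ) : totCoeffA p (totA p v : Tot k) = v.2 := by
  obtain ⟨u, a⟩ := v
  induction p using OnePoint.rec with
  | infty => rfl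
  | coe c =>
    by_cases hu : u = 0
    · subst hu
      simp only [totA, totCoeffA, OnePoint.elim_some, if_true]
      rfl
    · simp only [totA, totCoeffA, OnePoint.elim_some, hu, if_false, Tot.coeff_mk, Tot.proj_mk]
      simp [hu]

theorem totCoeffB_totB (hk : 2 ≤ k) (v : ℂ × ℂ) : totCoeffB p (totB p v : Tot k) = v.2 := by
  obtain ⟨f, x⟩ := v
  induction p using OnePoint.rec with
  | infty =>
    by_cases hf : f = 0
    · subst hf
      simp only [totB, totCoeffB, OnePoint.elim_infty, if_true, coeffIn_true_infty, neg_neg]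
    · obtain ⟨k, rfl⟩ := Nat.exists_eq_add_of_le' hk
      simp only [totB, totCoeffB, OnePoint.elim_infty, hf, if_false, coeffIn_true_coe, inv_inv,
        Nat.add_sub_cancel, inv_pow]
      field_simp
      ring
  | coe c => simp [totB, totCoeffB, coeffIn_false_coe]

theorem totB_totCoeffB (hk : 2 ≤ k) {v : Tot k} (hv : v.proj ≠ away p 0) :
    totB p (nearInv p v.proj, totCoeffB p v) = v := by
  -- It suffices to exhibit `v` in the image of `totB` with any second coordinate, since `totCoeffB`
  -- recovers that coordinate.
  have key : ∀ x, v = totB p (nearInv p v.proj, x) →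
      totB p (nearInv p v.proj, totCoeffB p v) = v := by
    intro x hx
    have h1 : totCoeffB p v = x := by
      conv_lhs => rw [hx]
      exact totCoeffB_totB p hk _
    rw [h1, ← hx]
  by_cases hp : v.proj = p
  · obtain ⟨x, a⟩ := v
    obtain rfl : x = p := hp
    refine key (-a : ℂ) ?_
    change _ = totB x (nearInv x x, _)
    rw [nearInv_self]
    induction x using OnePoint.rec with
    | infty =>
      simp only [totB, OnePoint.elim_infty, if_true]
      exact congrArg (Tot.mk _) (neg_neg (show ℂ from a)).symm
    | coe c =>
      simp only [totB, OnePoint.elim_some, add_zero]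
      exact congrArg (Tot.mk _) (neg_neg (show ℂ from a)).symm
  · obtain ⟨h0, h1⟩ := awayInv_eq p hp hv
    refine key ((nearInv p v.proj ^ (k - 2))⁻¹ * totCoeffA p v) ?_
    rw [totB_of_ne p h0, ← h1, mul_inv_cancel_left₀ (pow_ne_zero _ h0), totA_totCoeffA p hp]

theorem contMDiff_totB (hk : 2 ≤ k) :
    ContMDiff 𝓘(ℂ, ℂ × ℂ) (𝓘(ℂ, ℂ).prod 𝓘(ℂ, ℂ)) ω (totB p : ℂ × ℂ → Tot k) := by
  intro v
  have h1 : ContMDiffAt 𝓘(ℂ, ℂ × ℂ) 𝓘(ℂ, ℂ) ω (fun v ↦ (totB p v : Tot k).proj) v := by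
    simp only [proj_totB]
    exact (contMDiff_near p).contMDiffAt.comp v contDiff_fst.contMDiff.contMDiffAt
  have h2 : ContMDiffAt 𝓘(ℂ, ℂ × ℂ) 𝓘(ℂ, ℂ) ω (fun v : ℂ × ℂ ↦ -v.2) v :=
    contDiffAt_snd.neg.contMDiffAt
  have h3 : ∀ w : ℂ × ℂ, -totCoeffB p (totB p w : Tot k) = -w.2 := fun w ↦ by
    rw [totCoeffB_totB p hk]
  have h4 := near_ne_away_zero p v.1
  induction p using OnePoint.rec with
  | infty =>
    refine (contMDiffAt_tot_iff true ?_).2 ⟨h1, ?_⟩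
    · rw [mem_chartDomain_true, proj_totB]
      exact h4
    · refine h2.congr_of_eventuallyEq (.of_forall fun w ↦ (neg_neg _).symm.trans (h3 w))
  | coe c =>
    refine (contMDiffAt_tot_iff false ?_).2 ⟨h1, ?_⟩
    · rw [mem_chartDomain_false, proj_totB]
      simpa [away] using h4
    · refine h2.congr_of_eventuallyEq (.of_forall fun w ↦ (neg_neg _).symm.trans (h3 w))

/-- With `w = 1 / z = u / (1 + c * u)` the local equation of `p` is `1 - c * w = (1 + c * u)⁻¹`, and
`∂_u = (1 + c * u)⁻¹ ^ 2 • ∂_w`. This shows that the case distinction in `totA` is holomorphic at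
infinity. -/
theorem coeffIn_true_totA (hk : 2 ≤ k) {c u : ℂ} (h : 1 + c * u ≠ 0) (a : ℂ) :
    (totA (c : OnePoint ℂ) (u, a) : Tot k).coeffIn true = (1 + c * u) ^ (k - 2) * a := by
  by_cases hu : u = 0
  · subst hu
    simp only [totA, OnePoint.elim_some, if_true, coeffIn_true_infty, mul_zero, add_zero, one_pow,
      one_mul]
  · obtain ⟨k, rfl⟩ := Nat.exists_eq_add_of_le' hk
    simp only [totA, OnePoint.elim_some, hu, if_false, coeffIn_true_coe, Nat.add_sub_cancel]
    have h1 : c + u⁻¹ = (1 + c * u) / u := by field_simp; ring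
    rw [h1, inv_div, div_pow, div_pow]
    field_simp
    ring

theorem contMDiff_totA (hk : 2 ≤ k) :
    ContMDiff 𝓘(ℂ, ℂ × ℂ) (𝓘(ℂ, ℂ).prod 𝓘(ℂ, ℂ)) ω (totA p : ℂ × ℂ → Tot k) := by
  intro v
  by_cases hv : v.1 = 0
  · have h1 : ContMDiffAt 𝓘(ℂ, ℂ × ℂ) 𝓘(ℂ, ℂ) ω (fun v ↦ (totA p v : Tot k).proj) v := by
      simp only [proj_totA]
      exact (contMDiff_away p).contMDiffAt.comp v contDiff_fst.contMDiff.contMDiffAt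
    induction p using OnePoint.rec with
    | infty =>
      refine (contMDiffAt_tot_iff false ?_).2 ⟨h1, ?_⟩
      · rw [mem_chartDomain_false, proj_totA]
        exact away_ne _ _
      · exact contDiffAt_snd.contMDiffAt.congr_of_eventuallyEq
          (.of_forall fun w ↦ coeffIn_false_coe _ _)
    | coe c =>
      refine (contMDiffAt_tot_iff true ?_).2 ⟨h1, ?_⟩
      · rw [mem_chartDomain_true, proj_totA, hv]
        simp [away]
      · have h2 : ContDiff ℂ ω fun w : ℂ × ℂ ↦ (1 + c * w.1) ^ (k - 2) * w.2 :=
          ((contDiff_const.add (contDiff_const.mul contDiff_fst)).pow _).mul contDiff_snd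
        refine h2.contMDiff.contMDiffAt.congr_of_eventuallyEq ?_
        have h3 : ContinuousAt (fun w : ℂ × ℂ ↦ 1 + c * w.1) v := by fun_prop
        filter_upwards [h3.eventually_ne (by simp [hv] : 1 + c * v.1 ≠ 0)] with w hw
        exact coeffIn_true_totA hk hw w.2
  · have h1 : ContDiffAt ℂ ω (fun w : ℂ × ℂ ↦ (w.1⁻¹, w.1 ^ (k - 2) * w.2)) v :=
      (contDiffAt_fst.inv hv).prodMk ((contDiffAt_fst.pow _).mul contDiffAt_snd)
    refine ((contMDiff_totB p hk _).comp v h1.contMDiffAt).congr_of_eventuallyEq ?_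
    filter_upwards [(isOpen_ne_fun continuous_fst continuous_const).mem_nhds hv] with w hw
    have hw : w.1 ≠ 0 := hw
    rw [Function.comp_apply, totB_of_ne p (inv_ne_zero hw), inv_inv, ← mul_assoc, ← mul_pow,
      inv_mul_cancel₀ hw, one_pow, one_mul]

theorem contMDiffAt_totCoeffB {v : Tot k} (hv : v.proj ≠ away p 0) :
    ContMDiffAt (𝓘(ℂ, ℂ).prod 𝓘(ℂ, ℂ)) 𝓘(ℂ, ℂ) ω (totCoeffB p : Tot k → ℂ) v := by
  induction p using OnePoint.rec with
  | infty =>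
    exact (contMDiffAt_coeffIn true (mem_chartDomain_true.2 hv)).neg
  | coe c =>
    exact (contMDiffAt_coeffIn false (mem_chartDomain_false.2 (by simpa [away] using hv))).neg

theorem contMDiffAt_totCoeffA (hk : 2 ≤ k) {v : Tot k} (hv : v.proj ≠ p) :
    ContMDiffAt (𝓘(ℂ, ℂ).prod 𝓘(ℂ, ℂ)) 𝓘(ℂ, ℂ) ω (totCoeffA p : Tot k → ℂ) v := by
  have hproj : Continuous fun v : Tot k ↦ v.proj := contMDiff_totProj.continuous
  by_cases hq : v.proj = away p 0
  · induction p using OnePoint.rec with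
    | infty =>
      refine (contMDiffAt_coeffIn false (mem_chartDomain_false.2 hv)).congr_of_eventuallyEq ?_
      filter_upwards [hproj.continuousAt.eventually_ne hv] with w hw
      obtain ⟨x, a⟩ := w
      induction x using OnePoint.rec with
      | infty => exact absurd rfl hw
      | coe z => exact (coeffIn_false_coe z a).symm
    | coe c =>
      have h1 := contMDiffAt_coeffIn true (v := v) (mem_chartDomain_true.2 (by
        rw [hq]; simp [away]))
      have h2 := (contMDiffAt_awayInv (c : OnePoint ℂ) hv).comp v (contMDiff_totProj v)
      have h0 : awayInv (c : OnePoint ℂ) v.proj = 0 := by rw [hq, awayInv_away]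
      have h3 : ContDiffAt ℂ ω (fun w : ℂ × ℂ ↦ w.2 / (1 + c * w.1) ^ (k - 2))
          (awayInv (c : OnePoint ℂ) v.proj, v.coeffIn true) :=
        contDiffAt_snd.div ((contDiffAt_const.add (contDiffAt_const.mul contDiffAt_fst)).pow _)
          (by simp [h0])
      refine (ContMDiffAt.comp v (g := fun w : ℂ × ℂ ↦ w.2 / (1 + c * w.1) ^ (k - 2))
        h3.contMDiffAt (h2.prodMk_space h1)).congr_of_eventuallyEq ?_
      have h4 : ContinuousAt (fun w : Tot k ↦ 1 + c * awayInv (c : OnePoint ℂ) w.proj) v :=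
        continuousAt_const.add (continuousAt_const.mul h2.continuousAt)
      filter_upwards [hproj.continuousAt.eventually_ne hv, h4.eventually_ne (by simp [h0] :
        1 + c * awayInv (c : OnePoint ℂ) v.proj ≠ 0)] with w hw hw'
      have h5 := coeffIn_true_totA hk hw' (totCoeffA (c : OnePoint ℂ) w)
      rw [totA_totCoeffA _ hw] at h5
      change _ = w.coeffIn true / (1 + c * awayInv (c : OnePoint ℂ) w.proj) ^ (k - 2)
      rw [h5, mul_div_cancel_left₀ _ (pow_ne_zero _ hw')]
  · have h1 := (contMDiffAt_nearInv p hq).comp v (contMDiff_totProj v)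
    have h2 : ContDiff ℂ ω (fun w : ℂ × ℂ ↦ w.1 ^ (k - 2) * w.2) :=
      (contDiff_fst.pow _).mul contDiff_snd
    refine (ContMDiffAt.comp v (g := fun w : ℂ × ℂ ↦ w.1 ^ (k - 2) * w.2)
      h2.contMDiff.contMDiffAt (h1.prodMk_space (contMDiffAt_totCoeffB p hq))
        ).congr_of_eventuallyEq ?_
    filter_upwards [hproj.continuousAt.eventually_ne hv, hproj.continuousAt.eventually_ne hq]
      with w hw hw'
    have h3 := totB_totCoeffB p hk hw'
    rw [totB_of_ne p (awayInv_eq p hw hw').1] at h3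
    have h4 := congrArg (totCoeffA p) h3
    rw [totCoeffA_totA] at h4
    exact h4.symm

end Tot

end PLine

/-! ### The canonical isomorphism and its uniqueness -/

namespace PLine

variable {p : OnePoint ℂ} {k : ℕ}

theorem eqnAt_self (p : OnePoint ℂ) : eqnAt p p = 0 := by
  induction p using OnePoint.rec with
  | infty => rfl
  | coe c => exact sub_self c

theorem eqnAt_away_infty (u : ℂ) : eqnAt OnePoint.infty (away OnePoint.infty u) = 1 := rfl

theorem eqnAt_away_coe_zero (c : ℂ) : eqnAt c (away c 0) = 1 := by
  have : away (c : OnePoint ℂ) 0 = OnePoint.infty := by simp [away]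
  rw [this]
  change 1 - c * 0 = 1
  simp

theorem eqnAt_away_coe (c : ℂ) {u : ℂ} (hu : u ≠ 0) : eqnAt c (away c u) = u⁻¹ := by
  have : away (c : OnePoint ℂ) u = ((c + u⁻¹ : ℂ) : OnePoint ℂ) := by simp [away, hu]
  rw [this]
  exact add_sub_cancel_left c u⁻¹

/-- The ratio of the coefficients of a vector of `T(-k • p)` in the affine coordinate of
`ℙ¹ ∖ {p}` and in the frame of the preferred chart. -/
def coeffRatio (p : OnePoint ℂ) (k : ℕ) (u : ℂ) : ℂ :=
  p.elim 1 fun _ ↦ if u = 0 then 1 else -(u ^ (k - 2))⁻¹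

theorem coeffRatio_ne_zero (p : OnePoint ℂ) (k : ℕ) (u : ℂ) : coeffRatio p k u ≠ 0 := by
  induction p using OnePoint.rec with
  | infty => exact one_ne_zero
  | coe c =>
    simp only [coeffRatio, OnePoint.elim_some]
    split_ifs with hu
    · exact one_ne_zero
    · exact neg_ne_zero.2 (inv_ne_zero (pow_ne_zero _ hu))

theorem mk_away (p : OnePoint ℂ) (u b : ℂ) :
    (Tot.mk (away p u) b : Tot k) = totA p (u, coeffRatio p k u * b) := by
  induction p using OnePoint.rec with
  | infty => simp [coeffRatio, totA, away]
  | coe c =>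
    by_cases hu : u = 0
    · simp [coeffRatio, totA, away, hu]
    · simp only [coeffRatio, totA, away, OnePoint.elim_some, hu, if_false]
      congr 1
      field_simp

theorem mk_self (p : OnePoint ℂ) (b : ℂ) : (Tot.mk p b : Tot k) = totB p (0, -b) := by
  induction p using OnePoint.rec with
  | infty => simp [totB]
  | coe c => simp [totB]

theorem totA_zero (p : OnePoint ℂ) (u : ℂ) : (totA p (u, 0) : Tot k) = Tot.mk (away p u) 0 := by
  rw [mk_away, mul_zero]

/-- The velocity is `∂_u`, the vector with coefficient `1` in the coordinate `u`. Its coefficient in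
the preferred frame is the inverse of `coeffRatio`, and `toTangent` multiplies by the `k`-th power
of the local equation. -/
theorem hasMFDerivAt_away (p : OnePoint ℂ) (hk : 2 ≤ k) (u : ℂ) :
    HasMFDerivAt 𝓘(ℂ, ℂ) 𝓘(ℂ, ℂ) (away p) u (ContinuousLinearMap.toSpanSingleton ℂ
      (eqnAt p (away p u) ^ k * (coeffRatio p k u)⁻¹ : ℂ)) := by
  refine ⟨(contMDiff_away p).continuous.continuousAt, ?_⟩
  simp only [writtenInExtChartAt, mfld_simps]
  refine HasFDerivAt.hasFDerivWithinAt ?_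
  change HasFDerivAt (chartAt ℂ (away p u) ∘ away p) (ContinuousLinearMap.toSpanSingleton ℂ
      (eqnAt p (away p u) ^ k * (coeffRatio p k u)⁻¹ : ℂ)) u
  refine HasDerivAt.hasFDerivAt (f' := (eqnAt p (away p u) ^ k * (coeffRatio p k u)⁻¹ : ℂ)) ?_
  induction p using OnePoint.rec with
  | infty =>
    rw [eqnAt_away_infty]
    simp only [one_pow, coeffRatio, OnePoint.elim_infty, inv_one, mul_one]
    exact hasDerivAt_id u
  | coe c =>
    by_cases hu : u = 0
    · subst hu
      rw [eqnAt_away_coe_zero]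
      simp only [one_pow, coeffRatio, OnePoint.elim_some, if_true, inv_one, mul_one]
      have h0 : away (c : OnePoint ℂ) 0 = OnePoint.infty := by simp [away]
      rw [h0]
      have h1 : HasDerivAt (fun u : ℂ ↦ u / (1 + c * u)) 1 0 := by
        have := (hasDerivAt_id' (0 : ℂ)).fun_div
          (((hasDerivAt_id' (0 : ℂ)).const_mul c).const_add 1) (by simp)
        simpa using this
      refine h1.congr_of_eventuallyEq ?_
      filter_upwards [eventually_ne_zero_awayInfty c] with v hv
      change chartInfty (away (c : OnePoint ℂ) v) = _
      rw [away_coe_eq hv, chartInfty_inv_coe]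
    · rw [eqnAt_away_coe c hu]
      have h0 : away (c : OnePoint ℂ) u = ((c + u⁻¹ : ℂ) : OnePoint ℂ) := by simp [away, hu]
      rw [h0]
      have h1 : HasDerivAt (fun u : ℂ ↦ c + u⁻¹) (-(u ^ 2)⁻¹) u := (hasDerivAt_inv hu).const_add c
      have h2 : u⁻¹ ^ k * (coeffRatio (c : OnePoint ℂ) k u)⁻¹ = -(u ^ 2)⁻¹ := by
        obtain ⟨k, rfl⟩ := Nat.exists_eq_add_of_le' hk
        simp only [coeffRatio, OnePoint.elim_some, hu, if_false, Nat.add_sub_cancel, inv_pow]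
        field_simp
        ring
      rw [h2]
      refine h1.congr_of_eventuallyEq ?_
      filter_upwards [isOpen_ne.mem_nhds hu] with v hv
      have hv : v ≠ 0 := hv
      simp only [Function.comp_apply, away, OnePoint.elim_some, hv, if_false]
      rfl

/-- Off `p` the field `∂_u` is a frame of every `T(-k • p)`, and the natural maps send it to itself.
-/
theorem natMap_totA (p : OnePoint ℂ) (hk : 2 ≤ k) (n : ℕ) (v : ℂ × ℂ) :
    natMap p k n (totA p v) = totA p v := by
  obtain ⟨u, a⟩ := v
  induction p using OnePoint.rec with
  | infty =>
    refine congrArg (Tot.mk _) (?_ : (1 : ℂ) ^ n * a = a)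
    rw [one_pow, one_mul]
  | coe c =>
    by_cases hu : u = 0
    · subst hu
      have h := eqnAt_away_coe_zero c
      rw [← proj_totA (k := k + n) c (0, a)] at h
      rw [natMap, h]
      simp only [totA, OnePoint.elim_some, if_true, Tot.proj_mk, Tot.coeff_mk, one_pow, one_mul]
    · have h := eqnAt_away_coe c hu
      rw [← proj_totA (k := k + n) c (u, a)] at h
      obtain ⟨k, rfl⟩ := Nat.exists_eq_add_of_le' hk
      rw [natMap, h]
      simp only [totA, OnePoint.elim_some, hu, if_false, Tot.proj_mk, Tot.coeff_mk]
      congr 1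
      rw [show k + 2 + n - 2 = k + n by omega, Nat.add_sub_cancel, inv_pow]
      field_simp
      ring

theorem natMap_of_proj_eq (p : OnePoint ℂ) (k : ℕ) {n : ℕ} (hn : n ≠ 0) {v : Tot (k + n)}
    (hv : v.proj = p) : natMap p k n v = Tot.mk p 0 := by
  rw [natMap, hv, eqnAt_self, zero_pow hn, zero_mul]

namespace Std

section

variable {Q : ReflGraph (OnePoint ℂ)} (S : Std p k univ Q)

open Classical in
/-- The identification of the arrows with `T(-k • p)` by means of the coordinates `A` and `B`. -/
def toTot (g : Q.Arrow) : Tot k :=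
  if Q.s g = p then totB p (0, S.c g) else totA p (α (p := p) g)

open Classical in
/-- The inverse of `toTot`. -/
def ofTot (v : Tot k) : Q.Arrow :=
  if v.proj = p then S.B (0, totCoeffB p v) else S.A (awayInv p v.proj, totCoeffA p v)

theorem toTot_A (v : ℂ × ℂ) : S.toTot (S.A v) = totA p v := by
  rw [toTot, if_neg (S.s_A_ne v), S.α_A]

theorem B_of_ne_of_le (hk : 2 ≤ k) {f : ℂ} (hf : f ≠ 0) (x : ℂ) :
    S.B (f, x) = S.A (f⁻¹, f ^ (k - 2) * x) := by
  obtain ⟨k, rfl⟩ := Nat.exists_eq_add_of_le' hk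
  exact S.B_of_ne' hf x

theorem toTot_B (hk : 2 ≤ k) (v : ℂ × ℂ) : S.toTot (S.B v) = totB p v := by
  obtain ⟨f, x⟩ := v
  by_cases hf : f = 0
  · subst hf
    rw [toTot, if_pos (S.s_B_zero (mem_univ _)), S.c_B _ (mem_univ _)]
  · rw [S.B_of_ne_of_le hk hf, toTot_A, totB_of_ne p hf]

theorem ofTot_totA (v : ℂ × ℂ) : S.ofTot (totA p v) = S.A v := by
  rw [ofTot, proj_totA, if_neg (away_ne p _), awayInv_away, totCoeffA_totA]

theorem ofTot_totB (hk : 2 ≤ k) (v : ℂ × ℂ) : S.ofTot (totB p v) = S.B v := by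
  obtain ⟨f, x⟩ := v
  by_cases hf : f = 0
  · subst hf
    rw [ofTot, proj_totB, if_pos (near_zero p), totCoeffB_totB p hk]
  · rw [S.B_of_ne_of_le hk hf, totB_of_ne p hf, ofTot_totA]

theorem contMDiff_toTot (hk : 2 ≤ k) :
    ContMDiff 𝓘(ℂ, ℂ × ℂ) (𝓘(ℂ, ℂ).prod 𝓘(ℂ, ℂ)) ω S.toTot := by
  intro g
  have hs : Continuous Q.s := Q.contMDiff_s.continuous
  by_cases hg : Q.s g = p
  · have hq := s_ne_of_eq hg
    refine ((contMDiff_totB p hk _).comp g (S.contMDiffAt_β hq)).congr_of_eventuallyEq ?_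
    filter_upwards [hs.continuousAt.eventually_ne hq] with h hh
    rw [Function.comp_apply, ← S.toTot_B hk, S.B_β hh]
  · refine ((contMDiff_totA p hk _).comp g (S.contMDiffAt_α hg)).congr_of_eventuallyEq ?_
    filter_upwards [hs.continuousAt.eventually_ne hg] with h hh
    rw [Function.comp_apply, ← S.toTot_A, S.A_α hh]

theorem contMDiff_ofTot (hk : 2 ≤ k) :
    ContMDiff (𝓘(ℂ, ℂ).prod 𝓘(ℂ, ℂ)) 𝓘(ℂ, ℂ × ℂ) ω S.ofTot := by
  intro v
  have hs : Continuous fun v : Tot k ↦ v.proj := contMDiff_totProj.continuous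
  by_cases hv : v.proj = p
  · have hq : v.proj ≠ away p 0 := hv ▸ (away_ne p 0).symm
    have h1 := ((contMDiffAt_nearInv p hq).comp v (contMDiff_totProj v)).prodMk_space
      (contMDiffAt_totCoeffB p hq)
    have h2 := S.contMDiffOn_B.contMDiffAt
      (S.isOpen.mem_nhds (mem_univ (nearInv p v.proj, totCoeffB p v)))
    refine (ContMDiffAt.comp v h2 h1).congr_of_eventuallyEq ?_
    filter_upwards [hs.continuousAt.eventually_ne hq] with w hw
    change _ = S.B (nearInv p w.proj, totCoeffB p w)
    rw [← S.ofTot_totB hk, totB_totCoeffB p hk hw]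
  · have h1 := ((contMDiffAt_awayInv p hv).comp v (contMDiff_totProj v)).prodMk_space
      (contMDiffAt_totCoeffA p hk hv)
    refine (ContMDiffAt.comp v (S.contMDiff_A _) h1).congr_of_eventuallyEq ?_
    filter_upwards [hs.continuousAt.eventually_ne hv] with w hw
    change _ = S.A (awayInv p w.proj, totCoeffA p w)
    rw [← S.ofTot_totA, totA_totCoeffA p hw]

theorem ofTot_toTot (hk : 2 ≤ k) (g : Q.Arrow) : S.ofTot (S.toTot g) = g := by
  by_cases hg : Q.s g = p
  · obtain ⟨x, -, rfl⟩ := S.exists_eq_B hg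
    rw [S.toTot_B hk, S.ofTot_totB hk]
  · obtain ⟨v, rfl⟩ := S.exists_eq_A hg
    rw [S.toTot_A, S.ofTot_totA]

theorem toTot_ofTot (hk : 2 ≤ k) (v : Tot k) : S.toTot (S.ofTot v) = v := by
  by_cases hv : v.proj = p
  · rw [← totB_totCoeffB p hk (hv ▸ (away_ne p 0).symm : v.proj ≠ away p 0), S.ofTot_totB hk,
      S.toTot_B hk]
  · rw [← totA_totCoeffA p hv, S.ofTot_totA, S.toTot_A]

end

section

variable (S : Std p k univ (pairGraph p k))

/-- The canonical isomorphism of the arrows with `Tot T(-k • p)`. -/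
def iso (hk : 2 ≤ k) : PairTotIso p k where
  toFun := S.toTot
  invFun := S.ofTot
  left_inv := S.ofTot_toTot hk
  right_inv := S.toTot_ofTot hk
  contMDiff_toFun := S.contMDiff_toTot hk
  contMDiff_invFun := S.contMDiff_ofTot hk

theorem isCanonical_iso (hk : 2 ≤ k) : IsCanonical p k (S.iso hk) where
  proj_eq_s g := by
    change (S.toTot g).proj = _
    by_cases hg : (pairGraph p k).s g = p
    · obtain ⟨x, -, rfl⟩ := S.exists_eq_B hg
      rw [S.toTot_B hk, proj_totB, S.s_B _ (mem_univ _)]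
    · obtain ⟨v, rfl⟩ := S.exists_eq_A hg
      rw [S.toTot_A, proj_totA, S.s_A]
  map_one x := by
    change S.toTot _ = _
    by_cases hx : x = p
    · subst hx
      rw [S.one_self, S.toTot_B hk, mk_self, neg_zero]
      rfl
    · rw [← away_awayInv p hx, S.one_away, S.toTot_A, totA_zero]
  hasMFDerivAt x a := by
    change HasMFDerivAt 𝓘(ℂ, ℂ) 𝓘(ℂ, ℂ)
      (fun τ : ℂ ↦ (pairGraph p k).t (S.ofTot (Tot.mk x (τ * a)))) 0
      (ContinuousLinearMap.toSpanSingleton ℂ (eqnAt p x ^ k * a : ℂ))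
    by_cases hx : x = p
    -- Over `p` the target is constant along the fibre, and the prescribed tangent vector is zero
    -- because the local equation vanishes and `k > 0`.
    · subst hx
      have h1 : (fun τ : ℂ ↦ (pairGraph x k).t (S.ofTot (Tot.mk x (τ * a)))) = fun _ ↦ x := by
        funext τ
        rw [mk_self, S.ofTot_totB hk, S.t_B_zero _ (mem_univ _)]
      have h2 : ContinuousLinearMap.toSpanSingleton ℂ (eqnAt x x ^ k * a : ℂ) = 0 := by
        rw [eqnAt_self, zero_pow (by omega), zero_mul, ContinuousLinearMap.toSpanSingleton_zero]
      rw [h1]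
      exact h2 ▸ hasMFDerivAt_const x (0 : ℂ)
    · obtain ⟨u, rfl⟩ : ∃ u, x = away p u := ⟨_, (away_awayInv p hx).symm⟩
      have h1 : (fun τ : ℂ ↦ (pairGraph p k).t (S.ofTot (Tot.mk (away p u) (τ * a)))) =
          away p ∘ fun τ : ℂ ↦ u + coeffRatio p k u * (τ * a) := by
        funext τ
        rw [mk_away, S.ofTot_totA, S.t_A]
        rfl
      have h2 : HasDerivAt (fun τ : ℂ ↦ u + coeffRatio p k u * (τ * a))
          (coeffRatio p k u * a) 0 := by
        simpa using (((hasDerivAt_id (0 : ℂ)).mul_const a).const_mul (coeffRatio p k u)).const_add u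
      have h3 : HasMFDerivAt 𝓘(ℂ, ℂ) 𝓘(ℂ, ℂ) (away p) (u + coeffRatio p k u * (0 * a))
          (ContinuousLinearMap.toSpanSingleton ℂ
            (eqnAt p (away p u) ^ k * (coeffRatio p k u)⁻¹ : ℂ)) := by
        rw [show u + coeffRatio p k u * (0 * a) = u by ring]
        exact hasMFDerivAt_away p hk u
      have h4 := HasMFDerivAt.comp 0 h3 h2.hasFDerivAt.hasMFDerivAt
      have h5 : ∀ e r : ℂ, r ≠ 0 → ContinuousLinearMap.toSpanSingleton ℂ (e * a) =
          (ContinuousLinearMap.toSpanSingleton ℂ (e * r⁻¹)).comp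
            (ContinuousLinearMap.toSpanSingleton ℂ (r * a)) := by
        intro e r hr
        ext
        simp
        field_simp
      rw [h1]
      exact h4.congr_mfderiv
        (h5 (eqnAt p (away p u) ^ k) (coeffRatio p k u) (coeffRatio_ne_zero p k u)).symm

/-- On the fibre over `away p u` both sides are copies of `ℂ`, and the map between them is
biholomorphic and fixes `0`. It is therefore multiplication by some `l`, and the condition on the
derivative leaves only `l = 1`. -/
theorem symm_totA_eq (hk : 2 ≤ k) {Ψ : PairTotIso p k} (hΨ : IsCanonical p k Ψ) (u a : ℂ) :
    Ψ.symm (totA p (u, a)) = S.A (u, a) := by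
  have hs : ∀ a, (pairGraph p k).s (Ψ.symm (totA p (u, a))) = away p u := fun a ↦ by
    rw [← hΨ.proj_eq_s, Ψ.apply_symm_apply, proj_totA]
  have hA : ∀ a, S.A (u, (α (p := p) (Ψ.symm (totA p (u, a)))).2) = Ψ.symm (totA p (u, a)) := by
    intro a
    have := S.A_α (g := Ψ.symm (totA p (u, a))) (by rw [hs]; exact away_ne p u)
    have h1 : (α (p := p) (Ψ.symm (totA p (u, a)))).1 = u := by rw [α, hs, awayInv_away]
    exact (congrArg S.A (Prod.ext h1.symm rfl : ((u, _) : ℂ × ℂ) = α (p := p) _)).trans this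
  have hT : ∀ a, totA p (u, totCoeffA p (Ψ (S.A (u, a)))) = Ψ (S.A (u, a)) := by
    intro a
    have h1 : (Ψ (S.A (u, a))).proj = away p u := by rw [hΨ.proj_eq_s, S.s_A]
    have h2 := totA_totCoeffA p (v := Ψ (S.A (u, a))) (by rw [h1]; exact away_ne p u)
    rwa [h1, awayInv_away] at h2
  have hin : Differentiable ℂ fun a : ℂ ↦ (u, a) :=
    (differentiable_const u).prodMk differentiable_id
  have hin' : ContMDiff 𝓘(ℂ, ℂ) 𝓘(ℂ, ℂ × ℂ) ω fun a : ℂ ↦ (u, a) :=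
    (contDiff_const.prodMk contDiff_id).contMDiff
  set h : ℂ → ℂ := fun a ↦ (α (p := p) (Ψ.symm (totA p (u, a)))).2 with hh
  set h' : ℂ → ℂ := fun a ↦ totCoeffA p (Ψ (S.A (u, a))) with hh'
  have d1 : Differentiable ℂ h := by
    intro a
    have h1 : ContMDiffAt 𝓘(ℂ, ℂ) 𝓘(ℂ, ℂ × ℂ) ω (fun a ↦ Ψ.symm (totA p (u, a))) a :=
      (Ψ.symm.contMDiff.comp ((contMDiff_totA p hk).comp hin')) a
    have h2 := (S.contMDiffAt_α (g := Ψ.symm (totA p (u, a)))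
      (by rw [hs]; exact away_ne p u)).comp a h1
    exact (h2.contDiffAt.snd).differentiableAt (by simp)
  have d2 : Differentiable ℂ h' := by
    intro a
    have h1 : ContMDiffAt 𝓘(ℂ, ℂ) (𝓘(ℂ, ℂ).prod 𝓘(ℂ, ℂ)) ω (fun a ↦ Ψ (S.A (u, a))) a :=
      (Ψ.contMDiff.comp (S.contMDiff_A.comp hin')) a
    have h2 := (contMDiffAt_totCoeffA p hk (v := Ψ (S.A (u, a)))
      (by rw [hΨ.proj_eq_s]; exact S.s_A_ne _)).comp a h1
    exact h2.contDiffAt.differentiableAt (by simp)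
  have hl : Function.LeftInverse h' h := fun a ↦ by
    simp only [hh', hh, hA, Ψ.apply_symm_apply, totCoeffA_totA]
  have hr : Function.RightInverse h' h := fun a ↦ by
    simp only [hh', hh, hT, Ψ.symm_apply_apply, S.α_A]
  have h0 : h 0 = 0 := by
    have : Ψ.symm (totA p (u, 0)) = S.A (u, 0) := by
      rw [totA_zero, ← hΨ.map_one, Ψ.symm_apply_apply, S.one_away]
    simp only [hh, this, S.α_A]
  obtain ⟨l, hl⟩ := Complex.exists_mul_of_leftInverse d1 d2 hl hr h0
  have hlA : ∀ a, Ψ.symm (totA p (u, a)) = S.A (u, l * a) := fun a ↦ by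
    rw [← hA a]
    exact congrArg (fun b ↦ S.A (u, b)) (hl a)
  suffices l = 1 by rw [hlA, this, one_mul]
  set κ := coeffRatio p k u
  have hκ : κ ≠ 0 := coeffRatio_ne_zero p k u
  -- Reading the target in the coordinate `u` gives `l * κ` for the derivative, while canonicity
  -- gives a value that does not involve the isomorphism. Comparison with `S.iso`, where `l = 1`,
  -- avoids computing that value.
  have key : ∀ (Ψ : PairTotIso p k), IsCanonical p k Ψ → ∀ l : ℂ,
      (∀ a, Ψ.symm (totA p (u, a)) = S.A (u, l * a)) → ∀ E : ℂ →L[ℂ] ℂ,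
      HasMFDerivAt 𝓘(ℂ, ℂ) 𝓘(ℂ, ℂ) (awayInv p) (away p u) E →
      l * κ = E (eqnAt p (away p u) ^ k * 1 : ℂ) := by
    intro Ψ hΨ l hl E hE
    have h1 := hΨ.hasMFDerivAt (away p u) 1
    have h2 : (fun τ : ℂ ↦ (pairGraph p k).t (Ψ.symm (Tot.mk (away p u) (τ * 1)))) =
        fun τ ↦ away p (u + l * (κ * τ)) := by
      funext τ
      rw [mk_away, hl, S.t_A, mul_one]
    rw [h2] at h1
    rw [show u = u + l * (κ * 0) by ring] at hE
    have h3 := HasMFDerivAt.comp 0 hE h1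
    have h4 : (awayInv p ∘ fun τ ↦ away p (u + l * (κ * τ))) = fun τ ↦ u + l * (κ * τ) :=
      funext fun τ ↦ awayInv_away p _
    rw [h4] at h3
    have h5 : HasDerivAt (fun τ : ℂ ↦ u + l * (κ * τ)) (l * κ) 0 := by
      simpa using (((hasDerivAt_id (0 : ℂ)).const_mul κ).const_mul l).const_add u
    have h6 : HasFDerivAt (fun τ : ℂ ↦ u + l * (κ * τ)) (E.comp
      (ContinuousLinearMap.toSpanSingleton ℂ (eqnAt p (away p u) ^ k * 1 : ℂ))) (0 : ℂ) :=
      hasMFDerivAt_iff_hasFDerivAt.1 h3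
    rw [← h6.hasDerivAt.unique h5]
    simp
  have hE := ((contMDiffAt_awayInv p (away_ne p u)).mdifferentiableAt (by simp)).hasMFDerivAt
  have e1 := key Ψ hΨ l hlA _ hE
  have e2 := key _ (S.isCanonical_iso hk) 1 (fun a ↦ by
    rw [one_mul]; exact S.ofTot_totA _) _ hE
  rw [← e2] at e1
  exact mul_right_cancel₀ hκ e1

theorem eq_iso (hk : 2 ≤ k) {Ψ : PairTotIso p k} (hΨ : IsCanonical p k Ψ) : Ψ = S.iso hk := by
  have := S.t2Space
  suffices h : ∀ v, Ψ.symm v = S.ofTot v by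
    refine Diffeomorph.ext fun g ↦ ?_
    have h1 := h (Ψ g)
    rw [Ψ.symm_apply_apply] at h1
    conv_rhs => rw [h1]
    exact (S.toTot_ofTot hk _).symm
  intro v
  by_cases hv : v.proj = p
  · rw [← totB_totCoeffB p hk (hv ▸ (away_ne p 0).symm : v.proj ≠ away p 0), hv, nearInv_self]
    -- A point over `p` is the limit of `totB p (f, x)` as `f → 0`, and there the two maps already
    -- agree.
    set x := totCoeffB p v
    have h1 : Continuous fun f : ℂ ↦ (totB p (f, x) : Tot k) :=
      (contMDiff_totB p hk).continuous.comp (by fun_prop)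
    have h2 : Tendsto (fun f : ℂ ↦ Ψ.symm (totB p (f, x))) (𝓝[≠] 0) (𝓝 (Ψ.symm (totB p (0, x)))) :=
      (Ψ.symm.continuous.comp h1).continuousAt.tendsto.mono_left nhdsWithin_le_nhds
    have h3 : Tendsto (fun f : ℂ ↦ S.ofTot (totB p (f, x))) (𝓝[≠] 0)
        (𝓝 (S.ofTot (totB p (0, x)))) :=
      ((S.contMDiff_ofTot hk).continuous.comp h1).continuousAt.tendsto.mono_left nhdsWithin_le_nhds
    refine tendsto_nhds_unique h2 (h3.congr' ?_)
    filter_upwards [self_mem_nhdsWithin] with f hf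
    rw [totB_of_ne p hf, S.symm_totA_eq hk hΨ, S.ofTot_totA]
  · rw [← totA_totCoeffA p hv, S.symm_totA_eq hk hΨ, S.ofTot_totA]

end

end Std

/-- Standard coordinates on `Pair(ℙ¹, k • p)`. -/
def stdPairOfLe (p : OnePoint ℂ) : (k : ℕ) → 2 ≤ k → Std p k univ (pairGraph p k)
  | k + 2, _ => stdPair p k

/-- The groupoid `Pair(ℙ¹, k • p)`. -/
def pairGroupoid (p : OnePoint ℂ) : (k : ℕ) → 2 ≤ k → LieGroupoid (pairGraph p k)
  | k + 2, _ => (stdPair p k).lieGroupoid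

/-! ### The blow-downs as morphisms -/

section pairMap

variable (p k)

theorem s_pairMap (n : ℕ) :
    ∀ g, (pairGraph p k).s (pairMap p k n g) = (pairGraph p (k + n)).s g := by
  induction n with
  | zero => intro g; rfl
  | succ n ih => exact fun g ↦ ih _

theorem t_pairMap (n : ℕ) :
    ∀ g, (pairGraph p k).t (pairMap p k n g) = (pairGraph p (k + n)).t g := by
  induction n with
  | zero => intro g; rfl
  | succ n ih => exact fun g ↦ ih _

theorem blowdown_one (Q : ReflGraph (OnePoint ℂ)) (x : OnePoint ℂ) :
    Q.blowdown p ((Q.twist p).one x) = Q.one x := Blowup.down_lift ..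

theorem pairMap_one (n : ℕ) :
    ∀ x, pairMap p k n ((pairGraph p (k + n)).one x) = (pairGraph p k).one x := by
  induction n with
  | zero => intro x; rfl
  | succ n ih =>
    intro x
    exact (congrArg (pairMap p k n) (blowdown_one p _ x)).trans (ih x)

theorem contMDiff_pairMap (n : ℕ) : ContMDiff 𝓘(ℂ, ℂ × ℂ) 𝓘(ℂ, ℂ × ℂ) ω (pairMap p k n) := by
  induction n with
  | zero => exact contMDiff_id
  | succ n ih => exact ih.comp ((pairGraph p (k + n)).contMDiff_blowdown p)

theorem blowdown_of_s_eq {Q : ReflGraph (OnePoint ℂ)} {g : (Q.twist p).Arrow}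
    (hg : (Q.twist p).s g = p) : Q.blowdown p g = Q.one p := by
  obtain ⟨y | l, hy⟩ := g
  · exact absurd hg ((Q.off_mem_twistArrow p _).1 hy).1
  · rfl

/-- In a twist the source fibre over `p` lies in the exceptional divisor, so a single blow-down
contracts it to the identity. The hypothesis `n ≠ 0` provides one. -/
theorem pairMap_of_s_eq {n : ℕ} (hn : n ≠ 0) {g : (pairGraph p (k + n)).Arrow}
    (hg : (pairGraph p (k + n)).s g = p) : pairMap p k n g = (pairGraph p k).one p := by
  obtain ⟨n, rfl⟩ := Nat.exists_eq_succ_of_ne_zero hn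
  exact (congrArg (pairMap p k n) (blowdown_of_s_eq p hg)).trans (pairMap_one p k n p)

/-- Off `p` an arrow is known from its source and target, which the blow-downs preserve. Over `p`,
unless `n = 0`, everything maps to the identity arrow, whose square is itself. -/
theorem isMorphism_pairMap (n : ℕ) (hk : 2 ≤ k) :
    (pairGroupoid p (k + n) (Nat.le_add_right_of_le hk)).IsMorphism (pairGroupoid p k hk)
      (pairMap p k n) where
  contMDiff := contMDiff_pairMap p k n
  map_s := s_pairMap p k n
  map_t := t_pairMap p k n
  map_one := pairMap_one p k n
  map_mul g h hgh := by
    obtain rfl | hn := eq_or_ne n 0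
    · rfl
    · set G := pairGroupoid p (k + n) (Nat.le_add_right_of_le hk)
      set G' := pairGroupoid p k hk
      have hgh' : (pairGraph p k).s (pairMap p k n g) = (pairGraph p k).t (pairMap p k n h) := by
        rw [s_pairMap, t_pairMap, hgh]
      by_cases hs : (pairGraph p (k + n)).s h = p
      · have ht := (stdPairOfLe p (k + n) (Nat.le_add_right_of_le hk)).t_eq hs
        rw [pairMap_of_s_eq p k hn (hgh.trans ht), pairMap_of_s_eq p k hn hs,
          pairMap_of_s_eq p k hn ((G.s_mul g h hgh).trans hs)]
        have := G'.one_mul ((pairGraph p k).one p)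
        rw [(pairGraph p k).t_one] at this
        exact this.symm
      · refine (stdPairOfLe p k hk).ext_of_ne ?_ ?_ ?_
        · rw [s_pairMap, G.s_mul g h hgh]; exact hs
        · rw [s_pairMap, G.s_mul g h hgh, G'.s_mul _ _ hgh', s_pairMap]
        · rw [t_pairMap, G.t_mul g h hgh, G'.t_mul _ _ hgh', t_pairMap]

/-- Off `p` both sides keep the coordinates `(u, a)`; over `p` with `n > 0` both are zero. -/
theorem iso_pairMap (n : ℕ) (hk : 2 ≤ k) (g : (pairGraph p (k + n)).Arrow) :
    (stdPairOfLe p k hk).iso hk (pairMap p k n g) = natMap p k n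
      ((stdPairOfLe p (k + n) (Nat.le_add_right_of_le hk)).iso (Nat.le_add_right_of_le hk) g) := by
  set S := stdPairOfLe p k hk
  have hkn : 2 ≤ k + n := Nat.le_add_right_of_le hk
  set S' := stdPairOfLe p (k + n) hkn
  change S.toTot _ = natMap p k n (S'.toTot g)
  by_cases hg : (pairGraph p (k + n)).s g = p
  · obtain rfl | hn := eq_or_ne n 0
    · change S.toTot g = Tot.mk _ (_ ^ 0 * _)
      rw [pow_zero, one_mul]
      rfl
    · rw [pairMap_of_s_eq p k hn hg, natMap_of_proj_eq p k hn]
      · exact (S.isCanonical_iso hk).map_one p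
      · exact ((S'.isCanonical_iso hkn).proj_eq_s g).trans hg
  · obtain ⟨v, rfl⟩ := S'.exists_eq_A hg
    rw [S'.toTot_A, natMap_totA p hk, ← S.toTot_A]
    congr 1
    refine S.ext_of_ne ?_ ?_ ?_
    · rw [s_pairMap]; exact hg
    · rw [s_pairMap, S'.s_A, S.s_A]
    · rw [t_pairMap, S'.t_A, S.t_A]

end pairMap

end PLine

/-! ### Derivatives and vector fields in local parametrizations -/

section Derivative

variable {E E' E'' : Type} [NormedAddCommGroup E] [NormedSpace ℂ E] [NormedAddCommGroup E']
  [NormedSpace ℂ E'] [NormedAddCommGroup E''] [NormedSpace ℂ E'']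
  {M M' M'' : Type} [TopologicalSpace M] [ChartedSpace E M] [TopologicalSpace M']
  [ChartedSpace E' M'] [TopologicalSpace M''] [ChartedSpace E'' M'']

variable (E E') in
/-- The derivative of a map between manifolds, as a linear map between the model spaces. -/
def mder (f : M → M') (x : M) : E →L[ℂ] E' := mfderiv 𝓘(ℂ, E) 𝓘(ℂ, E') f x

theorem mder_comp {g : M' → M''} {f : M → M'} {x : M}
    (hg : MDifferentiableAt 𝓘(ℂ, E') 𝓘(ℂ, E'') g (f x))
    (hf : MDifferentiableAt 𝓘(ℂ, E) 𝓘(ℂ, E') f x) (w : E) :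
    mder E E'' (g ∘ f) x w = mder E' E'' g (f x) (mder E E' f x w) :=
  congrArg (fun L : E →L[ℂ] E'' ↦ L w) (mfderiv_comp x hg hf)

theorem mder_congr {f g : M → M'} {x : M} (h : f =ᶠ[𝓝 x] g) : mder E E' f x = mder E E' g x :=
  h.mfderiv_eq

theorem mder_const (c : M') (x : M) : mder E E' (fun _ : M ↦ c) x = 0 := mfderiv_const

theorem mder_id (x : M) : mder E E (id : M → M) x = ContinuousLinearMap.id ℂ E := mfderiv_id

theorem mder_eq_fderiv (f : E → E') (x : E) : mder E E' f x = fderiv ℂ f x := mfderiv_eq_fderiv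

theorem HasDerivAt.mder_apply_one {f : ℂ → E'} {d : E'} {z : ℂ} (h : HasDerivAt f d z) :
    mder ℂ E' f z 1 = d := by
  rw [mder_eq_fderiv]
  exact h.deriv

/-- Right translation is meaningful only on a source fibre, so its derivative is known only within
that set. It is tested on velocities of curves that stay in the set. -/
theorem HasMFDerivWithinAt.mder_comp_curve {φ : M → M'} {s : Set M} {c : ℂ → M} {z : ℂ}
    {L : E →L[ℂ] E'} (hφ : HasMFDerivWithinAt 𝓘(ℂ, E) 𝓘(ℂ, E') φ s (c z) L)
    (hc : MDifferentiableAt 𝓘(ℂ, ℂ) 𝓘(ℂ, E) c z) (hs : ∀ τ, c τ ∈ s) :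
    MDifferentiableAt 𝓘(ℂ, ℂ) 𝓘(ℂ, E') (φ ∘ c) z ∧
      mder ℂ E' (φ ∘ c) z 1 = L (mder ℂ E c z 1) := by
  have h := HasMFDerivWithinAt.comp z hφ (hc.hasMFDerivAt.hasMFDerivWithinAt (s := univ))
    fun τ _ ↦ hs τ
  rw [hasMFDerivWithinAt_univ] at h
  exact ⟨h.mdifferentiableAt, congrArg (fun L : ℂ →L[ℂ] E' ↦ L 1) h.mfderiv⟩

/-- `F` is a holomorphic parametrization near `v`, with inverse `C`. -/
structure IsCoord (F : E → M) (C : M → E) (v : E) : Prop where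
  contMDiffAt : ContMDiffAt 𝓘(ℂ, E) 𝓘(ℂ, E) ω F v
  contMDiffAt_symm : ContMDiffAt 𝓘(ℂ, E) 𝓘(ℂ, E) ω C (F v)
  left_inv : C ∘ F =ᶠ[𝓝 v] id
  right_inv : F ∘ C =ᶠ[𝓝 (F v)] id

namespace IsCoord

variable {F : E → M} {C : M → E} {v : E} (h : IsCoord F C v)

include h

theorem mdifferentiableAt : MDifferentiableAt 𝓘(ℂ, E) 𝓘(ℂ, E) F v :=
  h.contMDiffAt.mdifferentiableAt (by simp)

theorem mdifferentiableAt_symm : MDifferentiableAt 𝓘(ℂ, E) 𝓘(ℂ, E) C (F v) :=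
  h.contMDiffAt_symm.mdifferentiableAt (by simp)

theorem apply_symm : C (F v) = v := h.left_inv.eq_of_nhds

theorem mder_symm_mder (w : E) : mder E E C (F v) (mder E E F v w) = w := by
  rw [← mder_comp h.mdifferentiableAt_symm h.mdifferentiableAt, mder_congr h.left_inv, mder_id]
  rfl

theorem mder_mder_symm (w : E) : mder E E F v (mder E E C (F v) w) = w := by
  have h1 : MDifferentiableAt 𝓘(ℂ, E) 𝓘(ℂ, E) F (C (F v)) := by
    rw [h.apply_symm]; exact h.mdifferentiableAt
  have h2 := mder_comp h1 h.mdifferentiableAt_symm w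
  rw [h.apply_symm] at h2
  rw [← h2, mder_congr h.right_inv, mder_id]
  rfl

theorem isInvertible : (mfderiv 𝓘(ℂ, E) 𝓘(ℂ, E) F v).IsInvertible :=
  ContinuousLinearMap.IsInvertible.of_inverse (g := mfderiv 𝓘(ℂ, E) 𝓘(ℂ, E) C (F v))
    (ContinuousLinearMap.ext h.mder_mder_symm) (ContinuousLinearMap.ext h.mder_symm_mder)

theorem isInvertible_symm : (mfderiv 𝓘(ℂ, E) 𝓘(ℂ, E) C (F v)).IsInvertible :=
  ContinuousLinearMap.IsInvertible.of_inverse (g := mfderiv 𝓘(ℂ, E) 𝓘(ℂ, E) F v)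
    (ContinuousLinearMap.ext h.mder_symm_mder) (ContinuousLinearMap.ext h.mder_mder_symm)

end IsCoord

/-- The components of a vector field with respect to a parametrization. -/
def coordField (F : E → M) (ξ : M → E) (v : E) : E :=
  VectorField.mpullback 𝓘(ℂ, E) 𝓘(ℂ, E) F ξ v

namespace IsCoord

variable {F : E → M} {C : M → E} {v : E} (h : IsCoord F C v)

include h

theorem coordField_eq (ξ : M → E) :
    coordField F ξ v = mder E E C (F v) (ξ (F v)) := by
  have h1 : (mder E E F v).inverse = mder E E C (F v) :=
    ContinuousLinearMap.inverse_eq (ContinuousLinearMap.ext h.mder_mder_symm)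
      (ContinuousLinearMap.ext h.mder_symm_mder)
  rw [← h1]
  rfl

theorem mder_coordField (ξ : M → E) :
    mder E E F v (coordField F ξ v) = ξ (F v) := by
  rw [h.coordField_eq, h.mder_mder_symm]

theorem coordField_eq_of {ξ : M → E} {w : E}
    (hw : ξ (F v) = mder E E F v w) : coordField F ξ v = w := by
  rw [h.coordField_eq, hw, h.mder_symm_mder]

theorem contDiffAt_coordField [CompleteSpace E] [IsManifold 𝓘(ℂ, E) ω M]
    {ξ : M → E}
    (hξ : ContMDiffAt 𝓘(ℂ, E) 𝓘(ℂ, E).tangent ω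
      (fun x ↦ (⟨x, ξ x⟩ : TangentBundle 𝓘(ℂ, E) M)) (F v)) :
    ContDiffAt ℂ ω (coordField F ξ) v :=
  contMDiffAt_vectorSpace_iff_contDiffAt.1
    (ContMDiffAt.mpullback_vectorField_preimage hξ h.contMDiffAt h.isInvertible le_rfl)

/-- Near `F v` the field `ξ` is the pullback of `a` along `C`, and pullbacks along local
biholomorphic maps are holomorphic. -/
theorem contMDiffAt_of_coordField [CompleteSpace E] [IsManifold 𝓘(ℂ, E) ω M] {a : E → E}
    (ha : ContDiffAt ℂ ω a v) {ξ : M → E}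
    (hξ : ∀ᶠ x in 𝓝 (F v), IsCoord F C (C x) ∧ F (C x) = x ∧
      ξ x = mder E E F (C x) (a (C x))) :
    ContMDiffAt 𝓘(ℂ, E) 𝓘(ℂ, E).tangent ω
      (fun x ↦ (⟨x, ξ x⟩ : TangentBundle 𝓘(ℂ, E) M)) (F v) := by
  have ha' : ContDiffAt ℂ ω a (C (F v)) := by rwa [h.apply_symm]
  have h1 := ContMDiffAt.mpullback_vectorField_preimage (V := a)
    (contMDiffAt_vectorSpace_iff_contDiffAt.2 ha') h.contMDiffAt_symm h.isInvertible_symm le_rfl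
  refine h1.congr_of_eventuallyEq ?_
  filter_upwards [hξ] with x hx
  obtain ⟨h2, h3, h4⟩ := hx
  have h5 : (mder E E C x).inverse = mder E E F (C x) := by
    conv_lhs => rw [← h3]
    exact ContinuousLinearMap.inverse_eq (ContinuousLinearMap.ext h2.mder_symm_mder)
      (ContinuousLinearMap.ext h2.mder_mder_symm)
  refine congrArg (fun w : E ↦ (⟨x, w⟩ : TangentBundle 𝓘(ℂ, E) M)) ?_
  rw [h4, ← h5]
  rfl

/-- Pullback of vector fields commutes with the bracket, so brackets can be computed on components.
-/
theorem mlieBracket_eq [CompleteSpace E] [IsManifold 𝓘(ℂ, E) ω M] 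
    {ξ ξ' : M → E}
    (hξ : ContMDiffAt 𝓘(ℂ, E) 𝓘(ℂ, E).tangent ω
      (fun x ↦ (⟨x, ξ x⟩ : TangentBundle 𝓘(ℂ, E) M)) (F v))
    (hξ' : ContMDiffAt 𝓘(ℂ, E) 𝓘(ℂ, E).tangent ω
      (fun x ↦ (⟨x, ξ' x⟩ : TangentBundle 𝓘(ℂ, E) M)) (F v)) :
    (VectorField.mlieBracket 𝓘(ℂ, E) ξ ξ' (F v) : E) =
      mder E E F v (VectorField.lieBracket ℂ (coordField F ξ) (coordField F ξ') v) := by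
  have : IsManifold 𝓘(ℂ, E) (minSmoothness ℂ 2) M := .of_le (n := ω) le_top
  have h1 := VectorField.mpullback_mlieBracket (n := ω) (hξ.mdifferentiableAt (by simp))
    (hξ'.mdifferentiableAt (by simp)) h.contMDiffAt le_top
  have h2 : ∀ V W : E → E, VectorField.mlieBracket 𝓘(ℂ, E) V W = VectorField.lieBracket ℂ V W :=
    fun V W ↦ VectorField.mlieBracketWithin_eq_lieBracketWithin.trans
      VectorField.lieBracketWithin_univ
  rw [← h.mder_coordField (VectorField.mlieBracket 𝓘(ℂ, E) ξ ξ')]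
  exact congrArg _ (h1.trans (congrFun (h2 _ _) v))

end IsCoord

end Derivative

/-! ### Derivatives of source, target and right translations -/

namespace PLine

theorem isCoord_away (p : OnePoint ℂ) (u : ℂ) : IsCoord (away p) (awayInv p) u where
  contMDiffAt := contMDiff_away p u
  contMDiffAt_symm := contMDiffAt_awayInv p (away_ne p u)
  left_inv := .of_forall (awayInv_away p)
  right_inv := by
    filter_upwards [isOpen_ne.mem_nhds (away_ne p u)] with x hx using away_awayInv p hx

theorem isCoord_near (p : OnePoint ℂ) (f : ℂ) : IsCoord (near p) (nearInv p) f where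
  contMDiffAt := contMDiff_near p f
  contMDiffAt_symm := contMDiffAt_nearInv p (near_ne_away_zero p f)
  left_inv := .of_forall (nearInv_near p)
  right_inv := by
    filter_upwards [isOpen_ne.mem_nhds (near_ne_away_zero p f)] with x hx using near_nearInv p hx

/-- The preferred chart at `p` is `nearInv p` up to a translation. -/
theorem mder_chartAt_near (p : OnePoint ℂ) (f : ℂ) :
    mder ℂ ℂ (chartAt ℂ p) (near p f) = mder ℂ ℂ (nearInv p) (near p f) := by
  have h1 : (chartAt ℂ p : OnePoint ℂ → ℂ) =ᶠ[𝓝 (near p f)]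
      (fun z ↦ chartAt ℂ p p + z) ∘ nearInv p := by
    filter_upwards [isOpen_ne.mem_nhds (near_ne_away_zero p f)] with x hx
    rw [Function.comp_apply, ← chartAt_near, near_nearInv p hx]
  have h2 : HasDerivAt (fun z ↦ chartAt ℂ p p + z) 1 (nearInv p (near p f)) :=
    (hasDerivAt_id _).const_add _
  ext
  rw [mder_congr h1, mder_comp h2.differentiableAt.mdifferentiableAt
    (isCoord_near p f).mdifferentiableAt_symm, mder_eq_fderiv, h2.hasFDerivAt.fderiv]
  simp

namespace Std

variable {p : OnePoint ℂ} {k : ℕ} {Q : ReflGraph (OnePoint ℂ)} (S : Std p (k + 2) univ Q)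

/-- The arrow with the given source and target, in the affine coordinate of `ℙ¹ ∖ {p}`. -/
def E (v : ℂ × ℂ) : Q.Arrow := S.A (v.1, v.2 - v.1)

variable (p) in
/-- The source and the target, in the affine coordinate of `ℙ¹ ∖ {p}`. -/
def ends (g : Q.Arrow) : ℂ × ℂ := (awayInv p (Q.s g), awayInv p (Q.t g))

theorem s_E (v : ℂ × ℂ) : Q.s (S.E v) = away p v.1 := S.s_A _

theorem t_E (v : ℂ × ℂ) : Q.t (S.E v) = away p v.2 := by
  rw [E, S.t_A, add_sub_cancel]

theorem s_E_ne (v : ℂ × ℂ) : Q.s (S.E v) ≠ p := by rw [S.s_E]; exact away_ne p _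

theorem ends_E (v : ℂ × ℂ) : ends p (S.E v) = v := by
  rw [ends, S.s_E, S.t_E, awayInv_away, awayInv_away]

theorem E_ends {g : Q.Arrow} (hg : Q.s g ≠ p) : S.E (ends p g) = g := S.A_eq g hg

theorem one_away_eq_E (u : ℂ) : Q.one (away p u) = S.E (u, u) := by
  rw [S.one_away, E, sub_self]

theorem isCoord_E (v : ℂ × ℂ) : IsCoord S.E (ends p) v where
  contMDiffAt := by
    have h : ContDiff ℂ ω fun v : ℂ × ℂ ↦ (v.1, v.2 - v.1) :=
      contDiff_fst.prodMk (contDiff_snd.sub contDiff_fst)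
    exact (S.contMDiff_A.comp h.contMDiff) v
  contMDiffAt_symm :=
    ((contMDiffAt_awayInv p (S.s_E_ne v)).comp _ (Q.contMDiff_s _)).prodMk_space
      ((contMDiffAt_awayInv p (S.t_ne _ (S.s_E_ne v))).comp _ (Q.contMDiff_t _))
  left_inv := .of_forall S.ends_E
  right_inv := by
    filter_upwards [Q.contMDiff_s.continuous.continuousAt.eventually_ne (S.s_E_ne v)] with g hg
      using S.E_ends hg

theorem isCoord_B (v : ℂ × ℂ) : IsCoord S.B S.β v where
  contMDiffAt := S.contMDiff_B v
  contMDiffAt_symm := S.contMDiffAt_β (S.s_B_ne (mem_univ v))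
  left_inv := .of_forall fun v ↦ S.β_B (mem_univ v)
  right_inv := by
    filter_upwards [Q.contMDiff_s.continuous.continuousAt.eventually_ne (S.s_B_ne (mem_univ v))]
      with g hg using S.B_β hg

theorem mdifferentiableAt_s (g : Q.Arrow) : MDifferentiableAt 𝓘(ℂ, ℂ × ℂ) 𝓘(ℂ, ℂ) Q.s g :=
  (Q.contMDiff_s g).mdifferentiableAt (by simp)

theorem mdifferentiableAt_t (g : Q.Arrow) : MDifferentiableAt 𝓘(ℂ, ℂ × ℂ) 𝓘(ℂ, ℂ) Q.t g :=
  (Q.contMDiff_t g).mdifferentiableAt (by simp)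

theorem mder_comp_fst {f : ℂ → OnePoint ℂ} {v : ℂ × ℂ}
    (hf : MDifferentiableAt 𝓘(ℂ, ℂ) 𝓘(ℂ, ℂ) f v.1) (w : ℂ × ℂ) :
    mder (ℂ × ℂ) ℂ (f ∘ Prod.fst) v w = mder ℂ ℂ f v.1 w.1 := by
  rw [mder_comp hf differentiableAt_fst.mdifferentiableAt, mder_eq_fderiv, fderiv_fst]
  rfl

theorem mder_comp_snd {f : ℂ → OnePoint ℂ} {v : ℂ × ℂ}
    (hf : MDifferentiableAt 𝓘(ℂ, ℂ) 𝓘(ℂ, ℂ) f v.2) (w : ℂ × ℂ) :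
    mder (ℂ × ℂ) ℂ (f ∘ Prod.snd) v w = mder ℂ ℂ f v.2 w.2 := by
  rw [mder_comp hf differentiableAt_snd.mdifferentiableAt, mder_eq_fderiv, fderiv_snd]
  rfl

theorem mder_s_E (v w : ℂ × ℂ) :
    mder (ℂ × ℂ) ℂ Q.s (S.E v) (mder (ℂ × ℂ) (ℂ × ℂ) S.E v w) = mder ℂ ℂ (away p) v.1 w.1 := by
  rw [← mder_comp (mdifferentiableAt_s _) (S.isCoord_E v).mdifferentiableAt,
    ← mder_comp_fst (isCoord_away p _).mdifferentiableAt]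
  exact congrArg (fun F ↦ mder (ℂ × ℂ) ℂ F v w) (funext S.s_E)

theorem mder_t_E (v w : ℂ × ℂ) :
    mder (ℂ × ℂ) ℂ Q.t (S.E v) (mder (ℂ × ℂ) (ℂ × ℂ) S.E v w) = mder ℂ ℂ (away p) v.2 w.2 := by
  rw [← mder_comp (mdifferentiableAt_t _) (S.isCoord_E v).mdifferentiableAt,
    ← mder_comp_snd (isCoord_away p _).mdifferentiableAt]
  exact congrArg (fun F ↦ mder (ℂ × ℂ) ℂ F v w) (funext S.t_E)

theorem mder_s_B (v w : ℂ × ℂ) :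
    mder (ℂ × ℂ) ℂ Q.s (S.B v) (mder (ℂ × ℂ) (ℂ × ℂ) S.B v w) = mder ℂ ℂ (near p) v.1 w.1 := by
  rw [← mder_comp (mdifferentiableAt_s _) (S.isCoord_B v).mdifferentiableAt,
    ← mder_comp_fst (isCoord_near p _).mdifferentiableAt]
  exact congrArg (fun F ↦ mder (ℂ × ℂ) ℂ F v w) (funext fun v ↦ S.s_B v (mem_univ v))

theorem hasDerivAt_line (v : ℂ × ℂ) (b : ℂ) :
    HasDerivAt (fun τ : ℂ ↦ (v.1, v.2 + τ * b)) (0, b) 0 := by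
  have h : HasDerivAt (fun τ : ℂ ↦ v.2 + τ * b) b 0 := by
    simpa using ((hasDerivAt_id (0 : ℂ)).mul_const b).const_add v.2
  exact (hasDerivAt_const 0 v.1).prodMk h

theorem mder_line {F : ℂ × ℂ → Q.Arrow} {v : ℂ × ℂ}
    (hF : MDifferentiableAt 𝓘(ℂ, ℂ × ℂ) 𝓘(ℂ, ℂ × ℂ) F v) (b : ℂ) :
    MDifferentiableAt 𝓘(ℂ, ℂ) 𝓘(ℂ, ℂ × ℂ) (fun τ : ℂ ↦ F (v.1, v.2 + τ * b)) 0 ∧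
      mder ℂ (ℂ × ℂ) (fun τ : ℂ ↦ F (v.1, v.2 + τ * b)) 0 1 =
        mder (ℂ × ℂ) (ℂ × ℂ) F v (0, b) := by
  have hv : (v.1, v.2 + 0 * b) = v := by simp
  have hF' : MDifferentiableAt 𝓘(ℂ, ℂ × ℂ) 𝓘(ℂ, ℂ × ℂ) F (v.1, v.2 + 0 * b) := by rwa [hv]
  have hl := (hasDerivAt_line v b).differentiableAt.mdifferentiableAt
  refine ⟨hF'.comp 0 hl, ?_⟩
  have h2 := mder_comp (f := fun τ : ℂ ↦ (v.1, v.2 + τ * b)) (x := 0) hF' hl 1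
  rw [hv, (hasDerivAt_line v b).mder_apply_one] at h2
  exact h2

/-- The target is constantly `p` on the source fibre over `p`. -/
theorem mder_t_B_zero (x b : ℂ) :
    mder (ℂ × ℂ) ℂ Q.t (S.B (0, x)) (mder (ℂ × ℂ) (ℂ × ℂ) S.B (0, x) (0, b)) = 0 := by
  obtain ⟨h1, h2⟩ := mder_line (S.isCoord_B (0, x)).mdifferentiableAt b
  have h3 : Q.t ∘ (fun τ : ℂ ↦ S.B (0, x + τ * b)) = fun _ ↦ p := funext fun τ ↦ S.t_B0 _
  have h4 : S.B (0, x + 0 * b) = S.B (0, x) := by simp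
  have h5 := mder_comp (f := fun τ : ℂ ↦ S.B (0, x + τ * b)) (x := 0) (mdifferentiableAt_t _) h1 1
  rw [h3, mder_const, h2, h4] at h5
  exact h5.symm

/-- The derivative of `f / (1 + x * f ^ (k + 1))` in `x`. The factor `f ^ (k + 2)` is the origin of
the order of vanishing of the anchor. -/
theorem mder_nearInv_t_B {f x : ℂ} (hρ : 1 + x * f ^ (k + 1) ≠ 0) (b : ℂ) :
    mder ℂ ℂ (nearInv p) (Q.t (S.B (f, x))) (mder (ℂ × ℂ) ℂ Q.t (S.B (f, x))
      (mder (ℂ × ℂ) (ℂ × ℂ) S.B (f, x) (0, b))) =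
        -(b * f ^ (k + 2)) / (1 + x * f ^ (k + 1)) ^ 2 := by
  obtain ⟨h1, h2⟩ := mder_line (S.isCoord_B (f, x)).mdifferentiableAt b
  have h4 : S.B (f, x + 0 * b) = S.B (f, x) := by simp
  have h5 := mder_comp (f := fun τ : ℂ ↦ S.B (f, x + τ * b)) (x := 0) (mdifferentiableAt_t _) h1 1
  have h6 : MDifferentiableAt 𝓘(ℂ, ℂ) 𝓘(ℂ, ℂ) (nearInv p) (Q.t (S.B (f, x + 0 * b))) := by
    rw [h4, S.t_B' hρ]
    exact (isCoord_near p _).mdifferentiableAt_symm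
  have h7 := mder_comp (f := Q.t ∘ fun τ : ℂ ↦ S.B (f, x + τ * b)) (x := 0) h6
    ((mdifferentiableAt_t _).comp (0 : ℂ) h1) 1
  simp only [Function.comp_apply] at h7
  rw [h5, h2, h4] at h7
  rw [← h7]
  have h8 : HasDerivAt (fun τ : ℂ ↦ 1 + (x + τ * b) * f ^ (k + 1)) (b * f ^ (k + 1)) 0 := by
    simpa using ((((hasDerivAt_id (0 : ℂ)).mul_const b).const_add x).mul_const
      (f ^ (k + 1))).const_add 1
  have h9 : ∀ᶠ τ : ℂ in 𝓝 0, 1 + (x + τ * b) * f ^ (k + 1) ≠ 0 :=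
    h8.continuousAt.eventually_ne (by simpa using hρ)
  have h10 : nearInv p ∘ (Q.t ∘ fun τ : ℂ ↦ S.B (f, x + τ * b)) =ᶠ[𝓝 0]
      fun τ ↦ f / (1 + (x + τ * b) * f ^ (k + 1)) := by
    filter_upwards [h9] with τ hτ
    simp only [Function.comp_apply]
    rw [S.t_B' hτ, nearInv_near]
  rw [mder_congr h10]
  have h11 := (hasDerivAt_const (0 : ℂ) f).fun_div h8 h9.self_of_nhds
  rw [h11.mder_apply_one]
  simp only [zero_mul, add_zero, zero_sub]
  ring

include S in
/-- Off the fibre over `p`, the source and the target are local coordinates. -/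
theorem eq_of_mder_eq {g : Q.Arrow} (hg : Q.s g ≠ p) {w w' : ℂ × ℂ}
    (hs : mder (ℂ × ℂ) ℂ Q.s g w = mder (ℂ × ℂ) ℂ Q.s g w')
    (ht : mder (ℂ × ℂ) ℂ Q.t g w = mder (ℂ × ℂ) ℂ Q.t g w') : w = w' := by
  obtain ⟨v, rfl⟩ : ∃ v, g = S.E v := ⟨_, (S.E_ends hg).symm⟩
  have h := S.isCoord_E v
  rw [← h.mder_mder_symm w, ← h.mder_mder_symm w'] at hs ht ⊢
  rw [S.mder_s_E, S.mder_s_E] at hs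
  rw [S.mder_t_E, S.mder_t_E] at ht
  congr 1
  refine Prod.ext ?_ ?_
  · rw [← (isCoord_away p v.1).mder_symm_mder (Prod.fst _), hs, IsCoord.mder_symm_mder]
    exact isCoord_away p v.1
  · rw [← (isCoord_away p v.2).mder_symm_mder (Prod.snd _), ht, IsCoord.mder_symm_mder]
    exact isCoord_away p v.2

theorem exists_mder_E {v w : ℂ × ℂ} (hs : mder (ℂ × ℂ) ℂ Q.s (S.E v) w = 0) :
    ∃ b, w = mder (ℂ × ℂ) (ℂ × ℂ) S.E v (0, b) := by
  have h := S.isCoord_E v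
  rw [← h.mder_mder_symm w, S.mder_s_E] at hs
  refine ⟨(mder (ℂ × ℂ) (ℂ × ℂ) (ends p) (S.E v) w).2, ?_⟩
  conv_lhs => rw [← h.mder_mder_symm w]
  congr 1
  refine Prod.ext ?_ rfl
  rw [← (isCoord_away p v.1).mder_symm_mder (Prod.fst _), hs, map_zero]

theorem exists_mder_B {v w : ℂ × ℂ} (hs : mder (ℂ × ℂ) ℂ Q.s (S.B v) w = 0) :
    ∃ b, w = mder (ℂ × ℂ) (ℂ × ℂ) S.B v (0, b) := by
  have h := S.isCoord_B v
  rw [← h.mder_mder_symm w, S.mder_s_B] at hs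
  refine ⟨(mder (ℂ × ℂ) (ℂ × ℂ) S.β (S.B v) w).2, ?_⟩
  conv_lhs => rw [← h.mder_mder_symm w]
  congr 1
  refine Prod.ext ?_ rfl
  rw [← (isCoord_near p v.1).mder_symm_mder (Prod.fst _), hs, map_zero]

include S in
/-- A vector tangent to a source fibre is the velocity of a curve in the fibre. -/
theorem exists_curve {g : Q.Arrow} {w : ℂ × ℂ} (hs : mder (ℂ × ℂ) ℂ Q.s g w = 0) :
    ∃ c : ℂ → Q.Arrow, c 0 = g ∧ MDifferentiableAt 𝓘(ℂ, ℂ) 𝓘(ℂ, ℂ × ℂ) c 0 ∧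
      (∀ τ, Q.s (c τ) = Q.s g) ∧ mder ℂ (ℂ × ℂ) c 0 1 = w := by
  by_cases hg : Q.s g = p
  · obtain ⟨x, -, rfl⟩ := S.exists_eq_B hg
    obtain ⟨b, rfl⟩ := S.exists_mder_B hs
    obtain ⟨h1, h2⟩ := mder_line (S.isCoord_B (0, x)).mdifferentiableAt b
    exact ⟨_, by simp, h1, fun τ ↦ by rw [S.s_B0, S.s_B0], h2⟩
  · obtain ⟨v, rfl⟩ : ∃ v, g = S.E v := ⟨_, (S.E_ends hg).symm⟩
    obtain ⟨b, rfl⟩ := S.exists_mder_E hs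
    obtain ⟨h1, h2⟩ := mder_line (S.isCoord_E v).mdifferentiableAt b
    exact ⟨_, by simp, h1, fun τ ↦ by rw [S.s_E, S.s_E], h2⟩

section RightTranslation

variable (G : LieGroupoid Q) {g h : Q.Arrow}

/-- Right invariance is a condition on every derivative of the translation within the source fibre;
it has content because one exists. -/
theorem exists_hasMFDerivWithinAt_mul (hgh : Q.s g = Q.t h) :
    ∃ L : ℂ × ℂ →L[ℂ] ℂ × ℂ, HasMFDerivWithinAt 𝓘(ℂ, ℂ × ℂ) 𝓘(ℂ, ℂ × ℂ)
      (fun g' ↦ G.mul g' h) {g' | Q.s g' = Q.t h} g L := by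
  have h1 : ContMDiffWithinAt 𝓘(ℂ, ℂ × ℂ) 𝓘(ℂ, ℂ × ℂ) ω
      ((fun q : Q.Arrow × Q.Arrow ↦ G.mul q.1 q.2) ∘ fun g' ↦ (g', h)) {g' | Q.s g' = Q.t h} g :=
    (G.contMDiffOn_mul (g, h) hgh).comp g (contMDiffWithinAt_id.prodMk contMDiffWithinAt_const)
      fun g' hg' ↦ hg'
  exact ⟨_, (h1.mdifferentiableWithinAt (by simp)).hasMFDerivWithinAt⟩

-- Right translation by `h` keeps the target of `g`, and its values all have the source of `h`. Both
-- identities are differentiated along a curve in the source fibre with velocity `w`.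
include S in
theorem mder_mul (hgh : Q.s g = Q.t h) {L : ℂ × ℂ →L[ℂ] ℂ × ℂ}
    (hL : HasMFDerivWithinAt 𝓘(ℂ, ℂ × ℂ) 𝓘(ℂ, ℂ × ℂ)
      (fun g' ↦ G.mul g' h) {g' | Q.s g' = Q.t h} g L) {w : ℂ × ℂ}
    (hw : mder (ℂ × ℂ) ℂ Q.s g w = 0) :
    mder (ℂ × ℂ) ℂ Q.s (G.mul g h) (L w) = 0 ∧
      mder (ℂ × ℂ) ℂ Q.t (G.mul g h) (L w) = mder (ℂ × ℂ) ℂ Q.t g w := by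
  obtain ⟨c, rfl, hc, hcs, rfl⟩ := S.exists_curve hw
  have hs : ∀ τ, Q.s (c τ) = Q.t h := fun τ ↦ (hcs τ).trans hgh
  obtain ⟨h1, h2⟩ := hL.mder_comp_curve hc hs
  rw [← h2]
  constructor
  · have h3 := mder_comp (f := (fun g' ↦ G.mul g' h) ∘ c) (x := 0) (mdifferentiableAt_s _) h1 1
    have h4 : Q.s ∘ ((fun g' ↦ G.mul g' h) ∘ c) = fun _ ↦ Q.s h :=
      funext fun τ ↦ G.s_mul _ _ (hs τ)
    rw [h4, mder_const] at h3
    exact h3.symm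
  · have h3 := mder_comp (f := (fun g' ↦ G.mul g' h) ∘ c) (x := 0) (mdifferentiableAt_t _) h1 1
    have h4 : Q.t ∘ ((fun g' ↦ G.mul g' h) ∘ c) = Q.t ∘ c :=
      funext fun τ ↦ G.t_mul _ _ (hs τ)
    rw [h4, mder_comp (mdifferentiableAt_t _) hc] at h3
    exact h3.symm

end RightTranslation

end Std

end PLine

/-! ### The Lie algebroid -/

namespace PLine

namespace Std

open LieGroupoid

variable {p : OnePoint ℂ} {k : ℕ} {Q : ReflGraph (OnePoint ℂ)} (S : Std p (k + 2) univ Q)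

theorem one_near' (f : ℂ) : Q.one (near p f) = S.B (f, 0) := by
  by_cases hf : f = 0
  · rw [hf, near_zero, S.one_self]; rfl
  · exact S.one_near hf

section Section

variable {G : LieGroupoid Q} {V : Set (OnePoint ℂ)} {ξ ξ' : Q.Arrow → ℂ × ℂ}

theorem contMDiffAt_section (hV : IsOpen V) (hξ : G.IsAlgebroidSection V ξ) {g : Q.Arrow}
    (hg : Q.t g ∈ V) : ContMDiffAt 𝓘(ℂ, ℂ × ℂ) 𝓘(ℂ, ℂ × ℂ).tangent ω
      (fun g ↦ (⟨g, ξ g⟩ : TangentBundle 𝓘(ℂ, ℂ × ℂ) Q.Arrow)) g :=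
  hξ.contMDiffOn.contMDiffAt ((hV.preimage Q.contMDiff_t.continuous).mem_nhds hg)

theorem mder_s_section (hξ : G.IsAlgebroidSection V ξ) {g : Q.Arrow} (hg : Q.t g ∈ V) :
    mder (ℂ × ℂ) ℂ Q.s g (ξ g) = 0 := hξ.vertical g hg

theorem anchor_eq (ξ : Q.Arrow → ℂ × ℂ) (x : OnePoint ℂ) :
    anchor Q ξ x = mder (ℂ × ℂ) ℂ Q.t (Q.one x) (ξ (Q.one x)) := rfl

-- Right translation by `g` carries the value of `ξ` at the identity over `Q.t g` to its value at
-- `g`, and does not change the target. So `ξ` is related by `Q.t` to its anchor.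
include S in
theorem mder_t_section (hξ : G.IsAlgebroidSection V ξ) {g : Q.Arrow} (hg : Q.t g ∈ V) :
    mder (ℂ × ℂ) ℂ Q.t g (ξ g) = anchor Q ξ (Q.t g) := by
  have h1 : Q.s (Q.one (Q.t g)) = Q.t g := Q.s_one _
  have h2 : Q.t (Q.one (Q.t g)) ∈ V := by rwa [Q.t_one]
  obtain ⟨L, hL⟩ := exists_hasMFDerivWithinAt_mul G h1
  have h3 : L (ξ (Q.one (Q.t g))) = ξ (G.mul (Q.one (Q.t g)) g) :=
    hξ.right_invariant _ _ h2 h1 L hL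
  have h4 := (S.mder_mul G h1 hL (mder_s_section hξ h2)).2
  rw [h3, G.one_mul] at h4
  exact h4

theorem exists_section_B (hξ : G.IsAlgebroidSection V ξ) {v : ℂ × ℂ} (hv : Q.t (S.B v) ∈ V) :
    ∃ b, coordField S.B ξ v = (0, b) ∧ ξ (S.B v) = mder (ℂ × ℂ) (ℂ × ℂ) S.B v (0, b) := by
  obtain ⟨b, hb⟩ := S.exists_mder_B (mder_s_section hξ hv)
  exact ⟨b, (S.isCoord_B v).coordField_eq_of hb, hb⟩

include S in
theorem anchor_self (hξ : G.IsAlgebroidSection V ξ) (hp : p ∈ V) :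
    (anchor Q ξ p : ℂ) = 0 := by
  obtain ⟨b, -, hb⟩ := S.exists_section_B hξ (v := (0, 0)) (by rwa [S.t_B0])
  rw [anchor_eq, S.one_self]
  exact (congrArg _ hb).trans (S.mder_t_B_zero 0 b)

theorem anchor_near (hξ : G.IsAlgebroidSection V ξ) {f : ℂ} (hf : near p f ∈ V) :
    mder ℂ ℂ (chartAt ℂ p) (near p f) (anchor Q ξ (near p f)) =
      -(coordField S.B ξ (f, 0)).2 * f ^ (k + 2) := by
  have ht : Q.t (S.B (f, 0)) = near p f := by
    rw [S.t_B' (by simp), zero_mul, add_zero, div_one]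
  obtain ⟨b, hb, hb'⟩ := S.exists_section_B hξ (v := (f, 0)) (by rwa [ht])
  have h1 := S.mder_nearInv_t_B (f := f) (x := 0) (by simp) b
  rw [mder_chartAt_near, hb, anchor_eq, S.one_near', hb', ← ht, h1]
  simp

include S in
theorem isTwistedField_anchor (hV : IsOpen V) (hξ : G.IsAlgebroidSection V ξ) :
    IsTwistedField p (k + 2) V (anchor Q ξ) where
  contMDiffOn := by
    have h1 : ContMDiffOn 𝓘(ℂ, ℂ) 𝓘(ℂ, ℂ).tangent ω (tangentMap 𝓘(ℂ, ℂ × ℂ) 𝓘(ℂ, ℂ) Q.t ∘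
        (fun g ↦ (⟨g, ξ g⟩ : TangentBundle 𝓘(ℂ, ℂ × ℂ) Q.Arrow)) ∘ Q.one) V := by
      refine (Q.contMDiff_t.contMDiff_tangentMap le_rfl).comp_contMDiffOn ?_
      refine hξ.contMDiffOn.comp Q.contMDiff_one.contMDiffOn fun x hx ↦ ?_
      rwa [mem_preimage, mem_preimage, Q.t_one]
    have h2 : ∀ (x y : OnePoint ℂ) (w : ℂ), x = y → (⟨x, w⟩ : TangentBundle 𝓘(ℂ, ℂ) (OnePoint ℂ)) =
        (⟨y, w⟩ : TangentBundle 𝓘(ℂ, ℂ) (OnePoint ℂ)) := by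
      rintro x y w rfl; rfl
    exact h1.congr fun x _ ↦ h2 _ _ _ (Q.t_one x).symm
  order hp := by
    set c₀ := chartAt ℂ p p
    -- Along the identities `b` is the component of `ξ` in the fibre direction. The anchor is `-b`
    -- times the power `f ^ (k + 2)`, with `f = z - c₀` in the preferred chart.
    set b : ℂ → ℂ := fun f ↦ (coordField S.B ξ (f, 0)).2
    have h1 : ContDiffAt ℂ ω b 0 := by
      have h2 := (S.isCoord_B (0, 0)).contDiffAt_coordField
        (contMDiffAt_section hV hξ (by rwa [S.t_B0]))
      exact (ContDiffAt.comp (f := fun f : ℂ ↦ (f, (0 : ℂ))) (0 : ℂ) h2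
        (contDiffAt_id.prodMk contDiffAt_const)).snd
    have h3 : AnalyticAt ℂ (fun z ↦ -b (z - c₀)) c₀ := by
      have h4 : AnalyticAt ℂ b (c₀ - c₀) := by rw [sub_self]; exact h1.analyticAt
      exact (h4.comp (f := fun z ↦ z - c₀) (by fun_prop)).neg
    have h5 : (fun z ↦ -b (z - c₀) * (z - c₀) ^ (k + 2)) =ᶠ[𝓝 c₀] fun z : ℂ ↦
        (mfderiv 𝓘(ℂ, ℂ) 𝓘(ℂ, ℂ) (chartAt ℂ p) ((chartAt ℂ p).symm z)
          (anchor Q ξ ((chartAt ℂ p).symm z)) : ℂ) := by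
      have h6 : ContinuousAt (fun z ↦ near p (z - c₀)) c₀ :=
        ((contMDiff_near p).continuous.comp (by fun_prop)).continuousAt
      filter_upwards [h6.preimage_mem_nhds (hV.mem_nhds (by rwa [sub_self, near_zero]))] with z hz
      have h7 : (chartAt ℂ p).symm z = near p (z - c₀) := by
        rw [← chartAt_symm_add, add_sub_cancel]
      rw [h7]
      exact (S.anchor_near hξ hz).symm
    have h8 : AnalyticAt ℂ (fun z ↦ -b (z - c₀) * (z - c₀) ^ (k + 2)) c₀ := h3.mul (by fun_prop)
    rw [← analyticOrderAt_congr h5]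
    refine (natCast_le_analyticOrderAt h8).2 ⟨_, h3, .of_forall fun z ↦ ?_⟩
    rw [smul_eq_mul, mul_comm]

include S in
theorem section_eq_of_ne (hξ : G.IsAlgebroidSection V ξ) (hξ' : G.IsAlgebroidSection V ξ')
    (h : ∀ x ∈ V, anchor Q ξ x = anchor Q ξ' x) {g : Q.Arrow} (hg : Q.t g ∈ V) (hp : Q.s g ≠ p) :
    ξ g = ξ' g := by
  refine S.eq_of_mder_eq hp ?_ ?_
  · rw [mder_s_section hξ hg, mder_s_section hξ' hg]
  · rw [S.mder_t_section hξ hg, S.mder_t_section hξ' hg, h _ hg]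

-- Off `p` the derivatives of source and target determine `ξ`, and both are given by verticality and
-- the anchor. The fibre over `p` follows by continuity of the components in the coordinates `B`.
include S in
theorem section_eq (hV : IsOpen V) (hξ : G.IsAlgebroidSection V ξ)
    (hξ' : G.IsAlgebroidSection V ξ')
    (h : ∀ x ∈ V, anchor Q ξ x = anchor Q ξ' x) {g : Q.Arrow} (hg : Q.t g ∈ V) :
    ξ g = ξ' g := by
  by_cases hp : Q.s g = p
  · obtain ⟨x, -, rfl⟩ := S.exists_eq_B hp
    have hB := S.isCoord_B (0, x)
    have hl : ContinuousAt (fun f : ℂ ↦ (f, x)) 0 := by fun_prop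
    have h1 : ∀ {ξ : Q.Arrow → ℂ × ℂ}, G.IsAlgebroidSection V ξ →
        Tendsto (fun f ↦ coordField S.B ξ (f, x)) (𝓝[≠] 0) (𝓝 (coordField S.B ξ (0, x))) :=
      fun hξ ↦ (ContinuousAt.comp (x := (0 : ℂ)) (f := fun f : ℂ ↦ (f, x))
        (hB.contDiffAt_coordField (contMDiffAt_section hV hξ hg)).continuousAt
          hl).tendsto.mono_left nhdsWithin_le_nhds
    have h2 : ∀ᶠ f : ℂ in 𝓝 0, Q.t (S.B (f, x)) ∈ V :=
      ((Q.contMDiff_t.continuous.comp S.contMDiff_B.continuous).continuousAt.comp hl).eventually_mem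
        (hV.mem_nhds hg)
    have h3 : coordField S.B ξ (0, x) = coordField S.B ξ' (0, x) := by
      refine tendsto_nhds_unique (h1 hξ) ((h1 hξ').congr' ?_)
      filter_upwards [nhdsWithin_le_nhds h2, self_mem_nhdsWithin] with f hf hf0
      rw [(S.isCoord_B (f, x)).coordField_eq, (S.isCoord_B (f, x)).coordField_eq,
        S.section_eq_of_ne hξ hξ' h hf (by rw [S.s_B']; exact near_ne p hf0)]
    rw [← hB.mder_coordField ξ, h3, hB.mder_coordField]
  · exact S.section_eq_of_ne hξ hξ' h hg hp

/-- In the coordinates source and target a section has no source component, and its target component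
is that of the anchor and depends on the target alone. -/
theorem coordField_E (hξ : G.IsAlgebroidSection V ξ) {v : ℂ × ℂ} (hv : away p v.2 ∈ V) :
    coordField S.E ξ v = (0, coordField (away p) (anchor Q ξ) v.2) := by
  have ht : Q.t (S.E v) ∈ V := by rwa [S.t_E]
  refine (S.isCoord_E v).coordField_eq_of (S.eq_of_mder_eq (S.s_E_ne v) ?_ ?_)
  · rw [mder_s_section hξ ht, S.mder_s_E, map_zero]
  · refine (S.mder_t_section hξ ht).trans ?_
    rw [S.mder_t_E]
    refine Eq.trans ?_ ((isCoord_away p v.2).mder_coordField (anchor Q ξ)).symm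
    exact congrArg (fun x ↦ (anchor Q ξ x : ℂ)) (S.t_E v)

theorem fderiv_prodMk_zero_snd {ψ : ℂ → ℂ} {v : ℂ × ℂ} (hψ : DifferentiableAt ℂ ψ v.2)
    (w : ℂ × ℂ) :
    fderiv ℂ (fun v : ℂ × ℂ ↦ ((0, ψ v.2) : ℂ × ℂ)) v w = (0, fderiv ℂ ψ v.2 w.2) := by
  have h1 : HasFDerivAt (fun v : ℂ × ℂ ↦ ψ v.2) _ v := hψ.hasFDerivAt.comp v hasFDerivAt_snd
  rw [((hasFDerivAt_const (0 : ℂ) v).prodMk h1).fderiv]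
  rfl

-- Off `p` the bracket of two fields of the form `(0, ψ)` with `ψ` a function of the target is the
-- bracket of the target components. At `p` both anchors vanish, hence so does their bracket, while
-- the bracket of the sections is tangent to the fibre over `p`, on which the target is constant.
include S in
theorem anchor_mlieBracket (hV : IsOpen V) (hξ : G.IsAlgebroidSection V ξ)
    (hξ' : G.IsAlgebroidSection V ξ') {x : OnePoint ℂ} (hx : x ∈ V) :
    anchor Q (VectorField.mlieBracket 𝓘(ℂ, ℂ × ℂ) ξ ξ') x =
      VectorField.mlieBracket 𝓘(ℂ, ℂ) (anchor Q ξ) (anchor Q ξ') x := by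
  by_cases hp : x = p
  · subst hp
    have h1 : VectorField.mlieBracket 𝓘(ℂ, ℂ) (anchor Q ξ) (anchor Q ξ') x = 0 := by
      rw [← VectorField.mlieBracketWithin_univ]
      exact VectorField.mlieBracketWithin_eq_zero_of_eq_zero (S.anchor_self hξ hx)
        (S.anchor_self hξ' hx)
    rw [h1]
    have ht : Q.t (S.B (0, 0)) ∈ V := by rwa [S.t_B0]
    have hc := contMDiffAt_section hV hξ ht
    have hc' := contMDiffAt_section hV hξ' ht
    have hB := S.isCoord_B (0, 0)
    -- The component along `f` vanishes near the point, so its derivative vanishes and the bracket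
    -- has no such component.
    have h2 : ∀ {ξ : Q.Arrow → ℂ × ℂ}, G.IsAlgebroidSection V ξ →
        ∀ w, (fderiv ℂ (coordField S.B ξ) (0, 0) w).1 = 0 := by
      intro ξ hξ w
      have h3 := (hB.contDiffAt_coordField (contMDiffAt_section hV hξ ht)).differentiableAt
        (by simp)
      have h4 := (hasFDerivAt_fst.comp (0, 0) h3.hasFDerivAt).congr_of_eventuallyEq
        (f₁ := fun _ ↦ (0 : ℂ)) (by
          filter_upwards [(Q.contMDiff_t.continuous.comp
            S.contMDiff_B.continuous).continuousAt.eventually_mem (hV.mem_nhds ht)] with v hv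
          obtain ⟨b, hb, -⟩ := S.exists_section_B hξ hv
          rw [Function.comp_apply, hb])
      exact congrArg (fun L : ℂ × ℂ →L[ℂ] ℂ ↦ L w)
        (h4.unique (hasFDerivAt_const (0 : ℂ) ((0, 0) : ℂ × ℂ)))
    have h5 := hB.mlieBracket_eq hc hc'
    have h6 : VectorField.lieBracket ℂ (coordField S.B ξ) (coordField S.B ξ') (0, 0) =
        (0, (VectorField.lieBracket ℂ (coordField S.B ξ) (coordField S.B ξ') (0, 0)).2) := by
      refine Prod.ext ?_ rfl
      rw [VectorField.lieBracket, Prod.fst_sub, h2 hξ, h2 hξ', sub_zero]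
    rw [h6] at h5
    refine (anchor_eq (VectorField.mlieBracket 𝓘(ℂ, ℂ × ℂ) ξ ξ') x).trans ?_
    have h7 := S.mder_t_B_zero 0
      (VectorField.lieBracket ℂ (coordField S.B ξ) (coordField S.B ξ') (0, 0)).2
    rw [← h5] at h7
    rw [S.one_self]
    exact h7
  · obtain ⟨u, rfl⟩ : ∃ u, x = away p u := ⟨_, (away_awayInv p hp).symm⟩
    have ht : Q.t (S.E (u, u)) ∈ V := by rwa [S.t_E]
    have h1 := (S.isCoord_E (u, u)).mlieBracket_eq (contMDiffAt_section hV hξ ht)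
      (contMDiffAt_section hV hξ' ht)
    have hη := fun {ξ : Q.Arrow → ℂ × ℂ} (hξ : G.IsAlgebroidSection V ξ) ↦
      (S.isTwistedField_anchor hV hξ).contMDiffOn.contMDiffAt (hV.mem_nhds hx)
    have h2 := (isCoord_away p u).mlieBracket_eq (hη hξ) (hη hξ')
    have hd := fun {ξ : Q.Arrow → ℂ × ℂ} (hξ : G.IsAlgebroidSection V ξ) ↦
      ((isCoord_away p u).contDiffAt_coordField (hη hξ)).differentiableAt (by simp)
    have h3 : ∀ {ξ : Q.Arrow → ℂ × ℂ}, G.IsAlgebroidSection V ξ →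
        coordField S.E ξ =ᶠ[𝓝 (u, u)] fun v ↦ (0, coordField (away p) (anchor Q ξ) v.2) := by
      intro ξ hξ
      filter_upwards [((contMDiff_away p).continuous.comp
        continuous_snd).continuousAt.eventually_mem (hV.mem_nhds (hx : (away p ∘ Prod.snd) (u, u) ∈ V))] with v hv using S.coordField_E hξ hv
    have h4 : VectorField.lieBracket ℂ (coordField S.E ξ) (coordField S.E ξ') (u, u) =
        (0, VectorField.lieBracket ℂ (coordField (away p) (anchor Q ξ))
          (coordField (away p) (anchor Q ξ')) u) := by
      rw [VectorField.lieBracket, (h3 hξ).fderiv_eq, (h3 hξ').fderiv_eq,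
        fderiv_prodMk_zero_snd (hd hξ'), fderiv_prodMk_zero_snd (hd hξ), (h3 hξ).eq_of_nhds,
        (h3 hξ').eq_of_nhds, VectorField.lieBracket]
      exact Prod.ext (sub_self 0) rfl
    refine (anchor_eq (VectorField.mlieBracket 𝓘(ℂ, ℂ × ℂ) ξ ξ') (away p u)).trans
      (Eq.trans ?_ h2.symm)
    have h5 := S.mder_t_E (u, u) (0, VectorField.lieBracket ℂ (coordField (away p) (anchor Q ξ))
          (coordField (away p) (anchor Q ξ')) u)
    rw [S.one_away_eq_E]
    refine Eq.trans ?_ h5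
    rw [← h4]
    exact congrArg _ h1

end Section

section Surjective

variable {V : Set (OnePoint ℂ)} (η : OnePoint ℂ → ℂ) (a : ℂ)

open Classical in
/-- The right-invariant vector field with anchor `η`; here `-f ^ (k + 2) • a` is the leading term of
`η` at `p`. -/
def liftField (g : Q.Arrow) : ℂ × ℂ :=
  if Q.s g = p then mder (ℂ × ℂ) (ℂ × ℂ) S.B (0, S.c g) (0, a)
  else mder (ℂ × ℂ) (ℂ × ℂ) S.E (ends p g) (0, coordField (away p) η (ends p g).2)

theorem liftField_B (x : ℂ) :
    S.liftField η a (S.B (0, x)) = mder (ℂ × ℂ) (ℂ × ℂ) S.B (0, x) (0, a) := by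
  rw [liftField, if_pos (S.s_B0 x), S.c_B']

theorem liftField_E (v : ℂ × ℂ) : S.liftField η a (S.E v) =
    mder (ℂ × ℂ) (ℂ × ℂ) S.E v (0, coordField (away p) η v.2) := by
  rw [liftField, if_neg (S.s_E_ne v), S.ends_E]

theorem mder_s_liftField (g : Q.Arrow) : mder (ℂ × ℂ) ℂ Q.s g (S.liftField η a g) = 0 := by
  by_cases hg : Q.s g = p
  · obtain ⟨x, -, rfl⟩ := S.exists_eq_B hg
    rw [liftField_B, S.mder_s_B, map_zero]
  · obtain ⟨v, rfl⟩ : ∃ v, g = S.E v := ⟨_, (S.E_ends hg).symm⟩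
    rw [liftField_E, S.mder_s_E, map_zero]

theorem mder_t_liftField {g : Q.Arrow} (hg : Q.s g ≠ p) :
    mder (ℂ × ℂ) ℂ Q.t g (S.liftField η a g) = η (Q.t g) := by
  obtain ⟨v, rfl⟩ : ∃ v, g = S.E v := ⟨_, (S.E_ends hg).symm⟩
  rw [liftField_E, S.mder_t_E, (isCoord_away p v.2).mder_coordField, S.t_E]

/-- Over `p` right translation is a translation of the coordinate `c`, in which the field is the
constant `a`. Elsewhere both vectors have the same images under the derivatives of source and
target. -/
theorem liftField_mul {g h : Q.Arrow} (hgh : Q.s g = Q.t h) {L : ℂ × ℂ →L[ℂ] ℂ × ℂ}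
    (hL : HasMFDerivWithinAt 𝓘(ℂ, ℂ × ℂ) 𝓘(ℂ, ℂ × ℂ) (fun g' ↦ S.lieGroupoid.mul g' h)
      {g' | Q.s g' = Q.t h} g L) :
    L (S.liftField η a g) = S.liftField η a (S.lieGroupoid.mul g h) := by
  by_cases hp : Q.s h = p
  · have hg : Q.s g = p := hgh.trans (S.t_eq hp)
    obtain ⟨x, -, rfl⟩ := S.exists_eq_B hp
    obtain ⟨y, -, rfl⟩ := S.exists_eq_B hg
    have hm : ∀ y, S.lieGroupoid.mul (S.B (0, y)) (S.B (0, x)) = S.B (0, x + y) := S.mul_B x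
    obtain ⟨h1, h2⟩ := mder_line (S.isCoord_B (0, y)).mdifferentiableAt a
    obtain ⟨h3, h4⟩ := mder_line (S.isCoord_B (0, x + y)).mdifferentiableAt a
    have h5 : (fun τ : ℂ ↦ S.B (0, y + τ * a)) 0 = S.B (0, y) := by simp
    rw [← h5] at hL
    obtain ⟨-, h6⟩ := hL.mder_comp_curve h1 fun τ ↦ by
      change Q.s _ = _; rw [S.s_B0, S.t_B0]
    have h7 : (fun g' ↦ S.lieGroupoid.mul g' (S.B (0, x))) ∘ (fun τ : ℂ ↦ S.B (0, y + τ * a)) =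
        fun τ ↦ S.B (0, x + y + τ * a) := by
      funext τ
      rw [Function.comp_apply, hm, add_assoc]
    rw [h7] at h6
    rw [hm, liftField_B, liftField_B, ← h2, ← h4]
    exact h6.symm
  · obtain ⟨h1, h2⟩ := S.mder_mul S.lieGroupoid hgh hL (S.mder_s_liftField η a g)
    have hs : Q.s (S.lieGroupoid.mul g h) = Q.s h := S.lieGroupoid.s_mul g h hgh
    have ht : Q.t (S.lieGroupoid.mul g h) = Q.t g := S.lieGroupoid.t_mul g h hgh
    have hg : Q.s g ≠ p := hgh ▸ S.t_ne h hp
    refine S.eq_of_mder_eq (hs.trans_ne hp) ?_ ?_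
    · rw [h1, mder_s_liftField]
    · rw [h2, S.mder_t_liftField η a hg, S.mder_t_liftField η a (hs.trans_ne hp), ht]

theorem contMDiffAt_liftField_of_ne {g : Q.Arrow} (hg : Q.s g ≠ p)
    (hη : ContMDiffAt 𝓘(ℂ, ℂ) 𝓘(ℂ, ℂ).tangent ω
      (fun x ↦ (⟨x, η x⟩ : TangentBundle 𝓘(ℂ, ℂ) (OnePoint ℂ))) (Q.t g)) :
    ContMDiffAt 𝓘(ℂ, ℂ × ℂ) 𝓘(ℂ, ℂ × ℂ).tangent ω
      (fun g ↦ (⟨g, S.liftField η a g⟩ : TangentBundle 𝓘(ℂ, ℂ × ℂ) Q.Arrow)) g := by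
  obtain ⟨v, rfl⟩ : ∃ v, g = S.E v := ⟨_, (S.E_ends hg).symm⟩
  rw [S.t_E] at hη
  have h1 : ContDiffAt ℂ ω (fun v : ℂ × ℂ ↦ ((0, coordField (away p) η v.2) : ℂ × ℂ)) v :=
    contDiffAt_const.prodMk
      (((isCoord_away p v.2).contDiffAt_coordField hη).comp v contDiffAt_snd)
  refine (S.isCoord_E v).contMDiffAt_of_coordField h1 ?_
  filter_upwards [Q.contMDiff_s.continuous.continuousAt.eventually_ne hg] with h hh
  refine ⟨S.isCoord_E _, S.E_ends hh, ?_⟩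
  conv_lhs => rw [← S.E_ends hh]
  exact S.liftField_E η a _

theorem contMDiffAt_liftField_self {χ : ℂ → ℂ} (hχ : AnalyticAt ℂ χ 0)
    (hη : ∀ᶠ f in 𝓝 0, mder ℂ ℂ (nearInv p) (near p f) (η (near p f)) = f ^ (k + 2) * χ f)
    {g : Q.Arrow} (hg : Q.s g = p) :
    ContMDiffAt 𝓘(ℂ, ℂ × ℂ) 𝓘(ℂ, ℂ × ℂ).tangent ω
      (fun g ↦ (⟨g, S.liftField η (-χ 0) g⟩ : TangentBundle 𝓘(ℂ, ℂ × ℂ) Q.Arrow)) g := by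
  obtain ⟨x, -, rfl⟩ := S.exists_eq_B hg
  set ρ : ℂ × ℂ → ℂ := fun v ↦ 1 + v.2 * v.1 ^ (k + 1)
  have hρ : ContDiff ℂ ω ρ := contDiff_const.add (contDiff_snd.mul (contDiff_fst.pow _))
  have hρ0 : ρ (0, x) ≠ 0 := by simp [ρ]
  set f' : ℂ × ℂ → ℂ := fun v ↦ v.1 / ρ v
  have hf' : ContDiffAt ℂ ω f' (0, x) := contDiffAt_fst.div hρ.contDiffAt hρ0
  have hf'0 : f' (0, x) = 0 := zero_div _
  -- By `mder_nearInv_t_B` the derivative of the target sends `(0, b)` to `-b * f ^ (k + 2) / ρ ^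
  -- 2`, which must be `η` at the target, that is `(f / ρ) ^ (k + 2) * χ (f / ρ)`. The powers of `f`
  -- cancel; at `f = 0` the solution is the constant `-χ 0` used in `liftField`.
  set b : ℂ × ℂ → ℂ := fun v ↦ -χ (f' v) / ρ v ^ k
  have hb : ContDiffAt ℂ ω b (0, x) := by
    have h1 : ContDiffAt ℂ ω χ (f' (0, x)) := by rw [hf'0]; exact hχ.contDiffAt
    exact (h1.comp (0, x) hf').neg.div (hρ.contDiffAt.pow k) (pow_ne_zero _ hρ0)
  have hβ : ContinuousAt S.β (S.B (0, x)) :=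
    (S.isCoord_B (0, x)).contMDiffAt_symm.continuousAt
  have hβ0 : S.β (S.B (0, x)) = (0, x) := (S.isCoord_B (0, x)).apply_symm
  have e1 : ∀ᶠ h in 𝓝 (S.B (0, x)), ρ (S.β h) ≠ 0 :=
    (ContinuousAt.comp (f := S.β) (g := ρ) hρ.continuous.continuousAt hβ).eventually_ne
      (by rwa [Function.comp_apply, hβ0])
  have e2 : ∀ᶠ h in 𝓝 (S.B (0, x)), mder ℂ ℂ (nearInv p) (near p (f' (S.β h)))
      (η (near p (f' (S.β h)))) = f' (S.β h) ^ (k + 2) * χ (f' (S.β h)) := by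
    have h1 : ContinuousAt f' (S.β (S.B (0, x))) := by rw [hβ0]; exact hf'.continuousAt
    have h2 : Tendsto (fun h ↦ f' (S.β h)) (𝓝 (S.B (0, x))) (𝓝 0) := by
      have := (ContinuousAt.comp (f := S.β) (g := f') h1 hβ).tendsto
      rwa [Function.comp_apply, hβ0, hf'0] at this
    exact h2.eventually hη
  refine (S.isCoord_B (0, x)).contMDiffAt_of_coordField
    (a := fun v ↦ (0, b v)) (contDiffAt_const.prodMk hb) ?_
  filter_upwards [e1, e2, Q.contMDiff_s.continuous.continuousAt.eventually_ne
    (s_ne_of_eq hg)] with h h1 h2 h3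
  refine ⟨S.isCoord_B _, S.B_β h3, ?_⟩
  by_cases hp : Q.s h = p
  · obtain ⟨y, -, rfl⟩ := S.exists_eq_B hp
    have hy : S.β (S.B (0, y)) = (0, y) := S.β_B (mem_univ _)
    rw [hy, S.liftField_B]
    simp [b, ρ, f']
  · obtain ⟨v, rfl⟩ : ∃ v, h = S.B v := ⟨_, (S.B_β h3).symm⟩
    obtain ⟨f, y⟩ := v
    have hy : S.β (S.B (f, y)) = (f, y) := S.β_B (mem_univ _)
    rw [hy] at h1 h2 ⊢
    have ht : Q.t (S.B (f, y)) = near p (f' (f, y)) := S.t_B' h1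
    refine S.eq_of_mder_eq hp ?_ ?_
    · rw [S.mder_s_liftField, S.mder_s_B, map_zero]
    · rw [S.mder_t_liftField η _ hp]
      have h6 := S.mder_nearInv_t_B h1 (b (f, y))
      have h7 : ∀ w w' : ℂ, mder ℂ ℂ (nearInv p) (Q.t (S.B (f, y))) w =
          mder ℂ ℂ (nearInv p) (Q.t (S.B (f, y))) w' → w = w' := by
        intro w w' hw
        rw [ht] at hw
        rw [← (isCoord_near p (f' (f, y))).mder_mder_symm w, hw, IsCoord.mder_mder_symm]
        exact isCoord_near p _
      apply h7
      rw [h6, ht, h2]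
      simp only [f', b, ρ] at h1 ⊢
      rw [div_pow]
      field_simp
      ring

/-- The leading coefficient at `p` of a section of `T(-(k + 2) • p)`. -/
theorem exists_eq_pow_mul (hη : IsTwistedField p (k + 2) V η) (hp : p ∈ V) :
    ∃ χ : ℂ → ℂ, AnalyticAt ℂ χ 0 ∧
      ∀ᶠ f in 𝓝 0, mder ℂ ℂ (nearInv p) (near p f) (η (near p f)) = f ^ (k + 2) * χ f := by
  have h1 := hη.order hp
  set c₀ := chartAt ℂ p p
  set F : ℂ → ℂ := fun z ↦ mder ℂ ℂ (chartAt ℂ p) ((chartAt ℂ p).symm z)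
    (η ((chartAt ℂ p).symm z)) with hF
  change ((k + 2 : ℕ) : ℕ∞) ≤ analyticOrderAt F c₀ at h1
  have h2 : AnalyticAt ℂ F c₀ := by
    -- The order of a function that is not analytic is `0` by convention, less than `k + 2`.
    by_contra h
    rw [analyticOrderAt_of_not_analyticAt h] at h1
    simp at h1
  obtain ⟨χ, h3, h4⟩ := (natCast_le_analyticOrderAt h2).1 h1
  have h5 : Tendsto (fun f : ℂ ↦ c₀ + f) (𝓝 0) (𝓝 c₀) := by
    have h6 : Continuous fun f : ℂ ↦ c₀ + f := by fun_prop
    simpa using h6.tendsto 0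
  refine ⟨fun f ↦ χ (c₀ + f), ?_, ?_⟩
  · have h6 : AnalyticAt ℂ χ (c₀ + 0) := by rwa [add_zero]
    exact h6.comp (f := fun f ↦ c₀ + f) (by fun_prop)
  · filter_upwards [h5.eventually h4] with f hf
    simp only [hF, smul_eq_mul, add_sub_cancel_left] at hf
    rw [chartAt_symm_add, mder_chartAt_near] at hf
    exact hf

theorem exists_section (hV : IsOpen V) (hη : IsTwistedField p (k + 2) V η) :
    ∃ ξ : Q.Arrow → ℂ × ℂ, S.lieGroupoid.IsAlgebroidSection V ξ ∧
      ∀ x ∈ V, (anchor Q ξ x : ℂ) = η x := by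
  -- If `p ∉ V`, no arrow over `p` has its target in `V`, and `χ` is irrelevant.
  obtain ⟨χ, hχ⟩ : ∃ χ : ℂ → ℂ, p ∈ V → AnalyticAt ℂ χ 0 ∧
      ∀ᶠ f in 𝓝 0, mder ℂ ℂ (nearInv p) (near p f) (η (near p f)) = f ^ (k + 2) * χ f := by
    by_cases hp : p ∈ V
    · obtain ⟨χ, hχ⟩ := exists_eq_pow_mul η hη hp
      exact ⟨χ, fun _ ↦ hχ⟩
    · exact ⟨0, fun h ↦ absurd h hp⟩
  refine ⟨S.liftField η (-χ 0), ⟨fun g hg ↦ ?_, fun g _ ↦ S.mder_s_liftField η _ g,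
    fun g h _ hgh L hL ↦ S.liftField_mul η _ hgh hL⟩, fun x hx ↦ ?_⟩
  · refine ContMDiffAt.contMDiffWithinAt ?_
    by_cases hp : Q.s g = p
    · obtain ⟨h1, h2⟩ := hχ (S.t_eq hp ▸ hg)
      exact S.contMDiffAt_liftField_self η h1 h2 hp
    · exact S.contMDiffAt_liftField_of_ne η _ hp (hη.contMDiffOn.contMDiffAt (hV.mem_nhds hg))
  · rw [anchor_eq]
    by_cases hp : x = p
    · subst hp
      have h1 := (hχ hx).2.self_of_nhds
      rw [near_zero, zero_pow (by omega), zero_mul] at h1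
      have h2 := (isCoord_near x 0).mder_mder_symm (η x)
      rw [near_zero, h1, map_zero] at h2
      rw [S.one_self, ← h2]
      refine (congrArg _ (S.liftField_B η _ 0)).trans (S.mder_t_B_zero 0 _)
    · rw [S.mder_t_liftField η _ (by rwa [Q.s_one]), Q.t_one]

end Surjective

theorem integrates : S.lieGroupoid.Integrates p (k + 2) where
  mapsTo _ hV _ hξ := S.isTwistedField_anchor hV hξ
  injective _ hV _ _ hξ hξ' h _ hg := S.section_eq hV hξ hξ' h hg
  surjective _ hV η hη := S.exists_section η hV hη
  bracket _ hV _ _ hξ hξ' _ hx := S.anchor_mlieBracket hV hξ hξ' hx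

end Std

end PLine

/-! ### The main theorem -/

namespace PLine

theorem pairGroupoid_mul_eq (p : OnePoint ℂ) {k : ℕ} (hk : 2 ≤ k)
    (G : LieGroupoid (pairGraph p k)) {g h : (pairGraph p k).Arrow}
    (hgh : (pairGraph p k).s g = (pairGraph p k).t h) :
    G.mul g h = (pairGroupoid p k hk).mul g h := by
  obtain ⟨k, rfl⟩ := Nat.exists_eq_add_of_le' hk
  exact (stdPair p k).mul_eq _ G hgh

theorem isFundamentalGroupoid_pairGroupoid (p : OnePoint ℂ) {k : ℕ} (hk : 2 ≤ k) :
    (pairGroupoid p k hk).IsFundamentalGroupoid p k := by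
  obtain ⟨k, rfl⟩ := Nat.exists_eq_add_of_le' hk
  exact ⟨(stdPair p k).integrates, (stdPair p k).sourceSimplyConnected⟩

end PLine

end

/-- Uniqueness of the groupoid structure is equality of products on composable pairs: elsewhere
`mul` carries no information, and the inversion is determined by the product and the identities. -/
theorem mainTheorem6 (p : OnePoint ℂ) :
    ∃ (G : ∀ k, 2 ≤ k → LieGroupoid (PLine.pairGraph p k))
      (Φ : ∀ k, 2 ≤ k → PLine.PairTotIso p k),
      (∀ (k : ℕ) (hk : 2 ≤ k),
        (∀ (G' : LieGroupoid (PLine.pairGraph p k)) (g h : (PLine.pairGraph p k).Arrow),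
          (PLine.pairGraph p k).s g = (PLine.pairGraph p k).t h →
            G'.mul g h = (G k hk).mul g h) ∧
        PLine.IsCanonical p k (Φ k hk) ∧
        (∀ Ψ : PLine.PairTotIso p k, PLine.IsCanonical p k Ψ → Ψ = Φ k hk) ∧
        (G k hk).SourceSimplyConnected ∧
        (G k hk).IsFundamentalGroupoid p k) ∧
      (∀ (k n : ℕ) (hk : 2 ≤ k),
        (G (k + n) (Nat.le_add_right_of_le hk)).IsMorphism (G k hk) (PLine.pairMap p k n) ∧
        ∀ g, Φ k hk (PLine.pairMap p k n g) =
          PLine.natMap p k n (Φ (k + n) (Nat.le_add_right_of_le hk) g)) := by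
  refine ⟨PLine.pairGroupoid p, fun k hk ↦ (PLine.stdPairOfLe p k hk).iso hk, fun k hk ↦
    ⟨fun G' g h hgh ↦ PLine.pairGroupoid_mul_eq p hk G' hgh,
      (PLine.stdPairOfLe p k hk).isCanonical_iso hk,
      fun Ψ hΨ ↦ (PLine.stdPairOfLe p k hk).eq_iso hk hΨ,
      (PLine.isFundamentalGroupoid_pairGroupoid p hk).sourceSimplyConnected,
      PLine.isFundamentalGroupoid_pairGroupoid p hk⟩,
    fun k n hk ↦ ⟨PLine.isMorphism_pairMap p k n hk, PLine.iso_pairMap p k n hk⟩⟩
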